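/- Let $\varpi(n)=\log n$ if $n$ is prime and $\varpi(n)=0$ otherwise, and let $\varpi*\varpi(n)=\sum_{d\mid n}\varpi(d)\varpi(n/d)$. Let $\gamma$ be Euler's constant, let $\phi$ be Euler's function, and put $C_0=2\log 2-2\gamma-1-2\sum_p\frac{\log p}{p(p-1)}$. For real $x\ge 1$, an integer $q\ge 1$ and $a$ coprime to $q$, define $E(x;q,a)$ and $E_2(x;q,a)$ by $$\sum_{\substack{x<n\le 2x\\ n\equiv a\,(\mathrm{mod}\, q)}}\varpi(n)=\frac{x}{\phi(q)}+E(x;q,a),$$ $$\sum_{\substack{x<n\le 2x\\ n\equiv a\,(\mathrm{mod}\, q)}}\varpi*\varpi(n)=\frac{x}{\phi(q)}\Bigl(\log x+C_0-2\sum_{p\mid q}\frac{\log p}{p}\Bigr)+E_2(x;q,a),$$ where $p$ runs over primes. Put $$E^*(N,q)=\sup_{1\le x\le N}\ \max_{(a,q)=1}|E(x;q,a)|,\qquad E_2^*(N,q)=\sup_{1\le x\le N}\ \max_{(a,q)=1}|E_2(x;q,a)|.$$ For $1/2<\theta\le 1$, let $BV(\theta)$ be the hypothesis that for all $A>0$ and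 $\epsilon>0$, $$\sum_{q\le N^{\theta-\epsilon}}E^*(N,q)\ll_{A,\epsilon}N(\log N)^{-A}\qquad(N\to\infty),$$ and let $BV_2(\theta)$ be the same hypothesis with $E_2^*$ in place of $E^*$. Let $q_n$ denote the $n$-th number that is a product of exactly two distinct primes. Theorem. If $BV(\theta)$ and $BV_2(\theta)$ are both true for some $\theta$ with $\frac{75-\sqrt{473}}{56}<\theta\le 1$ (where $\frac{75-\sqrt{473}}{56}=0.950918\ldots$), then $$\liminf_{n\to\infty}(q_{n+1}-q_n)\le 6.$$ -/

import Mathlib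

noncomputable section

namespace GapsE2

open Filter Asymptotics

/-- The function `ϖ`: `ϖ(n) = log n` if `n` is prime, and `ϖ(n) = 0` otherwise. -/
def varpi (n : ℕ) : ℝ := if n.Prime then Real.log n else 0

/-- The Dirichlet convolution `ϖ * ϖ (n) = ∑_{d ∣ n} ϖ(d) ϖ(n/d)`. -/
def varpi2 (n : ℕ) : ℝ := ∑ d ∈ n.divisors, varpi d * varpi (n / d)

/-- The sum of `f n` over the natural numbers `x < n ≤ 2 x` with `n ≡ a (mod q)`, for real `x ≥ 0`. -/
def dyadicSum (f : ℕ → ℝ) (x : ℝ) (q : ℕ) (a : ZMod q) : ℝ :=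
  ∑ n ∈ (Finset.Ioc ⌊x⌋₊ ⌊2 * x⌋₊).filter (fun n : ℕ => (n : ZMod q) = a), f n

/-- The constant `C₀ = 2 log 2 - 2 γ - 1 - 2 ∑_p (log p) / (p (p - 1))`. -/
def C₀ : ℝ :=
  2 * Real.log 2 - 2 * Real.eulerMascheroniConstant - 1
    - 2 * ∑' p : Nat.Primes, Real.log (p : ℕ) / (((p : ℕ) : ℝ) * (((p : ℕ) : ℝ) - 1))

/-- The error term `E(x; q, a)` for `ϖ`. -/
def err (x : ℝ) (q : ℕ) (a : ZMod q) : ℝ :=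
  dyadicSum varpi x q a - x / (q.totient : ℝ)

/-- The error term `E₂(x; r, a)` for `ϖ * ϖ`. -/
def err2 (x : ℝ) (r : ℕ) (a : ZMod r) : ℝ :=
  dyadicSum varpi2 x r a
    - x / (r.totient : ℝ)
      * (Real.log x + C₀ - 2 * ∑ p ∈ r.primeFactors, Real.log p / (p : ℝ))

/-- `E(x, q)`: the maximum of `|E(x; q, a)|` over the reduced residue classes `a` mod `q`. -/
def errMax (x : ℝ) (q : ℕ) : ℝ := ⨆ a : (ZMod q)ˣ, |err x q (a : ZMod q)|

/-- `E₂(x, r)`: the maximum of `|E₂(x; r, a)|` over the reduced residue classes `a` mod `r`. -/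
def err2Max (x : ℝ) (r : ℕ) : ℝ := ⨆ a : (ZMod r)ˣ, |err2 x r (a : ZMod r)|

/-- `E*(N, q)`: the supremum of `E(x, q)` over real `1 ≤ x ≤ N`. -/
def errStar (N : ℝ) (q : ℕ) : ℝ := sSup ((fun x : ℝ => errMax x q) '' Set.Icc 1 N)

/-- `E₂*(N, r)`: the supremum of `E₂(x, r)` over real `1 ≤ x ≤ N`. -/
def err2Star (N : ℝ) (r : ℕ) : ℝ := sSup ((fun x : ℝ => err2Max x r) '' Set.Icc 1 N)

/-- `ϖ` has level of distribution `θ`: for all `A, ε > 0`,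
`∑_{q ≤ N^(θ - ε)} E*(N, q) ≪_{A, ε} N (log N)^(-A)`. -/
def HypBV (θ : ℝ) : Prop :=
  ∀ A : ℝ, 0 < A → ∀ ε : ℝ, 0 < ε →
    (fun N : ℝ => ∑ q ∈ Finset.Icc 1 ⌊N ^ (θ - ε)⌋₊, errStar N q)
      =O[atTop] (fun N : ℝ => N * Real.log N ^ (-A))

/-- `ϖ * ϖ` has level of distribution `θ`: for all `A, ε > 0`,
`∑_{r ≤ N^(θ - ε)} E₂*(N, r) ≪_{A, ε} N (log N)^(-A)`. -/
def HypBV2 (θ : ℝ) : Prop :=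
  ∀ A : ℝ, 0 < A → ∀ ε : ℝ, 0 < ε →
    (fun N : ℝ => ∑ r ∈ Finset.Icc 1 ⌊N ^ (θ - ε)⌋₊, err2Star N r)
      =O[atTop] (fun N : ℝ => N * Real.log N ^ (-A))

/-- `n` is a product of exactly two (distinct) primes. -/
def IsE2 (n : ℕ) : Prop := ∃ p q : ℕ, p.Prime ∧ q.Prime ∧ p ≠ q ∧ n = p * q

/-- The increasing enumeration of the products of two distinct primes (starting at index `0`). -/
def qSeq (n : ℕ) : ℕ := Nat.nth IsE2 n

/-! The suprema, the series and the enumeration above are genuine: none takes a default value. -/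

theorem infinite_setOf_isE2 : {n | IsE2 n}.Infinite := by
  have h : ((fun p : ℕ => 2 * p) '' ({p | p.Prime} \ {2})).Infinite := by
    refine Set.Infinite.image (fun a _ b _ hab => by simpa using hab) ?_
    exact Nat.infinite_setOfPred_prime.sdiff (Set.finite_singleton 2)
  refine h.mono ?_
  rintro _ ⟨p, ⟨hp, hp2⟩, rfl⟩
  exact ⟨2, p, Nat.prime_two, hp, fun h => hp2 h.symm, rfl⟩

theorem strictMono_qSeq : StrictMono qSeq := Nat.nth_strictMono infinite_setOf_isE2

theorem summable_C₀ : Summable (fun p : Nat.Primes =>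
    Real.log (p : ℕ) / (((p : ℕ) : ℝ) * (((p : ℕ) : ℝ) - 1))) := by
  have h : Summable (fun p : Nat.Primes => 4 * (((p : ℕ) : ℝ) ^ (-(3 / 2) : ℝ))) :=
    ((Nat.Primes.summable_rpow).2 (by norm_num)).mul_left 4
  refine h.of_nonneg_of_le (fun p => ?_) (fun p => ?_)
  · have : (2 : ℝ) ≤ ((p : ℕ) : ℝ) := by exact_mod_cast p.2.two_le
    have h1 : 0 ≤ Real.log ((p : ℕ) : ℝ) := Real.log_nonneg (by linarith)
    have : 0 ≤ ((p : ℕ) : ℝ) - 1 := by linarith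
    positivity
  · have h2 : (2 : ℝ) ≤ ((p : ℕ) : ℝ) := by exact_mod_cast p.2.two_le
    have h0 : (0 : ℝ) < ((p : ℕ) : ℝ) := by linarith
    have hl := Real.log_le_rpow_div h0.le (ε := 1 / 2) (by norm_num)
    have e : ((p : ℕ) : ℝ) ^ (-(3 / 2) : ℝ)
        = ((p : ℕ) : ℝ) ^ (1 / 2 : ℝ) / ((p : ℕ) : ℝ) ^ 2 := by
      rw [← Real.rpow_natCast, ← Real.rpow_sub h0]; norm_num
    have hs : 0 < ((p : ℕ) : ℝ) ^ (1 / 2 : ℝ) := Real.rpow_pos_of_pos h0 _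
    rw [e, ← mul_div_assoc, div_le_div_iff₀ (by nlinarith) (by positivity)]
    have h3 : ((p : ℕ) : ℝ) ^ 2 ≤ 2 * (((p : ℕ) : ℝ) * (((p : ℕ) : ℝ) - 1)) := by nlinarith
    have h4 : Real.log ((p : ℕ) : ℝ) ≤ 2 * ((p : ℕ) : ℝ) ^ (1 / 2 : ℝ) := by linarith
    calc _ ≤ (2 * ((p : ℕ) : ℝ) ^ (1 / 2 : ℝ)) * ((p : ℕ) : ℝ) ^ 2 := by gcongr
      _ ≤ (2 * ((p : ℕ) : ℝ) ^ (1 / 2 : ℝ))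
            * (2 * (((p : ℕ) : ℝ) * (((p : ℕ) : ℝ) - 1))) := by gcongr
      _ = _ := by ring

theorem varpi_nonneg (n : ℕ) : 0 ≤ varpi n := by
  unfold varpi; split_ifs
  · exact Real.log_natCast_nonneg n
  · exact le_rfl

theorem varpi2_nonneg (n : ℕ) : 0 ≤ varpi2 n :=
  Finset.sum_nonneg fun _ _ => mul_nonneg (varpi_nonneg _) (varpi_nonneg _)

theorem abs_dyadicSum_le {f : ℕ → ℝ} (hf : ∀ n, 0 ≤ f n) {x N : ℝ} (hx : x ≤ N) (q : ℕ)
    (a : ZMod q) : |dyadicSum f x q a| ≤ ∑ n ∈ Finset.range (⌊2 * N⌋₊ + 1), f n := by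
  unfold dyadicSum
  rw [abs_of_nonneg (Finset.sum_nonneg fun n _ => hf n)]
  refine Finset.sum_le_sum_of_subset_of_nonneg ?_ fun n _ _ => hf n
  intro n hn
  rw [Finset.mem_filter, Finset.mem_Ioc] at hn
  rw [Finset.mem_range]
  have : ⌊2 * x⌋₊ ≤ ⌊2 * N⌋₊ := Nat.floor_le_floor (by linarith)
  omega

theorem bddAbove_errStar (N : ℝ) (q : ℕ) :
    BddAbove ((fun x : ℝ => errMax x q) '' Set.Icc 1 N) := by
  refine ⟨(∑ n ∈ Finset.range (⌊2 * N⌋₊ + 1), varpi n) + N / (q.totient : ℝ), ?_⟩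
  rintro _ ⟨x, ⟨h1, hx⟩, rfl⟩
  refine ciSup_le fun a => ?_
  have hx0 : 0 ≤ x := by linarith
  refine (abs_sub _ _).trans (add_le_add (abs_dyadicSum_le varpi_nonneg hx q _) ?_)
  rw [abs_of_nonneg (by positivity)]
  gcongr

theorem bddAbove_err2Star (N : ℝ) (r : ℕ) :
    BddAbove ((fun x : ℝ => err2Max x r) '' Set.Icc 1 N) := by
  refine ⟨(∑ n ∈ Finset.range (⌊2 * N⌋₊ + 1), varpi2 n) + N / (r.totient : ℝ)
    * (Real.log N + |C₀ - 2 * ∑ p ∈ r.primeFactors, Real.log p / (p : ℝ)|), ?_⟩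
  rintro _ ⟨x, ⟨h1, hx⟩, rfl⟩
  refine ciSup_le fun a => ?_
  have hx0 : 0 < x := by linarith
  have hN : 0 < N := by linarith
  refine (abs_sub _ _).trans (add_le_add (abs_dyadicSum_le varpi2_nonneg hx r _) ?_)
  rw [abs_mul, abs_of_nonneg (by positivity : 0 ≤ x / (r.totient : ℝ)), add_sub_assoc]
  have hl : |Real.log x| ≤ Real.log N := by
    rw [abs_of_nonneg (Real.log_nonneg h1)]
    exact Real.log_le_log hx0 hx
  have h2 := (abs_add_le (Real.log x)
    (C₀ - 2 * ∑ p ∈ r.primeFactors, Real.log p / (p : ℝ))).trans (add_le_add hl le_rfl)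
  gcongr

end GapsE2

end

noncomputable section

open Filter Asymptotics Topology

namespace GapsE2

/-! ### Euler products with two complex variables -/

/-! Take `n ≡ 5 (mod 12)`. Then `n`, `n + 2`, `n + 6` are `5`, `7`, `11` modulo `12`, hence coprime
to `6` and never squares. At a nonsquare `m`, `ϖ * ϖ` is zero unless `m = p l` with distinct primes,
and then it equals `2 log p log l ≤ ½ log² m`. So if the average of `ϖ * ϖ` over the three shifts,
against nonnegative weights `Λ(n)²`, exceeds `½ log²(2N)` times the sum of `Λ(n)²`, some `n` has at
least two of the three shifts of the wanted form (`exists_isE2_pair_of_lt`). As `N` is arbitrarily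
large, gaps of size at most `6` recur.

The weights are `Λ(n) = ∑ μ(d) F(log d / log R)` over `d ≤ R = N^(η/2)` coprime to `6` with `d ∣ n
(n + 2) (n + 6)`, where `F` is smooth, vanishes on `[1, ∞)`, and `η < θ`. Expanding the square and
counting in residue classes leaves forms `∑ μ(d) μ(d') g([d, d']) F F`. A Laplace representation of
`F` turns such a form into an integral of an Euler product that behaves like `(ζ(1+s+s') / (ζ(1+s)
ζ(1+s')))^k`. Hence `(log R)^k` times the form tends to a singular series times `∫ F⁽ᵏ⁾(t+u)
F⁽ᵏ⁾(t+v) t^(k-1)/(k-1)! dt`, uniformly in shifts `u, v ≥ 0` of `F` (`exists_quadForm_error`).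
Unweighted sums have `k = 3` and density `3/p`; sums weighted by primes or by `ϖ * ϖ` have `k = 2`
and density `2/(p-1)`. The two singular series differ by the factor `3` (`singularSeries_triple`).

The weighted shift `m = p l` itself affects `Λ`. If both primes exceed `R` it contributes no
divisor. If `p ≤ R < l`, the divisors are `e` and `p e` with `e` dividing the other two shifts, and
`μ(p e) = -μ(e)` makes `Λ` the difference of the weights for `F` and for `F(· + log p / log R)`
(`sieveSum_insert_zero`). Squaring separates a sum of `ϖ * ϖ` against the two-shift weight,
evaluated with `BV₂` (`tendsto_pairSum`), from cross terms for each prime `p ≤ R`, where `m / p` is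
prime and `BV` is applied at `N / p` (`tendsto_sum_crossSum`). Each cross term contains a shifted
weight, supported on `e ≤ R / p`, so its moduli are at most `R² / p`; up to the factor `12` this is
within the level at `N / p`. Mertens' theorem turns the sum over `p` into an integral over `u = log
p / log R`.

Altogether it suffices that `I₃ < 3 (η J + η² D)`, where `I₃` and `J` are the limiting forms for `k
= 3` and `k = 2`, and `D` is the integrated cross density (`liminf_le_six_of_sieve_inequality`).
With `F''` close to `(1-t) + 2(1-t)²` on `[0, 1]`, `J` and `D` approach `5/12` and `-7/45`, while
`I₃ ≤ 23/30`. The condition becomes `28 η² - 75 η + 46 < 0`, and its smaller root is the threshold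
of the theorem. -/

theorem exists_norm_pow_sub_le (k : ℕ) : ∃ C : ℝ, 0 ≤ C ∧ ∀ (w : ℝ) (b c : ℂ), 0 ≤ w → w ≤ 1 / 2 →
    ‖c‖ ≤ 3 → ‖b - 1 - w * c‖ ≤ 34 * w ^ 2 → ‖b ^ k - 1 - k * w * c‖ ≤ C * w ^ 2 := by
  induction k with
  | zero => exact ⟨0, le_rfl, fun w b c _ _ _ _ => by simp⟩
  | succ k ih =>
    obtain ⟨C, hC, h⟩ := ih
    refine ⟨20 * C + 34 + 60 * k, by positivity, fun w b c hw hw2 hc hb => ?_⟩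
    have h1 := h w b c hw hw2 hc hb
    have hwc : ‖(w : ℂ) * c‖ ≤ 3 * w := by
      rw [norm_mul, Complex.norm_real, Real.norm_of_nonneg hw]; nlinarith
    -- Since `w ≤ 1/2`, `34 w² ≤ 17 w`; the constant is `20 = 17 + 3`.
    have hb1 : ‖b - 1‖ ≤ 20 * w := by
      calc ‖b - 1‖ = ‖(b - 1 - w * c) + w * c‖ := by ring_nf
        _ ≤ 34 * w ^ 2 + 3 * w := (norm_add_le _ _).trans (add_le_add hb hwc)
        _ ≤ 20 * w := by nlinarith
    have hb2 : ‖b‖ ≤ 20 := by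
      calc ‖b‖ = ‖(b - 1) + 1‖ := by ring_nf
        _ ≤ 20 * w + 1 := (norm_add_le _ _).trans (by rw [norm_one]; linarith)
        _ ≤ 20 := by linarith
    have e : b ^ (k + 1) - 1 - ((k + 1 : ℕ) : ℂ) * w * c
        = b * (b ^ k - 1 - k * w * c) + (b - 1 - w * c) + k * (w * c) * (b - 1) := by
      push_cast; ring
    rw [e]
    refine (norm_add₃_le).trans ?_
    have e1 : ‖b * (b ^ k - 1 - k * w * c)‖ ≤ 20 * (C * w ^ 2) := by
      rw [norm_mul]; gcongr
    have e2 : ‖(k : ℂ) * (w * c) * (b - 1)‖ ≤ k * (3 * w) * (20 * w) := by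
      rw [norm_mul, norm_mul, Complex.norm_natCast]; gcongr
    calc _ ≤ 20 * (C * w ^ 2) + 34 * w ^ 2 + k * (3 * w) * (20 * w) := by gcongr
      _ = _ := by ring

theorem norm_add_sub_mul_le {x y : ℂ} (hx : ‖x‖ ≤ 1) (hy : ‖y‖ ≤ 1) : ‖x + y - x * y‖ ≤ 3 := by
  refine (norm_sub_le _ _).trans ?_
  have := norm_add_le x y
  have : ‖x * y‖ ≤ 1 := by rw [norm_mul]; nlinarith [norm_nonneg x, norm_nonneg y]
  linarith

theorem half_le_norm_one_sub {w : ℝ} {x : ℂ} (hw : 0 ≤ w) (hw2 : w ≤ 1 / 2) (hx : ‖x‖ ≤ 1) :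
    1 / 2 ≤ ‖1 - (w : ℂ) * x‖ := by
  have h := norm_sub_norm_le (1 : ℂ) (w * x)
  have : ‖(w : ℂ) * x‖ ≤ 1 / 2 := by
    rw [norm_mul, Complex.norm_real, Real.norm_of_nonneg hw]; nlinarith [norm_nonneg x]
  rw [norm_one] at h; linarith

/-- First-order expansion in `w`. Over the common denominator the remainder is `w²` times a
polynomial of norm at most `8.5`, and the denominator has norm at least `1/4`: this is the constant
`34 = 4 · 8.5`. -/
theorem norm_quotient_sub_le {w : ℝ} {x y : ℂ} (hw : 0 ≤ w) (hw2 : w ≤ 1 / 2) (hx : ‖x‖ ≤ 1)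
    (hy : ‖y‖ ≤ 1) :
    ‖(1 - w * (x * y)) / ((1 - w * x) * (1 - w * y)) - 1 - w * (x + y - x * y)‖ ≤ 34 * w ^ 2 := by
  have h1 := half_le_norm_one_sub hw hw2 hx
  have h2 := half_le_norm_one_sub hw hw2 hy
  have n1 : 1 - (w : ℂ) * x ≠ 0 := fun h => by rw [h, norm_zero] at h1; linarith
  have n2 : 1 - (w : ℂ) * y ≠ 0 := fun h => by rw [h, norm_zero] at h2; linarith
  have hc := norm_add_sub_mul_le hx hy
  have hxy : ‖x * y‖ ≤ 1 := by rw [norm_mul]; nlinarith [norm_nonneg x, norm_nonneg y]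
  have e : (1 - w * (x * y)) / ((1 - w * x) * (1 - w * y)) - 1 - w * (x + y - x * y)
      = w ^ 2 * (-(x * y) + (x + y - x * y) * (x + y) - w * ((x * y) * (x + y - x * y)))
        / ((1 - w * x) * (1 - w * y)) := by
    field_simp; ring
  rw [e, norm_div, norm_mul, norm_mul, norm_pow, Complex.norm_real, Real.norm_of_nonneg hw,
    div_le_iff₀ (by positivity)]
  have hs : ‖x + y‖ ≤ 2 := (norm_add_le _ _).trans (by linarith)
  have hn : ‖-(x * y) + (x + y - x * y) * (x + y) - w * ((x * y) * (x + y - x * y))‖ ≤ 8.5 := by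
    refine (norm_sub_le _ _).trans ?_
    have a1 : ‖-(x * y) + (x + y - x * y) * (x + y)‖ ≤ 1 + 3 * 2 := by
      refine (norm_add_le _ _).trans ?_
      rw [norm_neg, norm_mul (x + y - x * y)]; gcongr
    have a2 : ‖(w : ℂ) * ((x * y) * (x + y - x * y))‖ ≤ 1 / 2 * (1 * 3) := by
      rw [norm_mul, norm_mul (x * y), Complex.norm_real, Real.norm_of_nonneg hw]; gcongr
    linarith
  calc w ^ 2 * _ ≤ w ^ 2 * 8.5 := by gcongr
    _ = 34 * w ^ 2 * (1 / 2 * (1 / 2)) := by ring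
    _ ≤ _ := by gcongr

/-- The local factors of a `k`-dimensional sieve agree with those of `ζ` up to a quadratic error. -/
theorem exists_norm_local_factor_le (k : ℕ) : ∃ C : ℝ, 0 ≤ C ∧ ∀ (w g : ℝ) (x y : ℂ), 0 ≤ w →
    w ≤ 1 / 2 → ‖x‖ ≤ 1 → ‖y‖ ≤ 1 →
    ‖(1 - g * (x + y - x * y)) * ((1 - w * (x * y)) / ((1 - w * x) * (1 - w * y))) ^ k - 1‖
      ≤ C * (w ^ 2 + |g - k * w|) := by
  obtain ⟨C, hC, h⟩ := exists_norm_pow_sub_le k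
  refine ⟨C + 3 * (1 + 2 * k + C) + 3 * k * (3 * k + C), by positivity,
    fun w g x y hw hw2 hx hy => ?_⟩
  have hc := norm_add_sub_mul_le hx hy
  have hb := h w _ _ hw hw2 hc (norm_quotient_sub_le hw hw2 hx hy)
  set b := (1 - w * (x * y)) / ((1 - w * x) * (1 - w * y))
  set c := x + y - x * y
  have hk : ‖(k : ℂ) * w * c‖ ≤ 3 * k * w := by
    rw [norm_mul, norm_mul, Complex.norm_natCast, Complex.norm_real, Real.norm_of_nonneg hw]
    have : (0 : ℝ) ≤ k * w := by positivity
    nlinarith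
  have hb1 : ‖b ^ k - 1‖ ≤ (3 * k + C) * w := by
    calc ‖b ^ k - 1‖ = ‖(b ^ k - 1 - k * w * c) + k * w * c‖ := by ring_nf
      _ ≤ C * w ^ 2 + 3 * k * w := (norm_add_le _ _).trans (add_le_add hb hk)
      _ ≤ _ := by nlinarith [mul_nonneg hC hw]
  have hb2 : ‖b ^ k‖ ≤ 1 + 2 * k + C := by
    calc ‖b ^ k‖ = ‖(b ^ k - 1) + 1‖ := by ring_nf
      _ ≤ (3 * k + C) * w + 1 := (norm_add_le _ _).trans (by rw [norm_one]; linarith)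
      _ ≤ _ := by nlinarith [(Nat.cast_nonneg k : (0 : ℝ) ≤ k)]
  -- The linear terms cancel when `g = k w`. What is left is the second-order remainder of `b ^ k`,
  -- the discrepancy `g - k w`, and a product of two terms of size `w`.
  have e : (1 - g * c) * b ^ k - 1 = (b ^ k - 1 - k * w * c) - ((g - k * w : ℝ) : ℂ) * c * b ^ k
      - k * w * c * (b ^ k - 1) := by push_cast; ring
  rw [e]
  refine (norm_sub_le _ _).trans (add_le_add (norm_sub_le _ _) le_rfl |>.trans ?_)
  have e1 : ‖((g - k * w : ℝ) : ℂ) * c * b ^ k‖ ≤ |g - k * w| * 3 * (1 + 2 * k + C) := by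
    rw [norm_mul, norm_mul, Complex.norm_real, Real.norm_eq_abs]; gcongr
  have e2 : ‖(k : ℂ) * w * c * (b ^ k - 1)‖ ≤ 3 * k * w * ((3 * k + C) * w) := by
    rw [norm_mul]; gcongr
  have p1 : 0 ≤ (3 * (1 + 2 * k + C)) * w ^ 2 := by positivity
  have p2 : 0 ≤ (C + 3 * k * (3 * k + C)) * |g - k * w| := by positivity
  calc _ ≤ C * w ^ 2 + |g - k * w| * 3 * (1 + 2 * k + C) + 3 * k * w * ((3 * k + C) * w) := by
        gcongr
    _ ≤ _ := by linarith

/-- `ℓ ^ (-s)` for a prime `ℓ`. -/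
def primePow (ℓ : Nat.Primes) (s : ℂ) : ℂ := ((ℓ : ℕ) : ℂ) ^ (-s)

/-- The factor at `ℓ` of the Euler product attached to the sieve density `g`. -/
def siftFactor (g : ℕ → ℝ) (s s' : ℂ) (ℓ : Nat.Primes) : ℂ :=
  1 - g ℓ * (primePow ℓ s + primePow ℓ s' - primePow ℓ s * primePow ℓ s')

/-- The factor at `ℓ` of `ζ(1+s) ζ(1+s') / ζ(1+s+s')`. -/
def zetaFactor (s s' : ℂ) (ℓ : Nat.Primes) : ℂ :=
  (1 - (((ℓ : ℕ) : ℝ)⁻¹ : ℝ) * (primePow ℓ s * primePow ℓ s'))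
    / ((1 - (((ℓ : ℕ) : ℝ)⁻¹ : ℝ) * primePow ℓ s) * (1 - (((ℓ : ℕ) : ℝ)⁻¹ : ℝ) * primePow ℓ s'))

/-- The Euler product that remains when the zeta factors are split off. -/
def residualProduct (k : ℕ) (g : ℕ → ℝ) (s s' : ℂ) : ℂ :=
  ∏' ℓ, siftFactor g s s' ℓ * zetaFactor s s' ℓ ^ k

/-- The value of the Euler product with factors `siftFactor g s s'`. -/
def siftProduct (k : ℕ) (g : ℕ → ℝ) (s s' : ℂ) : ℂ :=
  (riemannZeta (1 + s + s') * (riemannZeta (1 + s))⁻¹ * (riemannZeta (1 + s'))⁻¹) ^ k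
    * residualProduct k g s s'

/-- The distance of `g` from the density `k / ℓ`. -/
def densityError (k : ℕ) (g : ℕ → ℝ) (ℓ : Nat.Primes) : ℝ :=
  |g ℓ - k * ((ℓ : ℕ) : ℝ)⁻¹|

theorem inv_prime_le_half (ℓ : Nat.Primes) : ((ℓ : ℕ) : ℝ)⁻¹ ≤ 1 / 2 := by
  have : (2 : ℝ) ≤ (ℓ : ℕ) := by exact_mod_cast ℓ.2.two_le
  rw [inv_le_comm₀ (by linarith) (by norm_num)]; linarith

theorem prime_cast_ne_zero (ℓ : Nat.Primes) : ((ℓ : ℕ) : ℂ) ≠ 0 := by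
  exact_mod_cast ℓ.2.ne_zero

theorem norm_primePow (ℓ : Nat.Primes) (s : ℂ) : ‖primePow ℓ s‖ = ((ℓ : ℕ) : ℝ) ^ (-s.re) := by
  rw [primePow, Complex.norm_natCast_cpow_of_pos ℓ.2.pos, Complex.neg_re]

theorem norm_primePow_le_one (ℓ : Nat.Primes) {s : ℂ} (hs : 0 ≤ s.re) : ‖primePow ℓ s‖ ≤ 1 := by
  rw [norm_primePow]
  exact Real.rpow_le_one_of_one_le_of_nonpos (by exact_mod_cast ℓ.2.one_le) (by linarith)

theorem summable_inv_prime_sq : Summable fun ℓ : Nat.Primes => (((ℓ : ℕ) : ℝ)⁻¹) ^ 2 := by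
  refine (Nat.Primes.summable_rpow.2 (by norm_num : (-2 : ℝ) < -1)).congr fun ℓ => ?_
  rw [Real.rpow_neg (by positivity), inv_pow]; norm_num

/-- The constant in the local estimate. -/
def localConst (k : ℕ) : ℝ := (exists_norm_local_factor_le k).choose

theorem localConst_nonneg (k : ℕ) : 0 ≤ localConst k :=
  (exists_norm_local_factor_le k).choose_spec.1

theorem norm_residual_factor_le (k : ℕ) (g : ℕ → ℝ) {s s' : ℂ} (hs : 0 ≤ s.re) (hs' : 0 ≤ s'.re)
    (ℓ : Nat.Primes) : ‖siftFactor g s s' ℓ * zetaFactor s s' ℓ ^ k - 1‖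
      ≤ localConst k * ((((ℓ : ℕ) : ℝ)⁻¹) ^ 2 + densityError k g ℓ) :=
  (exists_norm_local_factor_le k).choose_spec.2 _ _ _ _ (by positivity) (inv_prime_le_half ℓ)
    (norm_primePow_le_one ℓ hs) (norm_primePow_le_one ℓ hs')

theorem summable_residual_bound (k : ℕ) {g : ℕ → ℝ} (hg : Summable (densityError k g)) :
    Summable fun ℓ : Nat.Primes =>
      localConst k * ((((ℓ : ℕ) : ℝ)⁻¹) ^ 2 + densityError k g ℓ) :=
  (summable_inv_prime_sq.add hg).mul_left _

theorem summable_residual (k : ℕ) {g : ℕ → ℝ} (hg : Summable (densityError k g)) {s s' : ℂ}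
    (hs : 0 ≤ s.re) (hs' : 0 ≤ s'.re) :
    Summable fun ℓ => ‖siftFactor g s s' ℓ * zetaFactor s s' ℓ ^ k - 1‖ :=
  (summable_residual_bound k hg).of_nonneg_of_le (fun _ => norm_nonneg _)
    (norm_residual_factor_le k g hs hs')

theorem hasProd_residual (k : ℕ) {g : ℕ → ℝ} (hg : Summable (densityError k g)) {s s' : ℂ}
    (hs : 0 ≤ s.re) (hs' : 0 ≤ s'.re) :
    HasProd (fun ℓ => siftFactor g s s' ℓ * zetaFactor s s' ℓ ^ k) (residualProduct k g s s') := by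
  have h := (multipliable_one_add_of_summable (summable_residual k hg hs hs')).hasProd
  simpa only [add_sub_cancel, residualProduct] using! h

/-- The size of the residual product in terms of `∑ |g ℓ - k / ℓ|`. -/
def residualConst (k : ℕ) (E : ℝ) : ℝ :=
  Real.exp (localConst k * ((∑' ℓ : Nat.Primes, (((ℓ : ℕ) : ℝ)⁻¹) ^ 2) + E))

/-- A product of factors `1 + a` is at most `exp ∑ |a|`. The bound sees `g` only through the total
density error, so it stays uniform when one prime is removed from the density. -/
theorem norm_residualProduct_le (k : ℕ) {g : ℕ → ℝ} (hg : Summable (densityError k g)) {s s' : ℂ}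
    (hs : 0 ≤ s.re) (hs' : 0 ≤ s'.re) {E : ℝ} (hE : ∑' ℓ, densityError k g ℓ ≤ E) :
    ‖residualProduct k g s s'‖ ≤ residualConst k E := by
  refine le_of_tendsto (hasProd_residual k hg hs hs').norm (Eventually.of_forall fun t => ?_)
  have h := Finset.norm_prod_one_add_sub_one_le t
    (fun ℓ => siftFactor g s s' ℓ * zetaFactor s s' ℓ ^ k - 1)
  simp only [add_sub_cancel] at h
  have h2 := norm_sub_norm_le (∏ ℓ ∈ t, siftFactor g s s' ℓ * zetaFactor s s' ℓ ^ k) 1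
  rw [norm_one] at h2
  have h3 : ∑ ℓ ∈ t, ‖siftFactor g s s' ℓ * zetaFactor s s' ℓ ^ k - 1‖
      ≤ localConst k * ((∑' ℓ : Nat.Primes, (((ℓ : ℕ) : ℝ)⁻¹) ^ 2) + E) := by
    calc _ ≤ ∑ ℓ ∈ t, localConst k * ((((ℓ : ℕ) : ℝ)⁻¹) ^ 2 + densityError k g ℓ) :=
          Finset.sum_le_sum fun ℓ _ => norm_residual_factor_le k g hs hs' ℓ
      _ ≤ ∑' ℓ : Nat.Primes, localConst k * ((((ℓ : ℕ) : ℝ)⁻¹) ^ 2 + densityError k g ℓ) :=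
          (summable_residual_bound k hg).sum_le_tsum _ fun ℓ _ => mul_nonneg (localConst_nonneg k)
            (add_nonneg (sq_nonneg _) (abs_nonneg _))
      _ ≤ _ := by
          rw [tsum_mul_left, summable_inv_prime_sq.tsum_add hg]
          have := localConst_nonneg k
          gcongr
  have h4 := Real.exp_le_exp.2 h3
  rw [← norm_prod, residualConst]
  linarith

theorem inv_mul_primePow (ℓ : Nat.Primes) (s : ℂ) :
    (((((ℓ : ℕ) : ℝ)⁻¹ : ℝ)) : ℂ) * primePow ℓ s = ((ℓ : ℕ) : ℂ) ^ (-(1 + s)) := by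
  rw [primePow, neg_add, Complex.cpow_add _ _ (prime_cast_ne_zero ℓ), Complex.cpow_neg_one]
  push_cast; rfl

theorem primePow_add (ℓ : Nat.Primes) (s s' : ℂ) :
    primePow ℓ s * primePow ℓ s' = primePow ℓ (s + s') := by
  rw [primePow, primePow, primePow, neg_add, Complex.cpow_add _ _ (prime_cast_ne_zero ℓ)]

theorem zetaFactor_ne_zero {s s' : ℂ} (hs : 0 ≤ s.re) (hs' : 0 ≤ s'.re) (ℓ : Nat.Primes) :
    zetaFactor s s' ℓ ≠ 0 := by
  have key : ∀ x : ℂ, ‖x‖ ≤ 1 → 1 - ((((ℓ : ℕ) : ℝ)⁻¹ : ℝ) : ℂ) * x ≠ 0 := fun x hx h => by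
    have := half_le_norm_one_sub (w := ((ℓ : ℕ) : ℝ)⁻¹) (by positivity) (inv_prime_le_half ℓ) hx
    rw [h, norm_zero] at this; linarith
  refine div_ne_zero (key _ ?_) (mul_ne_zero (key _ (norm_primePow_le_one ℓ hs))
    (key _ (norm_primePow_le_one ℓ hs')))
  rw [primePow_add]
  exact norm_primePow_le_one ℓ (by rw [Complex.add_re]; linarith)

theorem hasProd_zetaFactor {s s' : ℂ} (hs : 0 < s.re) (hs' : 0 < s'.re) :
    HasProd (zetaFactor s s')
      (riemannZeta (1 + s + s') * (riemannZeta (1 + s))⁻¹ * (riemannZeta (1 + s'))⁻¹)⁻¹ := by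
  have h1 := riemannZeta_eulerProduct_hasProd (s := 1 + s) (by simpa using hs)
  have h2 := riemannZeta_eulerProduct_hasProd (s := 1 + s') (by simpa using hs')
  have h3 := (riemannZeta_eulerProduct_hasProd (s := 1 + (s + s'))
    (by simp only [Complex.add_re, Complex.one_re]; linarith)).inv₀
    (riemannZeta_ne_zero_of_one_le_re (by simp only [Complex.add_re, Complex.one_re]; linarith))
  have e1 : zetaFactor s s' = fun ℓ : Nat.Primes => ((1 - ((ℓ : ℕ) : ℂ) ^ (-(1 + (s + s'))))⁻¹)⁻¹
      * (1 - ((ℓ : ℕ) : ℂ) ^ (-(1 + s)))⁻¹ * (1 - ((ℓ : ℕ) : ℂ) ^ (-(1 + s')))⁻¹ := by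
    funext ℓ
    simp only [zetaFactor, primePow_add, inv_mul_primePow, inv_inv, div_eq_mul_inv, mul_inv,
      mul_assoc]
  have e2 : (riemannZeta (1 + s + s') * (riemannZeta (1 + s))⁻¹ * (riemannZeta (1 + s'))⁻¹)⁻¹
      = (riemannZeta (1 + (s + s')))⁻¹ * riemannZeta (1 + s) * riemannZeta (1 + s') := by
    simp only [mul_inv, inv_inv, add_assoc]
  rw [e1, e2]
  exact (h3.mul h1).mul h2

/-- The `k`-th power of the zeta Euler product is multiplied in and out factor by factor, which is
legitimate because no local zeta factor vanishes. The residual product is controlled down to `s = s'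
= 0`, so all singular behaviour sits in explicit zeta values. -/
theorem hasProd_siftFactor (k : ℕ) {g : ℕ → ℝ} (hg : Summable (densityError k g)) {s s' : ℂ}
    (hs : 0 < s.re) (hs' : 0 < s'.re) :
    HasProd (siftFactor g s s') (siftProduct k g s s') := by
  have hz : riemannZeta (1 + s + s') * (riemannZeta (1 + s))⁻¹ * (riemannZeta (1 + s'))⁻¹ ≠ 0 := by
    refine mul_ne_zero (mul_ne_zero ?_ (inv_ne_zero ?_)) (inv_ne_zero ?_) <;>
      refine riemannZeta_ne_zero_of_one_le_re ?_ <;>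
      simp only [Complex.add_re, Complex.one_re] <;> linarith
  have h1 := (((hasProd_zetaFactor hs hs').inv₀ (inv_ne_zero hz)).pow k).mul
    (hasProd_residual k hg hs.le hs'.le)
  rw [inv_inv] at h1
  have e1 : siftFactor g s s' = fun ℓ =>
      (zetaFactor s s' ℓ)⁻¹ ^ k * (siftFactor g s s' ℓ * zetaFactor s s' ℓ ^ k) := by
    funext ℓ
    have := pow_ne_zero k (zetaFactor_ne_zero hs.le hs'.le ℓ)
    rw [inv_pow, mul_comm, mul_assoc, mul_inv_cancel₀ this, mul_one]
  rw [e1]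
  exact h1

/-- Factor by factor, `|1 - z| ≥ 1 - |z|` with `z = ℓ^(-1-s)`, and `|z|` depends only on the real
part of `s`. -/
theorem norm_riemannZeta_le {s : ℂ} (hs : 0 < s.re) :
    ‖riemannZeta (1 + s)‖ ≤ ‖riemannZeta (1 + s.re)‖ := by
  have h1 := (riemannZeta_eulerProduct_hasProd (s := 1 + s) (by simpa using hs)).norm
  have h2 := (riemannZeta_eulerProduct_hasProd (s := 1 + s.re) (by simpa using hs)).norm
  refine le_of_tendsto_of_tendsto' h1 h2 fun t => ?_
  refine Finset.prod_le_prod (fun _ _ => norm_nonneg _) fun ℓ _ => ?_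
  rw [← inv_mul_primePow, ← inv_mul_primePow, norm_inv, norm_inv]
  have hx : ‖primePow ℓ s.re‖ ≤ 1 := norm_primePow_le_one ℓ (by simpa using hs.le)
  have h3 := half_le_norm_one_sub (w := ((ℓ : ℕ) : ℝ)⁻¹) (by positivity) (inv_prime_le_half ℓ) hx
  refine inv_anti₀ (by linarith) ?_
  have e : primePow ℓ (s.re : ℂ) = ((‖primePow ℓ s‖ : ℝ) : ℂ) := by
    rw [norm_primePow, primePow, Complex.ofReal_cpow (by positivity)]; push_cast; rfl
  have hy := norm_primePow_le_one ℓ hs.le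
  rw [e]
  have h4 : 1 - ((((ℓ : ℕ) : ℝ)⁻¹ : ℝ) : ℂ) * ((‖primePow ℓ s‖ : ℝ) : ℂ)
      = ((1 - ((ℓ : ℕ) : ℝ)⁻¹ * ‖primePow ℓ s‖ : ℝ) : ℂ) := by push_cast; rfl
  have h5 := norm_sub_norm_le (1 : ℂ) ((((ℓ : ℕ) : ℝ)⁻¹ : ℝ) * primePow ℓ s)
  have h6 := inv_prime_le_half ℓ
  rw [h4, Complex.norm_real, Real.norm_of_nonneg]
  · rwa [norm_one, norm_mul, Complex.norm_real, Real.norm_of_nonneg (by positivity)] at h5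
  · nlinarith [norm_nonneg (primePow ℓ s), show (0 : ℝ) ≤ ((ℓ : ℕ) : ℝ)⁻¹ by positivity]

/-- Factor by factor, `|1 - z| ≤ 1 + |z| ≤ (1 - |z|)⁻¹`. This crude bound is what is used away from
the pole. -/
theorem norm_riemannZeta_inv_le {s : ℂ} (hs : 0 < s.re) :
    ‖(riemannZeta (1 + s))⁻¹‖ ≤ ‖riemannZeta (1 + s.re)‖ := by
  have h1 := ((riemannZeta_eulerProduct_hasProd (s := 1 + s) (by simpa using hs)).inv₀
    (riemannZeta_ne_zero_of_one_le_re (by simpa using hs.le))).norm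
  have h2 := (riemannZeta_eulerProduct_hasProd (s := 1 + s.re) (by simpa using hs)).norm
  refine le_of_tendsto_of_tendsto' h1 h2 fun t => ?_
  refine Finset.prod_le_prod (fun _ _ => norm_nonneg _) fun ℓ _ => ?_
  rw [inv_inv, ← inv_mul_primePow, ← inv_mul_primePow, norm_inv]
  have e : primePow ℓ (s.re : ℂ) = ((‖primePow ℓ s‖ : ℝ) : ℂ) := by
    rw [norm_primePow, primePow, Complex.ofReal_cpow (by positivity)]; push_cast; rfl
  have hy := norm_primePow_le_one ℓ hs.le
  have h4 : 1 - ((((ℓ : ℕ) : ℝ)⁻¹ : ℝ) : ℂ) * ((‖primePow ℓ s‖ : ℝ) : ℂ)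
      = ((1 - ((ℓ : ℕ) : ℝ)⁻¹ * ‖primePow ℓ s‖ : ℝ) : ℂ) := by push_cast; rfl
  have h6 := inv_prime_le_half ℓ
  have h7 : 0 ≤ ((ℓ : ℕ) : ℝ)⁻¹ * ‖primePow ℓ s‖ := by positivity
  have h8 : ((ℓ : ℕ) : ℝ)⁻¹ * ‖primePow ℓ s‖ ≤ 1 / 2 := by
    nlinarith [norm_nonneg (primePow ℓ s), show (0 : ℝ) ≤ ((ℓ : ℕ) : ℝ)⁻¹ by positivity]
  rw [e, h4, Complex.norm_real, Real.norm_of_nonneg (by linarith)]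
  have h5 := norm_sub_le (1 : ℂ) ((((ℓ : ℕ) : ℝ)⁻¹ : ℝ) * primePow ℓ s)
  rw [norm_one, norm_mul, Complex.norm_real, Real.norm_of_nonneg (by positivity)] at h5
  refine h5.trans ?_
  set q := ((ℓ : ℕ) : ℝ)⁻¹ * ‖primePow ℓ s‖
  rw [le_inv_comm₀ (by linarith) (by linarith), ← one_div, le_div_iff₀ (by linarith)]
  nlinarith

theorem tendsto_mul_riemannZeta :
    Tendsto (fun s : ℂ => s * riemannZeta (1 + s)) (𝓝[≠] 0) (𝓝 1) := by
  have h : Tendsto (fun s : ℂ => 1 + s) (𝓝[≠] 0) (𝓝[≠] 1) := by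
    refine tendsto_nhdsWithin_iff.2 ⟨?_, ?_⟩
    · have : Tendsto (fun s : ℂ => 1 + s) (𝓝 0) (𝓝 (1 + 0)) :=
        tendsto_const_nhds.add tendsto_id
      rw [add_zero] at this
      exact this.mono_left nhdsWithin_le_nhds
    · filter_upwards [self_mem_nhdsWithin] with s hs
      simpa using hs
  refine (riemannZeta_residue_one.comp h).congr fun s => ?_
  simp

/-- The spectral parameter `1 - 2 π i ξ`. -/
def freq (ξ : ℝ) : ℂ := 1 - 2 * Real.pi * ξ * Complex.I

theorem freq_re (ξ : ℝ) : (freq ξ).re = 1 := by simp [freq]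

theorem continuous_freq : Continuous freq := by unfold freq; fun_prop

/-- Size bounds for `ζ` and `1/ζ` to the right of `1`, at height comparable to the distance. -/
theorem exists_zeta_bounds : ∃ C σ₀ : ℝ, 0 < C ∧ 0 < σ₀ ∧ ∀ σ : ℝ, 0 < σ → σ ≤ σ₀ →
    (∀ z : ℂ, 1 ≤ z.re → ‖riemannZeta (1 + σ * z)‖ ≤ C * σ⁻¹) ∧
    (∀ z : ℂ, z.re = 1 → ‖(riemannZeta (1 + σ * z))⁻¹‖ ≤ C * σ * ‖z‖ ^ 2) := by
  have h := (tendsto_mul_riemannZeta.norm)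
  rw [norm_one] at h
  have h1 := h.eventually (Icc_mem_nhds (by norm_num : (1 / 2 : ℝ) < 1) (by norm_num : (1 : ℝ) < 2))
  rw [eventually_nhdsWithin_iff, Metric.eventually_nhds_iff] at h1
  obtain ⟨δ, hδ, h1⟩ := h1
  have hz : ∀ σ : ℝ, 0 < σ → σ < δ → ‖riemannZeta (1 + σ)‖ ≤ 2 * σ⁻¹ := fun σ h0 h2 => by
    have := (h1 (y := (σ : ℂ)) (by simpa [abs_of_pos h0] using h2)
      (by simpa using h0.ne')).2
    rw [norm_mul, Complex.norm_real, Real.norm_of_nonneg h0.le] at this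
    rw [← div_eq_mul_inv, le_div_iff₀ h0]; linarith
  refine ⟨2 + 2 * δ⁻¹ ^ 2, δ / 2, by positivity, by positivity, fun σ h0 hσ => ⟨?_, ?_⟩⟩
  · intro z hz1
    have hre : ((σ : ℂ) * z).re = σ * z.re := by simp
    have hp : 0 < σ * z.re := by positivity
    refine (norm_riemannZeta_le (by rw [hre]; exact hp)).trans ?_
    rw [hre]
    have hmono : ‖riemannZeta (1 + (σ * z.re : ℝ))‖ ≤ ‖riemannZeta (1 + σ)‖ := by
      have h1 := (riemannZeta_eulerProduct_hasProd (s := 1 + (σ * z.re : ℝ))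
        (by simp only [Complex.add_re, Complex.one_re, Complex.ofReal_re]; linarith)).norm
      have h2 := (riemannZeta_eulerProduct_hasProd (s := 1 + σ) (by simpa using h0)).norm
      refine le_of_tendsto_of_tendsto' h1 h2 fun t => ?_
      refine Finset.prod_le_prod (fun _ _ => norm_nonneg _) fun ℓ _ => ?_
      have key : ∀ τ : ℝ, 0 < τ → ‖(1 - ((ℓ : ℕ) : ℂ) ^ (-(1 + (τ : ℂ))))⁻¹‖
          = (1 - ((ℓ : ℕ) : ℝ) ^ (-(1 + τ)))⁻¹ := fun τ hτ => by
        have e : (1 - ((ℓ : ℕ) : ℂ) ^ (-(1 + (τ : ℂ)))) = ((1 - ((ℓ : ℕ) : ℝ) ^ (-(1 + τ)) : ℝ) : ℂ)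
            := by push_cast [Complex.ofReal_cpow (Nat.cast_nonneg (ℓ : ℕ))]; rfl
        rw [e, norm_inv, Complex.norm_real, Real.norm_of_nonneg]
        exact sub_nonneg.2 (Real.rpow_le_one_of_one_le_of_nonpos
          (by exact_mod_cast ℓ.2.one_le) (by linarith))
      rw [key _ hp, key _ h0]
      have hℓ : (1 : ℝ) < (ℓ : ℕ) := by exact_mod_cast ℓ.2.one_lt
      refine inv_anti₀ (sub_pos.2 (Real.rpow_lt_one_of_one_lt_of_neg hℓ (by linarith))) ?_
      have : ((ℓ : ℕ) : ℝ) ^ (-(1 + σ * z.re)) ≤ ((ℓ : ℕ) : ℝ) ^ (-(1 + σ)) :=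
        Real.rpow_le_rpow_of_exponent_le hℓ.le (by nlinarith)
      linarith
    refine hmono.trans ((hz σ h0 (by linarith)).trans ?_)
    gcongr
    have : 0 ≤ 2 * δ⁻¹ ^ 2 := by positivity
    linarith
  · intro z hz1
    have hre : ((σ : ℂ) * z).re = σ := by simp [hz1]
    have hn : 1 ≤ ‖z‖ := hz1 ▸ Complex.re_le_norm z
    have hnσ : ‖(σ : ℂ) * z‖ = σ * ‖z‖ := by
      rw [norm_mul, Complex.norm_real, Real.norm_of_nonneg h0.le]
    -- Near the pole `s ζ(1+s)` is close to `1`, giving the bound `2 σ |z|`. Farther away only `2/σ`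
    -- is available, and `σ |z| ≥ δ` trades it for `σ |z|²` at the cost of `δ⁻²`. The lost power of
    -- `|z|` is harmless because the amplitudes decay rapidly.
    rcases lt_or_ge (σ * ‖z‖) δ with hlt | hge
    · have hne : (σ : ℂ) * z ≠ 0 := fun h => by rw [h, Complex.zero_re] at hre; linarith
      have := (h1 (y := (σ : ℂ) * z) (by rwa [dist_zero_right, hnσ]) hne).1
      rw [norm_mul, hnσ] at this
      have hpos : 0 < ‖riemannZeta (1 + σ * z)‖ := by
        by_contra hcon
        have : ‖riemannZeta (1 + σ * z)‖ = 0 := le_antisymm (not_lt.1 hcon) (norm_nonneg _)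
        nlinarith
      rw [norm_inv, inv_le_iff_one_le_mul₀ hpos]
      have : 1 ≤ 2 * σ * ‖z‖ * ‖riemannZeta (1 + σ * z)‖ := by linarith
      refine this.trans ?_
      gcongr ?_ * _
      have : 0 ≤ 2 * δ⁻¹ ^ 2 * σ * ‖z‖ ^ 2 := by positivity
      nlinarith [mul_nonneg h0.le (norm_nonneg z)]
    · refine (norm_riemannZeta_inv_le (by rw [hre]; exact h0)).trans ?_
      rw [hre]
      refine (hz σ h0 (by linarith)).trans ?_
      have h2 : δ ^ 2 ≤ (σ * ‖z‖) ^ 2 := by gcongr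
      have h3 : 2 * σ⁻¹ ≤ 2 * δ⁻¹ ^ 2 * σ * ‖z‖ ^ 2 := by
        rw [← div_eq_mul_inv, div_le_iff₀ h0, inv_pow]
        calc (2 : ℝ) = 2 * (δ ^ 2)⁻¹ * δ ^ 2 := by field_simp
          _ ≤ 2 * (δ ^ 2)⁻¹ * (σ * ‖z‖) ^ 2 := by gcongr
          _ = _ := by ring
      have : 0 ≤ 2 * σ * ‖z‖ ^ 2 := by positivity
      linarith

/-- The sifting product at scale `σ`, bounded uniformly. -/
theorem exists_siftProduct_bound (k : ℕ) : ∃ C σ₀ : ℝ, 0 < C ∧ 0 < σ₀ ∧ ∀ σ : ℝ, 0 < σ → σ ≤ σ₀ →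
    ∀ (g : ℕ → ℝ) (E : ℝ), Summable (densityError k g) → ∑' ℓ, densityError k g ℓ ≤ E →
    ∀ ξ ξ' : ℝ, ‖siftProduct k g (σ * freq ξ) (σ * freq ξ')‖
      ≤ C * residualConst k E * σ ^ k * (‖freq ξ‖ ^ (2 * k) * ‖freq ξ'‖ ^ (2 * k)) := by
  obtain ⟨C, σ₀, hC, hσ₀, h⟩ := exists_zeta_bounds
  refine ⟨(C * C * C) ^ k, σ₀, by positivity, hσ₀, fun σ h0 hσ g E hg hE ξ ξ' => ?_⟩
  obtain ⟨h1, h2⟩ := h σ h0 hσ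
  have hre : ∀ ξ, ((σ : ℂ) * freq ξ).re = σ := fun ξ => by simp [freq_re]
  rw [siftProduct, norm_mul, norm_pow, norm_mul, norm_mul]
  have e1 := h1 (freq ξ + freq ξ') (by rw [Complex.add_re, freq_re, freq_re]; norm_num)
  rw [mul_add, ← add_assoc] at e1
  have e2 := h2 (freq ξ) (freq_re ξ)
  have e3 := h2 (freq ξ') (freq_re ξ')
  have e4 := norm_residualProduct_le k hg (s := σ * freq ξ) (s' := σ * freq ξ')
    (by rw [hre]; exact h0.le) (by rw [hre]; exact h0.le) hE
  calc _ ≤ (C * σ⁻¹ * (C * σ * ‖freq ξ‖ ^ 2) * (C * σ * ‖freq ξ'‖ ^ 2)) ^ k * residualConst k E := by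
        gcongr
    _ = _ := by
        have : C * σ⁻¹ * (C * σ * ‖freq ξ‖ ^ 2) * (C * σ * ‖freq ξ'‖ ^ 2)
          = (C * C * C) * σ * (‖freq ξ‖ ^ 2 * ‖freq ξ'‖ ^ 2) := by field_simp
        rw [this, mul_pow _ (‖freq ξ‖ ^ 2 * ‖freq ξ'‖ ^ 2), mul_pow (C * C * C),
          mul_pow (‖freq ξ‖ ^ 2), ← pow_mul, ← pow_mul]; ring

/-- The singular series of a sieve density. -/
def singularSeries (k : ℕ) (g : ℕ → ℝ) : ℂ := residualProduct k g 0 0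

/-- Dominated convergence for infinite products: each local factor is continuous at `s = s' = 0`,
and the local bound is uniform on the closed half-planes. -/
theorem tendsto_residualProduct (k : ℕ) {g : ℕ → ℝ} (hg : Summable (densityError k g)) {ξ ξ' : ℝ} :
    Tendsto (fun σ : ℝ => residualProduct k g (σ * freq ξ) (σ * freq ξ')) (𝓝[>] 0)
      (𝓝 (singularSeries k g)) := by
  have hpp : ∀ (ℓ : Nat.Primes) (ξ : ℝ), Tendsto (fun σ : ℝ => primePow ℓ (σ * freq ξ)) (𝓝[>] 0)
      (𝓝 (primePow ℓ 0)) := fun ℓ ξ => by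
    have : Continuous fun σ : ℝ => primePow ℓ (σ * freq ξ) := by
      unfold primePow
      refine Continuous.const_cpow (by fun_prop) (Or.inl (prime_cast_ne_zero ℓ))
    have h := this.tendsto 0
    simp only [Complex.ofReal_zero, zero_mul] at h
    exact h.mono_left nhdsWithin_le_nhds
  have h := tendsto_tprod_one_add_of_dominated_convergence (𝓕 := 𝓝[>] (0 : ℝ))
    (f := fun σ ℓ => siftFactor g (σ * freq ξ) (σ * freq ξ') ℓ
      * zetaFactor (σ * freq ξ) (σ * freq ξ') ℓ ^ k - 1)
    (g := fun ℓ => siftFactor g 0 0 ℓ * zetaFactor 0 0 ℓ ^ k - 1)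
    (summable_residual_bound k hg) (fun ℓ => ?_) ?_
  · simpa only [add_sub_cancel, residualProduct, singularSeries] using! h
  · refine Tendsto.sub_const ?_ 1
    have h1 := hpp ℓ ξ
    have h2 := hpp ℓ ξ'
    have key : ∀ x : ℂ, ‖x‖ ≤ 1 → 1 - ((((ℓ : ℕ) : ℝ)⁻¹ : ℝ) : ℂ) * x ≠ 0 := fun x hx h => by
      have := half_le_norm_one_sub (w := ((ℓ : ℕ) : ℝ)⁻¹) (by positivity) (inv_prime_le_half ℓ) hx
      rw [h, norm_zero] at this; linarith
    refine Tendsto.mul ?_ (Tendsto.pow ?_ k)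
    · exact (((h1.add h2).sub (h1.mul h2)).const_mul _).const_sub _
    · refine Tendsto.div ((h1.mul h2).const_mul _ |>.const_sub _)
        (((h1.const_mul _).const_sub _).mul ((h2.const_mul _).const_sub _)) ?_
      exact mul_ne_zero (key _ (norm_primePow_le_one ℓ (by simp)))
        (key _ (norm_primePow_le_one ℓ (by simp)))
  · filter_upwards [self_mem_nhdsWithin] with σ hσ ℓ
    have : (0 : ℝ) < σ := hσ
    refine norm_residual_factor_le k g ?_ ?_ ℓ <;> simp [freq_re, this.le]

/-- The simple pole gives `ζ(1 + σ z) ~ 1/(σ z)`, so the zeta quotient is `σ z z'/(z + z')` to first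
order; the residual product tends to the singular series. -/
theorem tendsto_siftProduct (k : ℕ) {g : ℕ → ℝ} (hg : Summable (densityError k g)) (ξ ξ' : ℝ) :
    Tendsto (fun σ : ℝ => ((σ : ℂ) ^ k)⁻¹ * siftProduct k g (σ * freq ξ) (σ * freq ξ')) (𝓝[>] 0)
      (𝓝 ((freq ξ * freq ξ' / (freq ξ + freq ξ')) ^ k * singularSeries k g)) := by
  have hz : ∀ z : ℂ, 1 ≤ z.re → Tendsto (fun σ : ℝ => (σ * z) * riemannZeta (1 + σ * z)) (𝓝[>] 0)
      (𝓝 1) := fun z hz => by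
    refine tendsto_mul_riemannZeta.comp (tendsto_nhdsWithin_iff.2 ⟨?_, ?_⟩)
    · have : Continuous fun σ : ℝ => (σ : ℂ) * z := by fun_prop
      have h := this.tendsto 0
      simp only [Complex.ofReal_zero, zero_mul] at h
      exact h.mono_left nhdsWithin_le_nhds
    · filter_upwards [self_mem_nhdsWithin] with σ hσ
      have h0 : (0 : ℝ) < σ := hσ
      refine mul_ne_zero (by exact_mod_cast h0.ne') fun h => ?_
      rw [h, Complex.zero_re] at hz; linarith
  have n1 : ∀ z : ℂ, 1 ≤ z.re → z ≠ 0 := fun z hz h => by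
    rw [h, Complex.zero_re] at hz; linarith
  have a1 : 1 ≤ (freq ξ).re := (freq_re _).ge
  have a2 : 1 ≤ (freq ξ').re := (freq_re _).ge
  have a3 : 1 ≤ (freq ξ + freq ξ').re := by rw [Complex.add_re, freq_re, freq_re]; norm_num
  have t1 := hz _ a1
  have t2 := hz _ a2
  have t3 := hz _ a3
  have t := (((t3.mul (t1.inv₀ one_ne_zero)).mul (t2.inv₀ one_ne_zero)).const_mul
    (freq ξ * freq ξ' / (freq ξ + freq ξ'))).pow k |>.mul (tendsto_residualProduct k hg (ξ := ξ)
      (ξ' := ξ'))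
  simp only [inv_one, mul_one] at t
  refine t.congr' ?_
  filter_upwards [self_mem_nhdsWithin] with σ hσ
  have h0 : (σ : ℂ) ≠ 0 := by
    have : (0 : ℝ) < σ := hσ
    exact_mod_cast this.ne'
  rw [siftProduct, ← mul_assoc ((σ : ℂ) ^ k)⁻¹, ← inv_pow, ← mul_pow, add_assoc, ← mul_add]
  congr 2
  have m1 := n1 _ a1
  have m2 := n1 _ a2
  have m3 := n1 _ a3
  simp only [mul_inv]
  field_simp

end GapsE2
end

noncomputable section

open Filter Asymptotics Topology MeasureTheory ArithmeticFunction
open scoped ArithmeticFunction.Moebius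

namespace GapsE2

/-! ### Quadratic forms in Möbius weights -/

/-- The multiplicative extension of `g` to squarefree numbers. -/
def siftWeight (g : ℕ → ℝ) (q : ℕ) : ℝ := ∏ p ∈ q.primeFactors, g p

/-- The quadratic form `∑ μ(d) μ(d') g([d, d']) F(log d / log R) H(log d' / log R)`. -/
def quadForm (g : ℕ → ℝ) (F H : ℝ → ℝ) (R : ℝ) : ℝ :=
  ∑ d ∈ Finset.Icc 1 ⌊R⌋₊, ∑ d' ∈ Finset.Icc 1 ⌊R⌋₊,
    (μ d : ℝ) * F (Real.log d / Real.log R) * ((μ d' : ℝ) * H (Real.log d' / Real.log R))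
      * siftWeight g (d.lcm d')

/-- The embedding of the primes into the natural numbers. -/
def primeEmb : Nat.Primes ↪ ℕ := ⟨fun ℓ => ℓ, fun _ _ h => Subtype.ext h⟩

theorem primeEmb_apply (ℓ : Nat.Primes) : primeEmb ℓ = (ℓ : ℕ) := rfl

/-- The product of a finite set of primes. -/
def primeProd (I : Finset Nat.Primes) : ℕ := ∏ ℓ ∈ I, (ℓ : ℕ)

theorem primeProd_eq (I : Finset Nat.Primes) :
    primeProd I = ∏ p ∈ I.map primeEmb, p := by
  rw [primeProd, Finset.prod_map]; rfl

theorem primeFactors_primeProd (I : Finset Nat.Primes) :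
    (primeProd I).primeFactors = I.map primeEmb := by
  rw [primeProd_eq]
  refine Nat.primeFactors_prod fun p hp => ?_
  obtain ⟨ℓ, _, rfl⟩ := Finset.mem_map.1 hp
  exact ℓ.2

theorem primeProd_injective : Function.Injective primeProd := fun I J h => by
  have := congrArg Nat.primeFactors h
  rwa [primeFactors_primeProd, primeFactors_primeProd, Finset.map_inj] at this

theorem primeProd_ne_zero (I : Finset Nat.Primes) : primeProd I ≠ 0 :=
  Finset.prod_ne_zero_iff.2 fun ℓ _ => ℓ.2.ne_zero

theorem moebius_primeProd (I : Finset Nat.Primes) : μ (primeProd I) = (-1) ^ I.card := by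
  classical
  induction I using Finset.induction_on with
  | empty => simp [primeProd]
  | insert a s ha ih =>
    have hc : Nat.Coprime (a : ℕ) (primeProd s) := by
      refine Nat.Coprime.prod_right fun ℓ hℓ => (Nat.coprime_primes a.2 ℓ.2).2 fun h => ?_
      exact ha (Subtype.ext h ▸ hℓ)
    rw [primeProd, Finset.prod_insert ha, ← primeProd,
      isMultiplicative_moebius.map_mul_of_coprime hc, ih, moebius_apply_prime a.2,
      Finset.card_insert_of_notMem ha]
    ring

theorem squarefree_eq_primeProd {d : ℕ} (hd : Squarefree d) {s : Finset Nat.Primes}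
    (hs : ∀ ℓ : Nat.Primes, (ℓ : ℕ) ∣ d → ℓ ∈ s) : ∃ I ∈ s.powerset, primeProd I = d := by
  refine ⟨s.filter fun ℓ => (ℓ : ℕ) ∣ d, Finset.mem_powerset.2 (Finset.filter_subset _ _), ?_⟩
  rw [primeProd_eq]
  conv_rhs => rw [← Nat.prod_primeFactors_of_squarefree hd]
  refine Finset.prod_congr ?_ fun _ _ => rfl
  ext p
  simp only [Finset.mem_map, Finset.mem_filter, primeEmb_apply, Nat.mem_primeFactors]
  constructor
  · rintro ⟨ℓ, ⟨_, h⟩, rfl⟩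
    exact ⟨ℓ.2, h, hd.ne_zero⟩
  · rintro ⟨hp, h, _⟩
    exact ⟨⟨p, hp⟩, ⟨hs ⟨p, hp⟩ h, h⟩, rfl⟩

/-- Squarefree numbers are indexed by their sets of primes. Any finite `s` containing the primes up
to `R` serves, since the summand vanishes beyond `R`; this freedom later lets `s` exhaust all
primes. -/
theorem sum_Icc_eq_sum_powerset {M : Type*} [AddCommMonoid M] {R : ℝ} (hR : 0 ≤ R)
    {s : Finset Nat.Primes}
    (hs : ∀ ℓ : Nat.Primes, ((ℓ : ℕ) : ℝ) ≤ R → ℓ ∈ s) (φ : ℕ → M)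
    (h1 : ∀ d, ¬ Squarefree d → φ d = 0) (h2 : ∀ d : ℕ, R < d → φ d = 0) :
    ∑ d ∈ Finset.Icc 1 ⌊R⌋₊, φ d = ∑ I ∈ s.powerset, φ (primeProd I) := by
  classical
  rw [← Finset.sum_image (f := φ) (g := primeProd) (fun I _ J _ h => primeProd_injective h)]
  refine Finset.sum_congr_of_eq_on_inter (fun d hd hd' => ?_) (fun d _ hd' => ?_) fun _ _ _ => rfl
  · by_contra h
    have hsq : Squarefree d := by by_contra h3; exact h (h1 d h3)
    rw [Finset.mem_Icc, Nat.le_floor_iff hR] at hd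
    obtain ⟨I, hI, rfl⟩ := squarefree_eq_primeProd hsq (s := s) fun ℓ hℓ => hs ℓ
      (le_trans (by exact_mod_cast Nat.le_of_dvd hsq.ne_zero.bot_lt hℓ) hd.2)
    exact hd' (Finset.mem_image_of_mem _ hI)
  · by_cases h0 : d = 0
    · exact h1 d (by rw [h0]; exact not_squarefree_zero)
    · refine h2 d ?_
      rw [Finset.mem_Icc, Nat.le_floor_iff hR] at hd'
      by_contra h
      exact hd' ⟨Nat.one_le_iff_ne_zero.2 h0, not_lt.1 h⟩

/-- An index lies in neither set, in `I` only, in `J` only, or in both, and contributes `1`, `-g x`,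
`-g y` or `g x y`; these four cases add up to the local factor. -/
theorem sum_powerset_powerset {ι : Type*} [DecidableEq ι] (s : Finset ι) (g x y : ι → ℂ) :
    ∑ I ∈ s.powerset, ∑ J ∈ s.powerset, (-1) ^ I.card * (-1) ^ J.card * (∏ i ∈ I ∪ J, g i)
      * ((∏ i ∈ I, x i) * ∏ i ∈ J, y i) = ∏ i ∈ s, (1 - g i * (x i + y i - x i * y i)) := by
  induction s using Finset.induction_on with
  | empty => simp
  | insert a s ha ih =>
    rw [Finset.prod_insert ha, ← ih, Finset.sum_powerset_insert ha, Finset.mul_sum,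
      ← Finset.sum_add_distrib]
    refine Finset.sum_congr rfl fun I hI => ?_
    rw [Finset.sum_powerset_insert ha, Finset.sum_powerset_insert ha, Finset.mul_sum,
      ← Finset.sum_add_distrib, ← Finset.sum_add_distrib, ← Finset.sum_add_distrib]
    refine Finset.sum_congr rfl fun J hJ => ?_
    have hI' : a ∉ I := fun h => ha (Finset.mem_powerset.1 hI h)
    have hJ' : a ∉ J := fun h => ha (Finset.mem_powerset.1 hJ h)
    have hIJ : a ∉ I ∪ J := by simp [hI', hJ']
    have e1 : I ∪ insert a J = insert a (I ∪ J) := by simp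
    have e2 : insert a I ∪ J = insert a (I ∪ J) := by simp
    have e3 : insert a I ∪ insert a J = insert a (I ∪ J) := by simp
    rw [e1, e2, e3, Finset.prod_insert hIJ, Finset.prod_insert hI', Finset.prod_insert hJ',
      Finset.card_insert_of_notMem hI', Finset.card_insert_of_notMem hJ']
    ring

/-! ### Spectral representation of the weight function -/

/-- `F` is the Laplace-type transform `F(t) = ∫ f(ξ) exp(-(1 - 2πiξ) t) dξ` of a rapidly decreasing
amplitude `f`. -/
structure IsSpectral (f : ℝ → ℂ) (F : ℝ → ℝ) : Prop where
  cont : Continuous f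
  int : ∀ m : ℕ, Integrable fun ξ => ‖freq ξ‖ ^ m * ‖f ξ‖
  rep : ∀ t : ℝ, (F t : ℂ) = ∫ ξ, f ξ * Complex.exp (-(freq ξ * t))

theorem norm_exp_neg_freq (ξ t : ℝ) : ‖Complex.exp (-(freq ξ * t))‖ = Real.exp (-t) := by
  rw [Complex.norm_exp]; simp [freq_re]

theorem continuous_exp_neg_freq (t : ℝ) : Continuous fun ξ => Complex.exp (-(freq ξ * t)) := by
  have := continuous_freq
  fun_prop

theorem IsSpectral.integrable {f : ℝ → ℂ} {F : ℝ → ℝ} (h : IsSpectral f F) : Integrable f := by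
  have := h.int 0
  simp only [pow_zero, one_mul] at this
  exact (integrable_norm_iff h.cont.aestronglyMeasurable).1 this

theorem IsSpectral.integrable_mul_exp {f : ℝ → ℂ} {F : ℝ → ℝ} (h : IsSpectral f F) (t : ℝ) :
    Integrable fun ξ => f ξ * Complex.exp (-(freq ξ * t)) :=
  h.integrable.mul_bdd (c := Real.exp (-t)) (continuous_exp_neg_freq t).aestronglyMeasurable
    (Eventually.of_forall fun ξ => (norm_exp_neg_freq ξ t).le)

/-- A shift multiplies the amplitude by an exponential of norm `exp (-u)`, which is at most `1` for
`u ≥ 0`. All uniformity in the shifts comes from here. -/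
theorem IsSpectral.shift {f : ℝ → ℂ} {F : ℝ → ℝ} (h : IsSpectral f F) (u : ℝ) :
    IsSpectral (fun ξ => f ξ * Complex.exp (-(freq ξ * u))) fun t => F (t + u) where
  cont := h.cont.mul (continuous_exp_neg_freq u)
  int m := by
    refine ((h.int m).mul_const (Real.exp (-u))).congr (Eventually.of_forall fun ξ => ?_)
    simp only
    rw [norm_mul, norm_exp_neg_freq, mul_assoc]
  rep t := by
    rw [h.rep]
    refine integral_congr_ae (Eventually.of_forall fun ξ => ?_)
    simp only
    rw [mul_assoc, ← Complex.exp_add]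
    congr 2
    push_cast; ring

theorem IsSpectral.deriv {f : ℝ → ℂ} {F : ℝ → ℝ} (h : IsSpectral f F) (hF : Differentiable ℝ F) :
    IsSpectral (fun ξ => -freq ξ * f ξ) (deriv F) where
  cont := continuous_freq.neg.mul h.cont
  int m := by
    refine (h.int (m + 1)).congr (Eventually.of_forall fun ξ => ?_)
    simp only
    rw [norm_mul, norm_neg]; ring
  rep t := by
    have hd : HasDerivAt (fun t : ℝ => ∫ ξ, f ξ * Complex.exp (-(freq ξ * t)))
        (∫ ξ, -freq ξ * f ξ * Complex.exp (-(freq ξ * t))) t := by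
      refine (hasDerivAt_integral_of_dominated_loc_of_deriv_le
        (F := fun (t : ℝ) ξ => f ξ * Complex.exp (-(freq ξ * t)))
        (F' := fun (t : ℝ) ξ => -freq ξ * f ξ * Complex.exp (-(freq ξ * t)))
        (bound := fun ξ => ‖freq ξ‖ ^ 1 * ‖f ξ‖ * Real.exp (1 - t))
        (s := Metric.ball t 1) (Metric.ball_mem_nhds t one_pos) ?_ (h.integrable_mul_exp t) ?_ ?_
        ((h.int 1).mul_const _) ?_).2
      · exact Eventually.of_forall fun t => (h.integrable_mul_exp t).aestronglyMeasurable
      · exact ((continuous_freq.neg.mul h.cont).mul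
          (continuous_exp_neg_freq t)).aestronglyMeasurable
      · refine Eventually.of_forall fun ξ t' ht' => ?_
        rw [norm_mul, norm_mul, norm_neg, norm_exp_neg_freq, pow_one]
        gcongr
        have := abs_lt.1 (Real.dist_eq t' t ▸ Metric.mem_ball.1 ht')
        linarith
      · refine Eventually.of_forall fun ξ t' _ => ?_
        have h1 : HasDerivAt (fun t : ℝ => -(freq ξ * (t : ℂ))) (-(freq ξ * 1)) t' :=
          ((Complex.ofRealCLM.hasDerivAt (x := t')).const_mul (freq ξ)).neg
        have h2 := (h1.cexp).const_mul (f ξ)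
        convert! h2 using 1
        ring
    have h1 : HasDerivAt (fun t : ℝ => (F t : ℂ)) ((_root_.deriv F t : ℝ) : ℂ) t :=
      (hF t).hasDerivAt.ofReal_comp
    have h2 : (fun t : ℝ => (F t : ℂ)) = fun t : ℝ => ∫ ξ, f ξ * Complex.exp (-(freq ξ * t)) :=
      funext h.rep
    rw [h2] at h1
    exact h1.unique hd

theorem IsSpectral.iteratedDeriv {f : ℝ → ℂ} {F : ℝ → ℝ} (h : IsSpectral f F)
    (hF : ContDiff ℝ (⊤ : ℕ∞) F) (k : ℕ) :
    IsSpectral (fun ξ => (-freq ξ) ^ k * f ξ) (iteratedDeriv k F) := by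
  induction k with
  | zero => simpa using h
  | succ k ih =>
    rw [iteratedDeriv_succ]
    convert ih.deriv (hF.differentiable_iteratedDeriv k (by exact_mod_cast WithTop.coe_lt_top k))
      using 2 with ξ
    ring

theorem norm_freq_le (ξ : ℝ) : ‖freq ξ‖ ≤ 1 + 2 * Real.pi * |ξ| := by
  refine (norm_sub_le _ _).trans ?_
  simp [abs_of_pos Real.pi_pos]

/-- Every smooth compactly supported function has a spectral representation. -/
theorem exists_isSpectral {F : ℝ → ℝ} (hF : ContDiff ℝ (⊤ : ℕ∞) F) (hc : HasCompactSupport F) :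
    ∃ f, IsSpectral f F := by
  -- Fourier inversion is applied to `e^t F(t)` instead of `F`. Moving `e^(-t)` back gives the
  -- frequencies real part `1`, which keeps the Euler products in the region of convergence.
  have hs : ContDiff ℝ (⊤ : ℕ∞) fun t : ℝ => ((Real.exp t * F t : ℝ) : ℂ) :=
    Complex.ofRealCLM.contDiff.comp (Real.contDiff_exp.mul hF)
  have hs2 : HasCompactSupport fun t : ℝ => ((Real.exp t * F t : ℝ) : ℂ) := by
    refine HasCompactSupport.comp_left (g := ((↑) : ℝ → ℂ)) (hc.mul_left (f' := F)) (by simp)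
  set φ : SchwartzMap ℝ ℂ := hs2.toSchwartzMap hs
  set ψ : SchwartzMap ℝ ℂ := FourierTransform.fourier φ
  refine ⟨ψ, ψ.continuous, fun m => ?_, fun t => ?_⟩
  · have h1 : Integrable fun ξ => (2 : ℝ) ^ m * (‖ξ‖ ^ 0 * ‖ψ ξ‖)
        + (2 : ℝ) ^ m * (2 * Real.pi) ^ m * (‖ξ‖ ^ m * ‖ψ ξ‖) :=
      ((ψ.integrable_pow_mul volume 0).const_mul _).add
        ((ψ.integrable_pow_mul volume m).const_mul _)
    refine h1.mono' ((continuous_freq.norm.pow m).mul ψ.continuous.norm).aestronglyMeasurable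
      (Eventually.of_forall fun ξ => ?_)
    rw [Real.norm_of_nonneg (by positivity)]
    have h2 : ‖freq ξ‖ ^ m ≤ 2 ^ m * (1 + (2 * Real.pi) ^ m * ‖ξ‖ ^ m) := by
      have h0 : 0 ≤ 2 * Real.pi * |ξ| := by positivity
      calc ‖freq ξ‖ ^ m ≤ (1 + 2 * Real.pi * |ξ|) ^ m := by gcongr; exact norm_freq_le ξ
        _ ≤ (2 * max 1 (2 * Real.pi * |ξ|)) ^ m := by
          gcongr
          linarith [le_max_left 1 (2 * Real.pi * |ξ|), le_max_right 1 (2 * Real.pi * |ξ|)]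
        _ = 2 ^ m * (max 1 (2 * Real.pi * |ξ|)) ^ m := by rw [mul_pow]
        _ ≤ 2 ^ m * (1 + (2 * Real.pi * |ξ|) ^ m) := by
          gcongr
          rcases le_total 1 (2 * Real.pi * |ξ|) with h | h
          · rw [max_eq_right h]; linarith
          · rw [max_eq_left h, one_pow]; linarith [pow_nonneg h0 m]
        _ = _ := by rw [mul_pow (2 * Real.pi), Real.norm_eq_abs]
    calc _ ≤ 2 ^ m * (1 + (2 * Real.pi) ^ m * ‖ξ‖ ^ m) * ‖ψ ξ‖ := by gcongr
      _ = _ := by ring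
  · have h1 : FourierTransformInv.fourierInv ψ = φ := FourierTransform.fourierInv_fourier_eq φ
    have h2 : (FourierTransformInv.fourierInv ψ) t = φ t := by rw [h1]
    rw [SchwartzMap.fourierInv_coe, Real.fourierInv_eq'] at h2
    have h3 : φ t = Real.exp t * F t := by
      change ((Real.exp t * F t : ℝ) : ℂ) = _; push_cast; rfl
    rw [h3] at h2
    have h4 : (F t : ℂ) = Complex.exp (-t) * (Real.exp t * F t) := by
      rw [← mul_assoc, Complex.ofReal_exp, ← Complex.exp_add]; simp
    rw [h4, ← h2, ← integral_const_mul]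
    refine integral_congr_ae (Eventually.of_forall fun ξ => ?_)
    simp only [smul_eq_mul, RCLike.inner_apply, conj_trivial]
    rw [← mul_assoc, ← Complex.exp_add, mul_comm]
    congr 2
    simp only [freq]; push_cast; ring

end GapsE2
end

/-! ### The quadratic form as an integral of an Euler product. -/

noncomputable section

open Filter Asymptotics Topology MeasureTheory ArithmeticFunction
open scoped ArithmeticFunction.Moebius

namespace GapsE2

theorem exp_log_primeProd (I : Finset Nat.Primes) (ξ σ : ℝ) :
    Complex.exp (-(freq ξ * ((Real.log (primeProd I) * σ : ℝ) : ℂ)))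
      = ∏ ℓ ∈ I, primePow ℓ (σ * freq ξ) := by
  rw [primeProd, Nat.cast_prod, Real.log_prod (fun ℓ _ => by exact_mod_cast ℓ.2.ne_zero),
    Finset.sum_mul, Complex.ofReal_sum, Finset.mul_sum, ← Finset.sum_neg_distrib, Complex.exp_sum]
  refine Finset.prod_congr rfl fun ℓ _ => ?_
  rw [primePow, Complex.cpow_def_of_ne_zero (prime_cast_ne_zero ℓ), ← Complex.natCast_log]
  congr 1
  push_cast; ring

theorem siftWeight_lcm (g : ℕ → ℝ) (I J : Finset Nat.Primes) :
    siftWeight g ((primeProd I).lcm (primeProd J)) = ∏ ℓ ∈ I ∪ J, g ℓ := by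
  have h : ((primeProd I).lcm (primeProd J)).primeFactors = (I ∪ J).map primeEmb := by
    rw [Finset.map_union, ← primeFactors_primeProd, ← primeFactors_primeProd]
    ext p
    simp only [Nat.mem_primeFactors, Finset.mem_union]
    constructor
    · rintro ⟨hp, hd, _⟩
      rcases (hp.dvd_mul.1 (hd.trans (Nat.lcm_dvd_mul _ _))) with h | h
      · exact Or.inl ⟨hp, h, primeProd_ne_zero _⟩
      · exact Or.inr ⟨hp, h, primeProd_ne_zero _⟩
    · rintro (⟨hp, hd, _⟩ | ⟨hp, hd, _⟩)
      · exact ⟨hp, hd.trans (Nat.dvd_lcm_left _ _),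
          Nat.lcm_ne_zero (primeProd_ne_zero _) (primeProd_ne_zero _)⟩
      · exact ⟨hp, hd.trans (Nat.dvd_lcm_right _ _),
          Nat.lcm_ne_zero (primeProd_ne_zero _) (primeProd_ne_zero _)⟩
  rw [siftWeight, h, Finset.prod_map]
  rfl

theorem moebius_mul_weight_eq_zero {F : ℝ → ℝ} (hF : ∀ t, 1 ≤ t → F t = 0) {R : ℝ} (hR : 1 < R)
    (d : ℕ) (hd : ¬ Squarefree d ∨ R < d) : (μ d : ℝ) * F (Real.log d / Real.log R) = 0 := by
  rcases hd with hd | hd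
  · rw [moebius_eq_zero_of_not_squarefree hd]; simp
  · rw [hF, mul_zero]
    rw [le_div_iff₀ (Real.log_pos hR), one_mul]
    exact Real.log_le_log (by linarith) hd.le

theorem quadForm_eq_sum_powerset (g : ℕ → ℝ) {F H : ℝ → ℝ} (hF : ∀ t, 1 ≤ t → F t = 0)
    (hH : ∀ t, 1 ≤ t → H t = 0) {R : ℝ} (hR : 1 < R) {s : Finset Nat.Primes}
    (hs : ∀ ℓ : Nat.Primes, ((ℓ : ℕ) : ℝ) ≤ R → ℓ ∈ s) :
    quadForm g F H R = ∑ I ∈ s.powerset, ∑ J ∈ s.powerset,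
      (-1) ^ I.card * (-1) ^ J.card * (∏ i ∈ I ∪ J, g i)
        * (F (Real.log (primeProd I) * (Real.log R)⁻¹)
          * H (Real.log (primeProd J) * (Real.log R)⁻¹)) := by
  have hR0 : 0 ≤ R := by linarith
  rw [quadForm, sum_Icc_eq_sum_powerset hR0 hs]
  · refine Finset.sum_congr rfl fun I _ => ?_
    rw [sum_Icc_eq_sum_powerset hR0 hs]
    · refine Finset.sum_congr rfl fun J _ => ?_
      rw [moebius_primeProd, moebius_primeProd, siftWeight_lcm, div_eq_mul_inv, div_eq_mul_inv]
      push_cast; ring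
    · intro d hd
      rw [moebius_mul_weight_eq_zero hH hR d (Or.inl hd), mul_zero, zero_mul]
    · intro d hd
      rw [moebius_mul_weight_eq_zero hH hR d (Or.inr hd), mul_zero, zero_mul]
  · intro d hd
    refine Finset.sum_eq_zero fun d' _ => ?_
    rw [moebius_mul_weight_eq_zero hF hR d (Or.inl hd), zero_mul, zero_mul]
  · intro d hd
    refine Finset.sum_eq_zero fun d' _ => ?_
    rw [moebius_mul_weight_eq_zero hF hR d (Or.inr hd), zero_mul, zero_mul]

/-- After inserting the spectral representation, the dependence on `d` and `d'` is multiplicative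
over primes, so the finite double sum factors under the integral. -/
theorem quadForm_eq_integral_prod (g : ℕ → ℝ) {f h : ℝ → ℂ} {F H : ℝ → ℝ} (hf : IsSpectral f F)
    (hh : IsSpectral h H) (hF : ∀ t, 1 ≤ t → F t = 0) (hH : ∀ t, 1 ≤ t → H t = 0) {R : ℝ}
    (hR : 1 < R) {s : Finset Nat.Primes} (hs : ∀ ℓ : Nat.Primes, ((ℓ : ℕ) : ℝ) ≤ R → ℓ ∈ s) :
    (quadForm g F H R : ℂ) = ∫ z : ℝ × ℝ, f z.1 * h z.2 *
      ∏ ℓ ∈ s, siftFactor g (((Real.log R)⁻¹ : ℝ) * freq z.1) (((Real.log R)⁻¹ : ℝ) * freq z.2) ℓ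
      := by
  classical
  set σ := (Real.log R)⁻¹
  rw [quadForm_eq_sum_powerset g hF hH hR hs]
  have hterm : ∀ I J : Finset Nat.Primes, Integrable (fun z : ℝ × ℝ =>
      ((-1) ^ I.card * (-1) ^ J.card * (∏ i ∈ I ∪ J, (g i : ℂ))) *
        ((f z.1 * Complex.exp (-(freq z.1 * ((Real.log (primeProd I) * σ : ℝ) : ℂ))))
          * (h z.2 * Complex.exp (-(freq z.2 * ((Real.log (primeProd J) * σ : ℝ) : ℂ)))))) :=
    fun I J => ((hf.integrable_mul_exp _).mul_prod (hh.integrable_mul_exp _)).const_mul _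
  have e1 : ∀ z : ℝ × ℝ, f z.1 * h z.2 * ∏ ℓ ∈ s, siftFactor g (σ * freq z.1) (σ * freq z.2) ℓ
      = ∑ I ∈ s.powerset, ∑ J ∈ s.powerset,
      ((-1) ^ I.card * (-1) ^ J.card * (∏ i ∈ I ∪ J, (g i : ℂ))) *
        ((f z.1 * Complex.exp (-(freq z.1 * ((Real.log (primeProd I) * σ : ℝ) : ℂ))))
          * (h z.2 * Complex.exp (-(freq z.2 * ((Real.log (primeProd J) * σ : ℝ) : ℂ))))) := by
    intro z
    simp only [siftFactor]
    rw [← sum_powerset_powerset, Finset.mul_sum]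
    refine Finset.sum_congr rfl fun I _ => ?_
    rw [Finset.mul_sum]
    refine Finset.sum_congr rfl fun J _ => ?_
    rw [exp_log_primeProd, exp_log_primeProd]
    ring
  rw [integral_congr_ae (Eventually.of_forall e1), integral_finsetSum _ fun I _ =>
    integrable_finsetSum _ fun J _ => hterm I J]
  rw [Complex.ofReal_sum]
  refine Finset.sum_congr rfl fun I _ => ?_
  rw [Complex.ofReal_sum, integral_finsetSum _ fun J _ => hterm I J]
  refine Finset.sum_congr rfl fun J _ => ?_
  rw [integral_const_mul, Measure.volume_eq_prod, integral_prod_mul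
    (fun ξ => f ξ * Complex.exp (-(freq ξ * ((Real.log (primeProd I) * σ : ℝ) : ℂ))))
    (fun ξ => h ξ * Complex.exp (-(freq ξ * ((Real.log (primeProd J) * σ : ℝ) : ℂ)))),
    ← hf.rep, ← hh.rep]
  simp only [Complex.ofReal_mul, Complex.ofReal_prod, Complex.ofReal_pow, Complex.ofReal_neg,
    Complex.ofReal_one]
  rfl

theorem continuous_primePow (ℓ : Nat.Primes) (σ : ℝ) :
    Continuous fun ξ => primePow ℓ (σ * freq ξ) := by
  unfold primePow
  have := continuous_freq
  exact Continuous.const_cpow (by fun_prop) (Or.inl (prime_cast_ne_zero ℓ))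

theorem continuous_prod_siftFactor (g : ℕ → ℝ) (σ : ℝ) (s : Finset Nat.Primes) :
    Continuous fun z : ℝ × ℝ => ∏ ℓ ∈ s, siftFactor g (σ * freq z.1) (σ * freq z.2) ℓ := by
  refine continuous_finsetProd _ fun ℓ _ => ?_
  unfold siftFactor
  have h1 := (continuous_primePow ℓ σ).comp (continuous_fst (X := ℝ) (Y := ℝ))
  have h2 := (continuous_primePow ℓ σ).comp (continuous_snd (X := ℝ) (Y := ℝ))
  exact continuous_const.sub (continuous_const.mul ((h1.add h2).sub (h1.mul h2)))

theorem re_mul_freq (σ ξ : ℝ) : ((σ : ℂ) * freq ξ).re = σ := by simp [freq_re]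

/-- For fixed `σ > 0` the deviations of the factors from `1` are `O(|g ℓ| ℓ^(-σ))`, hence summable.
The resulting bound does not depend on the finite set of primes and dominates the passage to the
full product. -/
theorem exists_norm_prod_siftFactor_le {k : ℕ} {g : ℕ → ℝ} (hg : Summable (densityError k g))
    {σ : ℝ} (hσ : 0 < σ) : ∃ M : ℝ, ∀ (s : Finset Nat.Primes) (z : ℝ × ℝ),
      ‖∏ ℓ ∈ s, siftFactor g (σ * freq z.1) (σ * freq z.2) ℓ‖ ≤ M := by
  set b : Nat.Primes → ℝ := fun ℓ => 3 * (densityError k g ℓ + k * ((ℓ : ℕ) : ℝ) ^ (-(1 + σ)))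
  have hb : Summable b := ((hg.add ((Nat.Primes.summable_rpow.2 (by linarith)).mul_left _))).mul_left _
  refine ⟨Real.exp (∑' ℓ, b ℓ), fun s z => ?_⟩
  have hle : ∀ ℓ, ‖siftFactor g (σ * freq z.1) (σ * freq z.2) ℓ - 1‖ ≤ b ℓ := fun ℓ => by
    have hx : ∀ ξ, ‖primePow ℓ (σ * freq ξ)‖ = ((ℓ : ℕ) : ℝ) ^ (-σ) := fun ξ => by
      rw [norm_primePow, re_mul_freq]
    have h1 : ((ℓ : ℕ) : ℝ) ^ (-σ) ≤ 1 := Real.rpow_le_one_of_one_le_of_nonpos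
      (by exact_mod_cast ℓ.2.one_le) (by linarith)
    set w := ((ℓ : ℕ) : ℝ) ^ (-σ)
    have hw : 0 ≤ w := by positivity
    have h3 : ‖primePow ℓ (σ * freq z.1) + primePow ℓ (σ * freq z.2)
        - primePow ℓ (σ * freq z.1) * primePow ℓ (σ * freq z.2)‖ ≤ 3 * w := by
      refine (norm_sub_le _ _).trans ?_
      have := norm_add_le (primePow ℓ (σ * freq z.1)) (primePow ℓ (σ * freq z.2))
      rw [hx, hx] at this
      rw [norm_mul, hx, hx]
      nlinarith
    rw [siftFactor, sub_sub_cancel_left, norm_neg, norm_mul, Complex.norm_real, Real.norm_eq_abs]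
    have h4 : |g ℓ| ≤ densityError k g ℓ + k * ((ℓ : ℕ) : ℝ)⁻¹ := by
      have := abs_add_le (g ℓ - k * ((ℓ : ℕ) : ℝ)⁻¹) (k * ((ℓ : ℕ) : ℝ)⁻¹)
      rwa [sub_add_cancel, abs_of_nonneg (by positivity : 0 ≤ k * ((ℓ : ℕ) : ℝ)⁻¹)] at this
    have h5 : ((ℓ : ℕ) : ℝ) ^ (-(1 + σ)) = ((ℓ : ℕ) : ℝ)⁻¹ * w := by
      rw [neg_add, Real.rpow_add (by exact_mod_cast ℓ.2.pos), Real.rpow_neg_one]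
    have hd : 0 ≤ densityError k g ℓ := abs_nonneg _
    calc _ ≤ (densityError k g ℓ + k * ((ℓ : ℕ) : ℝ)⁻¹) * (3 * w) := by gcongr
      _ = 3 * (densityError k g ℓ * w + k * (((ℓ : ℕ) : ℝ)⁻¹ * w)) := by ring
      _ ≤ b ℓ := by
        simp only [b]
        rw [h5]
        gcongr
        nlinarith
  have h := Finset.norm_prod_one_add_sub_one_le s
    (fun ℓ => siftFactor g (σ * freq z.1) (σ * freq z.2) ℓ - 1)
  simp only [add_sub_cancel] at h
  have h2 := norm_sub_norm_le (∏ ℓ ∈ s, siftFactor g (σ * freq z.1) (σ * freq z.2) ℓ) 1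
  rw [norm_one] at h2
  have h3 := Real.exp_le_exp.2 ((Finset.sum_le_sum fun ℓ (_ : ℓ ∈ s) => hle ℓ).trans
    (hb.sum_le_tsum s fun ℓ _ => (norm_nonneg _).trans (hle ℓ)))
  linarith

theorem aestronglyMeasurable_siftProduct {k : ℕ} {g : ℕ → ℝ} (hg : Summable (densityError k g))
    {σ : ℝ} (hσ : 0 < σ) :
    AEStronglyMeasurable fun z : ℝ × ℝ => siftProduct k g (σ * freq z.1) (σ * freq z.2) :=
  aestronglyMeasurable_of_tendsto_ae (atTop : Filter (Finset Nat.Primes))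
    (fun s => (continuous_prod_siftFactor g σ s).aestronglyMeasurable)
    (Eventually.of_forall fun z => hasProd_siftFactor k hg (by rwa [re_mul_freq])
      (by rwa [re_mul_freq]))

/-- The quadratic form as an integral of an Euler product. -/
theorem quadForm_eq_integral {k : ℕ} {g : ℕ → ℝ} (hg : Summable (densityError k g)) {f h : ℝ → ℂ}
    {F H : ℝ → ℝ} (hf : IsSpectral f F) (hh : IsSpectral h H) (hF : ∀ t, 1 ≤ t → F t = 0)
    (hH : ∀ t, 1 ≤ t → H t = 0) {R : ℝ} (hR : 1 < R) :
    (quadForm g F H R : ℂ) = ∫ z : ℝ × ℝ, f z.1 * h z.2 *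
      siftProduct k g (((Real.log R)⁻¹ : ℝ) * freq z.1) (((Real.log R)⁻¹ : ℝ) * freq z.2) := by
  have hσ : 0 < (Real.log R)⁻¹ := inv_pos.2 (Real.log_pos hR)
  set σ := (Real.log R)⁻¹
  obtain ⟨M, hM⟩ := exists_norm_prod_siftFactor_le hg hσ
  have hfh : Integrable fun z : ℝ × ℝ => f z.1 * h z.2 := hf.integrable.mul_prod hh.integrable
  have hlim : Tendsto (fun s : Finset Nat.Primes => ∫ z : ℝ × ℝ, f z.1 * h z.2 *
      ∏ ℓ ∈ s, siftFactor g (σ * freq z.1) (σ * freq z.2) ℓ) atTop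
      (𝓝 (∫ z : ℝ × ℝ, f z.1 * h z.2 * siftProduct k g (σ * freq z.1) (σ * freq z.2))) := by
    refine tendsto_integral_filter_of_dominated_convergence (fun z => ‖f z.1 * h z.2‖ * M)
      (Eventually.of_forall fun s => hfh.aestronglyMeasurable.mul
        (continuous_prod_siftFactor g σ s).aestronglyMeasurable)
      (Eventually.of_forall fun s => Eventually.of_forall fun z => ?_)
      (hfh.norm.mul_const _) (Eventually.of_forall fun z => ?_)
    · rw [norm_mul]; gcongr; exact hM s z
    · exact (hasProd_siftFactor k hg (by rwa [re_mul_freq]) (by rwa [re_mul_freq])).const_mul _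
  refine tendsto_nhds_unique ?_ hlim
  -- Once `s` contains the primes up to `R`, the integral over the finite product equals the
  -- quadratic form, so the net is eventually constant.
  refine tendsto_const_nhds.congr' ?_
  have hfin : {ℓ : Nat.Primes | ((ℓ : ℕ) : ℝ) ≤ R}.Finite := by
    refine Set.Finite.of_finite_image (f := primeEmb) ((Set.finite_Iic ⌊R⌋₊).subset ?_)
      primeEmb.injective.injOn
    rintro _ ⟨ℓ, hℓ, rfl⟩
    exact Nat.le_floor hℓ
  filter_upwards [eventually_ge_atTop hfin.toFinset] with s hs
  exact quadForm_eq_integral_prod g hf hh hF hH hR fun ℓ hℓ => hs (hfin.mem_toFinset.2 hℓ)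

end GapsE2
end

/-! ### Laplace integrals and the limiting bilinear form. -/

noncomputable section

open Filter Asymptotics Topology MeasureTheory ArithmeticFunction
open scoped ArithmeticFunction.Moebius

namespace GapsE2

theorem integrableOn_pow_mul_exp_neg (n : ℕ) :
    IntegrableOn (fun t : ℝ => t ^ n * Real.exp (-t)) (Set.Ioi 0) := by
  have h := Real.GammaIntegral_convergent (s := n + 1) (by positivity)
  refine h.congr_fun (fun t _ => ?_) measurableSet_Ioi
  simp only [add_sub_cancel_right, Real.rpow_natCast]
  ring

theorem norm_pow_mul_cexp {a : ℂ} (ha : 1 ≤ a.re) (n : ℕ) {t : ℝ} (ht : 0 ≤ t) :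
    ‖(t : ℂ) ^ n * Complex.exp (-(a * t))‖ ≤ t ^ n * Real.exp (-t) := by
  rw [norm_mul, norm_pow, Complex.norm_real, Real.norm_of_nonneg ht, Complex.norm_exp]
  gcongr
  simp only [Complex.neg_re, Complex.mul_re, Complex.ofReal_re, Complex.ofReal_im, mul_zero,
    sub_zero]
  nlinarith

theorem integrableOn_pow_mul_cexp {a : ℂ} (ha : 1 ≤ a.re) (n : ℕ) :
    IntegrableOn (fun t : ℝ => (t : ℂ) ^ n * Complex.exp (-(a * t))) (Set.Ioi 0) := by
  refine (integrableOn_pow_mul_exp_neg n).mono' (by fun_prop) ?_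
  filter_upwards [ae_restrict_mem measurableSet_Ioi] with t ht
  exact norm_pow_mul_cexp ha n (le_of_lt ht)

theorem integral_pow_mul_cexp {a : ℂ} (ha : 1 ≤ a.re) (n : ℕ) :
    ∫ t in Set.Ioi (0 : ℝ), (t : ℂ) ^ n * Complex.exp (-(a * t)) = n.factorial / a ^ (n + 1) := by
  have h0 : a ≠ 0 := fun h => by rw [h, Complex.zero_re] at ha; linarith
  have hlim : ∀ n : ℕ, Tendsto (fun t : ℝ => (t : ℂ) ^ n * Complex.exp (-(a * t))) atTop (𝓝 0) :=
    fun n => squeeze_zero_norm' (by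
      filter_upwards [eventually_ge_atTop 0] with t ht using norm_pow_mul_cexp ha n ht)
      (Real.tendsto_pow_mul_exp_neg_atTop_nhds_zero n)
  have hexp : ∀ t : ℝ, HasDerivAt (fun t : ℝ => Complex.exp (-(a * t)))
      (-a * Complex.exp (-(a * t))) t := fun t => by
    have h1 : HasDerivAt (fun t : ℝ => -(a * (t : ℂ))) (-(a * 1)) t :=
      ((Complex.ofRealCLM.hasDerivAt (x := t)).const_mul a).neg
    convert! h1.cexp using 1
    ring
  induction n with
  | zero =>
    have h := integral_Ioi_of_hasDerivAt_of_tendsto' (a := (0 : ℝ)) (fun t _ => hexp t)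
      (by simpa [IntegrableOn] using (integrableOn_pow_mul_cexp ha 0).const_mul (-a)) (by simpa using hlim 0)
    rw [integral_const_mul] at h
    simp only [Complex.ofReal_zero, mul_zero, neg_zero, Complex.exp_zero, zero_sub] at h
    simp only [pow_zero, one_mul, zero_add, pow_one, Nat.factorial_zero, Nat.cast_one]
    rw [eq_div_iff h0]
    linear_combination -h
  | succ n ih =>
    have hd : ∀ t : ℝ, HasDerivAt (fun t : ℝ => (t : ℂ) ^ (n + 1) * Complex.exp (-(a * t)))
        ((n + 1) * ((t : ℂ) ^ n * Complex.exp (-(a * t)))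
          + -a * ((t : ℂ) ^ (n + 1) * Complex.exp (-(a * t)))) t := fun t => by
      have h1 := (Complex.ofRealCLM.hasDerivAt (x := t)).pow (n + 1)
      convert! h1.mul (hexp t) using 1
      simp
      ring
    have h := integral_Ioi_of_hasDerivAt_of_tendsto' (a := (0 : ℝ)) (fun t _ => hd t)
      (((integrableOn_pow_mul_cexp ha n).const_mul _).add
        ((integrableOn_pow_mul_cexp ha (n + 1)).const_mul _)) (hlim (n + 1))
    rw [integral_add ((integrableOn_pow_mul_cexp ha n).const_mul _)
      ((integrableOn_pow_mul_cexp ha (n + 1)).const_mul _), integral_const_mul,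
      integral_const_mul, ih] at h
    simp only [Complex.ofReal_zero, ne_eq, Nat.add_eq_zero_iff, one_ne_zero, and_false,
      not_false_eq_true, zero_pow, zero_mul, sub_zero] at h
    rw [Nat.factorial_succ, eq_div_iff (pow_ne_zero _ h0)]
    have h2 : a * ∫ t in Set.Ioi (0 : ℝ), (t : ℂ) ^ (n + 1) * Complex.exp (-(a * t))
        = (n + 1) * n.factorial / a ^ (n + 1) := by linear_combination -h
    rw [eq_div_iff (pow_ne_zero _ h0)] at h2
    push_cast
    linear_combination h2

/-- The limiting bilinear form of the sieve of dimension `k` for the shifts of `F` by `u`, `v`. -/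
def sieveForm (k : ℕ) (F : ℝ → ℝ) (u v : ℝ) : ℝ :=
  ∫ t in Set.Ioi (0 : ℝ), iteratedDeriv k F (t + u) * iteratedDeriv k F (t + v)
    * (t ^ (k - 1) / (k - 1).factorial)

/-- The factor `(z + z')^(-k)` is the Laplace integral of `t^(k-1)/(k-1)!`, and `z^k`, `z'^k`
differentiate the two copies of `F`, the signs cancelling. Fubini exchanges the integrals. -/
theorem sieveForm_eq_integral {f : ℝ → ℂ} {F : ℝ → ℝ} (h : IsSpectral f F)
    (hF : ContDiff ℝ (⊤ : ℕ∞) F) {k : ℕ} (hk : 0 < k) (u v : ℝ) :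
    (sieveForm k F u v : ℂ) = ∫ z : ℝ × ℝ, (f z.1 * Complex.exp (-(freq z.1 * u)))
      * (f z.2 * Complex.exp (-(freq z.2 * v)))
      * (freq z.1 * freq z.2 / (freq z.1 + freq z.2)) ^ k := by
  obtain ⟨n, rfl⟩ : ∃ n, k = n + 1 := ⟨k - 1, by omega⟩
  simp only [sieveForm, Nat.add_sub_cancel]
  have hs := h.iteratedDeriv hF (n + 1)
  have hu' := hs.shift u
  have hv' := hs.shift v
  rw [← integral_complex_ofReal]
  set a : ℝ → ℂ := fun ξ => (-freq ξ) ^ (n + 1) * f ξ * Complex.exp (-(freq ξ * u))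
  set b : ℝ → ℂ := fun ξ => (-freq ξ) ^ (n + 1) * f ξ * Complex.exp (-(freq ξ * v))
  have hab : Integrable fun z : ℝ × ℝ => a z.1 * b z.2 := hu'.integrable.mul_prod hv'.integrable
  have hac : Continuous a := hu'.cont
  have hbc : Continuous b := hv'.cont
  have hre : ∀ z : ℝ × ℝ, 1 ≤ (freq z.1 + freq z.2).re := fun z => by
    rw [Complex.add_re, freq_re, freq_re]; norm_num
  have e1 : ∀ t : ℝ, ((iteratedDeriv (n + 1) F (t + u) * iteratedDeriv (n + 1) F (t + v)
      * (t ^ n / n.factorial) : ℝ) : ℂ) = ∫ z : ℝ × ℝ, (a z.1 * b z.2)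
        * (((n.factorial : ℂ))⁻¹ * ((t : ℂ) ^ n * Complex.exp (-((freq z.1 + freq z.2) * t)))) := by
    intro t
    have e : ∀ z : ℝ × ℝ, (a z.1 * b z.2)
        * (((n.factorial : ℂ))⁻¹ * ((t : ℂ) ^ n * Complex.exp (-((freq z.1 + freq z.2) * t))))
        = (((n.factorial : ℂ))⁻¹ * (t : ℂ) ^ n) * ((a z.1 * Complex.exp (-(freq z.1 * t)))
          * (b z.2 * Complex.exp (-(freq z.2 * t)))) := fun z => by
      rw [add_mul, neg_add, Complex.exp_add]; ring
    rw [integral_congr_ae (Eventually.of_forall e), integral_const_mul, Measure.volume_eq_prod,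
      integral_prod_mul (fun ξ => a ξ * Complex.exp (-(freq ξ * t)))
        (fun ξ => b ξ * Complex.exp (-(freq ξ * t))), ← hu'.rep, ← hv'.rep]
    push_cast
    ring
  have e2 : ∀ z : ℝ × ℝ, (f z.1 * Complex.exp (-(freq z.1 * u)))
      * (f z.2 * Complex.exp (-(freq z.2 * v))) * (freq z.1 * freq z.2 / (freq z.1 + freq z.2)) ^ (n + 1)
      = ∫ t in Set.Ioi (0 : ℝ), (a z.1 * b z.2)
        * (((n.factorial : ℂ))⁻¹ * ((t : ℂ) ^ n * Complex.exp (-((freq z.1 + freq z.2) * t)))) := by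
    intro z
    rw [integral_const_mul, integral_const_mul, integral_pow_mul_cexp (hre z)]
    have hfac : (n.factorial : ℂ) ≠ 0 := by exact_mod_cast n.factorial_ne_zero
    simp only [a, b, div_pow, mul_pow]
    have hsgn : (-freq z.1) ^ (n + 1) * (-freq z.2) ^ (n + 1)
        = freq z.1 ^ (n + 1) * freq z.2 ^ (n + 1) := by
      rw [← mul_pow, neg_mul_neg, mul_pow]
    have h3 : (freq z.1 + freq z.2) ^ (n + 1) ≠ 0 := pow_ne_zero _ fun h0 => by
      have := hre z; rw [h0, Complex.zero_re] at this; linarith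
    field_simp
    linear_combination (-(f z.1 * f z.2)) * hsgn
  rw [integral_congr_ae (Eventually.of_forall e2), integral_congr_ae (Eventually.of_forall e1)]
  refine integral_integral_swap ?_
  have hbd : Integrable (fun p : ℝ × (ℝ × ℝ) => (p.1 ^ n * Real.exp (-p.1)) * ‖a p.2.1 * b p.2.2‖)
      ((volume.restrict (Set.Ioi (0 : ℝ))).prod volume) :=
    (integrableOn_pow_mul_exp_neg n).mul_prod hab.norm
  refine hbd.mono' ?_ ?_
  · have := continuous_freq
    refine Continuous.aestronglyMeasurable ?_
    unfold Function.uncurry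
    fun_prop
  · have hm : MeasurableSet {p : ℝ × (ℝ × ℝ) | 0 < p.1} := measurableSet_lt measurable_const measurable_fst
    have : ∀ᵐ p ∂((volume.restrict (Set.Ioi (0 : ℝ))).prod (volume : Measure (ℝ × ℝ))), 0 < p.1 := by
      refine Measure.ae_prod_iff_ae_ae hm |>.2 ?_
      filter_upwards [ae_restrict_mem measurableSet_Ioi] with t ht
      exact Eventually.of_forall fun _ => ht
    filter_upwards [this] with p hp
    simp only [Function.uncurry]
    rw [norm_mul (a _ * b _), norm_mul (n.factorial : ℂ)⁻¹, mul_comm]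
    have h1 := norm_pow_mul_cexp (hre p.2) n hp.le
    have h2 : ‖((n.factorial : ℂ))⁻¹‖ ≤ 1 := by
      rw [norm_inv, Complex.norm_natCast]
      exact inv_le_one_of_one_le₀ (by exact_mod_cast n.factorial_pos)
    refine mul_le_mul_of_nonneg_right ?_ (norm_nonneg _)
    calc _ ≤ 1 * (p.1 ^ n * Real.exp (-p.1)) := by gcongr
      _ = _ := one_mul _

end GapsE2
end

/-! ### Uniform asymptotics of the quadratic form and the effect of removing one prime. -/

noncomputable section

open Filter Asymptotics Topology MeasureTheory ArithmeticFunction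

namespace GapsE2

theorem norm_shift_amplitude_le (f : ℝ → ℂ) {u v : ℝ} (hu : 0 ≤ u) (hv : 0 ≤ v) (z : ℝ × ℝ) :
    ‖(f z.1 * Complex.exp (-(freq z.1 * u))) * (f z.2 * Complex.exp (-(freq z.2 * v)))‖
      ≤ ‖f z.1 * f z.2‖ := by
  rw [norm_mul, norm_mul, norm_mul, norm_mul, norm_exp_neg_freq, norm_exp_neg_freq]
  have h1 : Real.exp (-u) ≤ 1 := Real.exp_le_one_iff.2 (by linarith)
  have h2 : Real.exp (-v) ≤ 1 := Real.exp_le_one_iff.2 (by linarith)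
  gcongr
  · exact mul_le_of_le_one_right (norm_nonneg _) h1
  · exact mul_le_of_le_one_right (norm_nonneg _) h2

theorem tendsto_inv_log_atTop : Tendsto (fun R : ℝ => (Real.log R)⁻¹) atTop (𝓝[>] 0) :=
  tendsto_inv_atTop_nhdsGT_zero.comp Real.tendsto_log_atTop

theorem integrable_pow_freq_prod {f : ℝ → ℂ} {F : ℝ → ℝ} (h : IsSpectral f F) (m : ℕ) :
    Integrable fun z : ℝ × ℝ => ‖f z.1 * f z.2‖ * (‖freq z.1‖ ^ m * ‖freq z.2‖ ^ m) := by
  refine ((h.int m).mul_prod (h.int m)).congr (Eventually.of_forall fun z => ?_)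
  simp only
  rw [norm_mul]; ring

theorem one_le_norm_freq_add (ξ ξ' : ℝ) : 1 ≤ ‖freq ξ + freq ξ'‖ := by
  have := Complex.re_le_norm (freq ξ + freq ξ')
  rw [Complex.add_re, freq_re, freq_re] at this
  linarith

/-- Asymptotics of the quadratic form, uniformly in the shifts. -/
theorem exists_quadForm_error {k : ℕ} (hk : 0 < k) {g : ℕ → ℝ} (hg : Summable (densityError k g))
    {F : ℝ → ℝ} (hFs : ContDiff ℝ (⊤ : ℕ∞) F) (hFc : HasCompactSupport F)
    (hF : ∀ t, 1 ≤ t → F t = 0) : ∃ δ : ℝ → ℝ, Tendsto δ atTop (𝓝 0) ∧ ∀ᶠ R : ℝ in atTop,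
      ∀ u v : ℝ, 0 ≤ u → 0 ≤ v →
      |Real.log R ^ k * quadForm g (fun t => F (t + u)) (fun t => F (t + v)) R
        - (singularSeries k g).re * sieveForm k F u v| ≤ δ R := by
  obtain ⟨f, hf⟩ := exists_isSpectral hFs hFc
  set S := singularSeries k g
  set K : ℝ → ℝ × ℝ → ℂ := fun σ z =>
    ((σ : ℂ) ^ k)⁻¹ * siftProduct k g (σ * freq z.1) (σ * freq z.2)
  set L : ℝ × ℝ → ℂ := fun z => (freq z.1 * freq z.2 / (freq z.1 + freq z.2)) ^ k * S
  have hff : Integrable fun z : ℝ × ℝ => f z.1 * f z.2 := hf.integrable.mul_prod hf.integrable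
  have hLc : Continuous L := by
    have := continuous_freq
    refine Continuous.mul (Continuous.pow (Continuous.div (by fun_prop) (by fun_prop) ?_) k)
      continuous_const
    intro z h
    have := one_le_norm_freq_add z.1 z.2
    rw [h, norm_zero] at this; linarith
  have hKm : ∀ σ, 0 < σ → AEStronglyMeasurable (K σ) := fun σ hσ =>
    (aestronglyMeasurable_siftProduct hg hσ).const_mul _
  obtain ⟨C, σ₀, hC, hσ₀, hbd⟩ := exists_siftProduct_bound k
  set A := C * residualConst k (∑' ℓ, densityError k g ℓ) + ‖S‖
  have hA : 0 ≤ A := by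
    have : 0 < residualConst k (∑' ℓ, densityError k g ℓ) := Real.exp_pos _
    positivity
  have hKb : ∀ σ, 0 < σ → σ ≤ σ₀ → ∀ z : ℝ × ℝ,
      ‖K σ z‖ ≤ A * (‖freq z.1‖ ^ (2 * k) * ‖freq z.2‖ ^ (2 * k)) := by
    intro σ h0 h1 z
    have h2 := hbd σ h0 h1 g _ hg le_rfl z.1 z.2
    simp only [K]
    rw [norm_mul, norm_inv, norm_pow, Complex.norm_real, Real.norm_of_nonneg h0.le,
      inv_mul_le_iff₀ (by positivity)]
    refine h2.trans ?_
    calc _ = σ ^ k * (C * residualConst k (∑' ℓ, densityError k g ℓ)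
          * (‖freq z.1‖ ^ (2 * k) * ‖freq z.2‖ ^ (2 * k))) := by ring
      _ ≤ _ := by gcongr; exact le_add_of_nonneg_right (norm_nonneg S)
  have hLb : ∀ z : ℝ × ℝ, ‖L z‖ ≤ A * (‖freq z.1‖ ^ (2 * k) * ‖freq z.2‖ ^ (2 * k)) := by
    intro z
    refine le_of_tendsto (tendsto_siftProduct k hg z.1 z.2).norm ?_
    filter_upwards [Ioc_mem_nhdsGT hσ₀] with σ hσ using hKb σ hσ.1 hσ.2 z
  have hbound : Integrable fun z : ℝ × ℝ =>
      (2 * A) * (‖f z.1 * f z.2‖ * (‖freq z.1‖ ^ (2 * k) * ‖freq z.2‖ ^ (2 * k))) :=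
    (integrable_pow_freq_prod hf (2 * k)).const_mul _
  have hdom : ∀ σ, 0 < σ → σ ≤ σ₀ → ∀ z : ℝ × ℝ, ‖f z.1 * f z.2‖ * ‖K σ z - L z‖
      ≤ (2 * A) * (‖f z.1 * f z.2‖ * (‖freq z.1‖ ^ (2 * k) * ‖freq z.2‖ ^ (2 * k))) := by
    intro σ h0 h1 z
    have := (norm_sub_le _ _).trans (add_le_add (hKb σ h0 h1 z) (hLb z))
    calc _ ≤ ‖f z.1 * f z.2‖ * _ := mul_le_mul_of_nonneg_left this (norm_nonneg _)
      _ = _ := by ring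
  -- This integral is the error function `δ`. Shifts enter only through amplitudes bounded by `‖f
  -- z.1 * f z.2‖`, so one limit serves all `u, v ≥ 0`.
  have hlim : Tendsto (fun σ => ∫ z : ℝ × ℝ, ‖f z.1 * f z.2‖ * ‖K σ z - L z‖) (𝓝[>] 0) (𝓝 0) := by
    have h := tendsto_integral_filter_of_dominated_convergence (l := 𝓝[>] (0 : ℝ))
      (F := fun σ (z : ℝ × ℝ) => ‖f z.1 * f z.2‖ * ‖K σ z - L z‖) (f := fun _ => (0 : ℝ))
      (μ := (volume : Measure (ℝ × ℝ))) _ ?_ ?_ hbound ?_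
    · simpa using h
    · filter_upwards [self_mem_nhdsWithin] with σ hσ
      exact hff.aestronglyMeasurable.norm.mul ((hKm σ hσ).sub hLc.aestronglyMeasurable).norm
    · filter_upwards [Ioc_mem_nhdsGT hσ₀] with σ hσ
      refine Eventually.of_forall fun z => ?_
      rw [Real.norm_of_nonneg (by positivity)]
      exact hdom σ hσ.1 hσ.2 z
    · refine Eventually.of_forall fun z => ?_
      have := ((tendsto_siftProduct k hg z.1 z.2).sub_const (L z)).norm.const_mul ‖f z.1 * f z.2‖
      rwa [show (freq z.1 * freq z.2 / (freq z.1 + freq z.2)) ^ k * singularSeries k g = L z from rfl,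
        sub_self, norm_zero, mul_zero] at this
  have hev : ∀ᶠ R : ℝ in atTop, (Real.log R)⁻¹ ∈ Set.Ioc 0 σ₀ :=
    tendsto_inv_log_atTop.eventually (Ioc_mem_nhdsGT hσ₀)
  obtain ⟨R₀, hR₀⟩ := eventually_atTop.1 hev
  have key : ∀ R, R₀ ≤ R → 1 < R → ∀ u v : ℝ, 0 ≤ u → 0 ≤ v →
      |Real.log R ^ k * quadForm g (fun t => F (t + u)) (fun t => F (t + v)) R
        - S.re * sieveForm k F u v|
      ≤ ∫ z : ℝ × ℝ, ‖f z.1 * f z.2‖ * ‖K (Real.log R)⁻¹ z - L z‖ := by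
    intro R hR hR1 u v hu hv
    obtain ⟨h0, h1⟩ := hR₀ R hR
    set σ := (Real.log R)⁻¹
    have hF' : ∀ u : ℝ, 0 ≤ u → ∀ t, 1 ≤ t → F (t + u) = 0 := fun u hu t ht => hF _ (by linarith)
    have hq := quadForm_eq_integral hg (hf.shift u) (hf.shift v) (hF' u hu) (hF' v hv) hR1
    have hs := sieveForm_eq_integral hf hFs hk u v
    set a : ℝ × ℝ → ℂ := fun z => (f z.1 * Complex.exp (-(freq z.1 * u)))
      * (f z.2 * Complex.exp (-(freq z.2 * v)))
    have ha : ∀ z, ‖a z‖ ≤ ‖f z.1 * f z.2‖ := norm_shift_amplitude_le f hu hv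
    have hac : Continuous a := by
      have h1 := (hf.shift u).cont.comp (continuous_fst (X := ℝ) (Y := ℝ))
      have h2 := (hf.shift v).cont.comp (continuous_snd (X := ℝ) (Y := ℝ))
      exact h1.mul h2
    have hint : Integrable fun z => a z * K σ z := by
      refine ((integrable_pow_freq_prod hf (2 * k)).const_mul A).mono'
        (hac.aestronglyMeasurable.mul (hKm σ h0)) (Eventually.of_forall fun z => ?_)
      rw [norm_mul]
      calc _ ≤ ‖f z.1 * f z.2‖ * _ := mul_le_mul (ha z) (hKb σ h0 h1 z) (norm_nonneg _)
            (norm_nonneg _)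
        _ = _ := by ring
    have hint2 : Integrable fun z => a z * L z := by
      refine ((integrable_pow_freq_prod hf (2 * k)).const_mul A).mono'
        (hac.mul hLc).aestronglyMeasurable (Eventually.of_forall fun z => ?_)
      rw [norm_mul]
      calc _ ≤ ‖f z.1 * f z.2‖ * _ := mul_le_mul (ha z) (hLb z) (norm_nonneg _) (norm_nonneg _)
        _ = _ := by ring
    have e : ((Real.log R ^ k * quadForm g (fun t => F (t + u)) (fun t => F (t + v)) R : ℝ) : ℂ)
        - S * sieveForm k F u v = ∫ z, (a z * K σ z - a z * L z) := by
      rw [integral_sub hint hint2, Complex.ofReal_mul, hq, hs, ← integral_const_mul,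
        ← integral_const_mul]
      congr 1
      · refine integral_congr_ae (Eventually.of_forall fun z => ?_)
        simp only [a, K, σ]
        push_cast
        rw [inv_pow, inv_inv]; ring
      · refine integral_congr_ae (Eventually.of_forall fun z => ?_)
        simp only [a, L]; ring
    have hre : Real.log R ^ k * quadForm g (fun t => F (t + u)) (fun t => F (t + v)) R
        - S.re * sieveForm k F u v = (∫ z, (a z * K σ z - a z * L z)).re := by
      rw [← e, Complex.sub_re, Complex.ofReal_re, Complex.re_mul_ofReal]
    rw [hre]
    refine (Complex.abs_re_le_norm _).trans ((norm_integral_le_integral_norm _).trans ?_)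
    refine integral_mono_of_nonneg (Eventually.of_forall fun z => norm_nonneg _) ?_
      (Eventually.of_forall fun z => ?_)
    · refine hbound.mono' (hff.aestronglyMeasurable.norm.mul
        ((hKm σ h0).sub hLc.aestronglyMeasurable).norm) (Eventually.of_forall fun z => ?_)
      rw [Real.norm_of_nonneg (by positivity)]
      exact hdom σ h0 h1 z
    · simp only
      rw [← mul_sub, norm_mul]
      gcongr
      exact ha z
  refine ⟨_, hlim.comp tendsto_inv_log_atTop, ?_⟩
  filter_upwards [eventually_ge_atTop R₀, eventually_gt_atTop 1] with R hR hR1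
  exact key R hR hR1

/-- `g` with the prime `p` removed. -/
def removePrime (g : ℕ → ℝ) (p : ℕ) : ℕ → ℝ := Function.update g p 0

theorem densityError_removePrime_le (k : ℕ) (g : ℕ → ℝ) (p ℓ : Nat.Primes) :
    densityError k (removePrime g p) ℓ ≤ densityError k g ℓ + if ℓ = p then (k : ℝ) else 0 := by
  by_cases h : ℓ = p
  · subst h
    have h1 : (k : ℝ) * ((ℓ : ℕ) : ℝ)⁻¹ ≤ k :=
      mul_le_of_le_one_right (Nat.cast_nonneg k) (by linarith [inv_prime_le_half ℓ])
    have h2 : 0 ≤ (k : ℝ) * ((ℓ : ℕ) : ℝ)⁻¹ := by positivity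
    have h3 : 0 ≤ densityError k g ℓ := abs_nonneg _
    simp only [densityError, removePrime, Function.update_self, if_true, zero_sub, abs_neg,
      abs_of_nonneg h2] at *
    linarith
  · have h' : (ℓ : ℕ) ≠ p := fun h2 => h (Subtype.ext h2)
    simp [densityError, removePrime, h, h']

theorem hasSum_single_prime (k : ℝ) (p : Nat.Primes) :
    HasSum (fun ℓ : Nat.Primes => if ℓ = p then k else 0) k := by
  classical
  exact hasSum_ite_eq p k

theorem densityError_nonneg (k : ℕ) (g : ℕ → ℝ) (ℓ : Nat.Primes) : 0 ≤ densityError k g ℓ :=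
  abs_nonneg _

theorem summable_densityError_removePrime {k : ℕ} {g : ℕ → ℝ} (hg : Summable (densityError k g))
    (p : Nat.Primes) : Summable (densityError k (removePrime g p)) :=
  (hg.add (hasSum_single_prime k p).summable).of_nonneg_of_le (densityError_nonneg _ _)
    (densityError_removePrime_le k g p)

/-- The bound is the same for every `p`, so the residual products for all removed primes share one
constant. -/
theorem tsum_densityError_removePrime_le {k : ℕ} {g : ℕ → ℝ} (hg : Summable (densityError k g))
    (p : Nat.Primes) :
    ∑' ℓ, densityError k (removePrime g p) ℓ ≤ ∑' ℓ, densityError k g ℓ + k := by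
  have h := (summable_densityError_removePrime hg p).tsum_le_tsum
    (densityError_removePrime_le k g p) (hg.add (hasSum_single_prime k p).summable)
  rwa [hg.tsum_add (hasSum_single_prime k p).summable, (hasSum_single_prime k p).tsum_eq] at h

theorem siftProduct_eq_mul {k : ℕ} {g : ℕ → ℝ} (hg : Summable (densityError k g))
    (p : Nat.Primes) {s s' : ℂ} (hs : 0 < s.re) (hs' : 0 < s'.re) :
    siftProduct k g s s' = siftFactor g s s' p * siftProduct k (removePrime g p) s s' := by
  classical
  refine tendsto_nhds_unique (hasProd_siftFactor k hg hs hs') ?_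
  refine ((hasProd_siftFactor k (summable_densityError_removePrime hg p) hs hs').const_mul
    (siftFactor g s s' p)).congr' ?_
  filter_upwards [eventually_ge_atTop {p}] with t ht
  have hp : p ∈ t := ht (Finset.mem_singleton_self p)
  rw [← Finset.mul_prod_erase t (siftFactor g s s') hp,
    ← Finset.mul_prod_erase t (siftFactor (removePrime g p) s s') hp]
  have h1 : siftFactor (removePrime g p) s s' p = 1 := by simp [siftFactor, removePrime]
  rw [h1, one_mul]
  congr 1
  refine Finset.prod_congr rfl fun ℓ hℓ => ?_
  have h' : (ℓ : ℕ) ≠ p := fun h2 => (Finset.mem_erase.1 hℓ).1 (Subtype.ext h2)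
  simp [siftFactor, removePrime, h']

/-- Removing one prime from the sieve changes the quadratic form by a factor `O(g(p))`. -/
theorem exists_quadForm_removePrime_le (k : ℕ) {g : ℕ → ℝ}
    (hg : Summable (densityError k g)) {F : ℝ → ℝ} (hFs : ContDiff ℝ (⊤ : ℕ∞) F)
    (hFc : HasCompactSupport F) (hF : ∀ t, 1 ≤ t → F t = 0) : ∃ C : ℝ, 0 ≤ C ∧
      ∀ᶠ R : ℝ in atTop, ∀ (p : Nat.Primes) (u v : ℝ), 0 ≤ u → 0 ≤ v →
      |Real.log R ^ k * (quadForm g (fun t => F (t + u)) (fun t => F (t + v)) R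
        - quadForm (removePrime g p) (fun t => F (t + u)) (fun t => F (t + v)) R)| ≤ C * |g p| := by
  obtain ⟨f, hf⟩ := exists_isSpectral hFs hFc
  obtain ⟨C, σ₀, hC, hσ₀, hbd⟩ := exists_siftProduct_bound k
  set A := C * residualConst k (∑' ℓ, densityError k g ℓ + k)
  have hA : 0 ≤ A := by
    have : 0 < residualConst k (∑' ℓ, densityError k g ℓ + k) := Real.exp_pos _
    positivity
  set B := ∫ z : ℝ × ℝ, ‖f z.1 * f z.2‖ * (‖freq z.1‖ ^ (2 * k) * ‖freq z.2‖ ^ (2 * k))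
  have hB : 0 ≤ B := integral_nonneg fun z => by positivity
  refine ⟨3 * A * B, by positivity, ?_⟩
  filter_upwards [eventually_gt_atTop 1,
    tendsto_inv_log_atTop.eventually (Ioc_mem_nhdsGT hσ₀)] with R hR1 hσ p u v hu hv
  obtain ⟨h0, h1⟩ := hσ
  have hlog : 0 < Real.log R := Real.log_pos hR1
  have hF' : ∀ u : ℝ, 0 ≤ u → ∀ t, 1 ≤ t → F (t + u) = 0 := fun u hu t ht => hF _ (by linarith)
  have hg' := summable_densityError_removePrime hg p
  have hq := quadForm_eq_integral hg (hf.shift u) (hf.shift v) (hF' u hu) (hF' v hv) hR1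
  have hq' := quadForm_eq_integral hg' (hf.shift u) (hf.shift v) (hF' u hu) (hF' v hv) hR1
  set σ := (Real.log R)⁻¹
  set a : ℝ × ℝ → ℂ := fun z => (f z.1 * Complex.exp (-(freq z.1 * u)))
    * (f z.2 * Complex.exp (-(freq z.2 * v)))
  have ha : ∀ z, ‖a z‖ ≤ ‖f z.1 * f z.2‖ := norm_shift_amplitude_le f hu hv
  have hac : Continuous a := by
    have h1 := (hf.shift u).cont.comp (continuous_fst (X := ℝ) (Y := ℝ))
    have h2 := (hf.shift v).cont.comp (continuous_snd (X := ℝ) (Y := ℝ))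
    exact h1.mul h2
  have hint : ∀ g' : ℕ → ℝ, Summable (densityError k g') →
      Integrable fun z => a z * siftProduct k g' (σ * freq z.1) (σ * freq z.2) := by
    intro g' hg'
    refine ((integrable_pow_freq_prod hf (2 * k)).const_mul
      (C * residualConst k (∑' ℓ, densityError k g' ℓ) * σ ^ k)).mono'
      (hac.aestronglyMeasurable.mul (aestronglyMeasurable_siftProduct hg' h0))
      (Eventually.of_forall fun z => ?_)
    rw [norm_mul]
    calc _ ≤ ‖f z.1 * f z.2‖ * _ := mul_le_mul (ha z) (hbd σ h0 h1 g' _ hg' le_rfl _ _)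
          (norm_nonneg _) (norm_nonneg _)
      _ = _ := by ring
  have hb := hbd σ h0 h1 _ _ hg' (tsum_densityError_removePrime_le hg p)
  have hfac : ∀ z : ℝ × ℝ, ‖siftFactor g (σ * freq z.1) (σ * freq z.2) p - 1‖ ≤ 3 * |g p| := by
    intro z
    rw [siftFactor, sub_sub_cancel_left, norm_neg, norm_mul, Complex.norm_real, Real.norm_eq_abs,
      mul_comm]
    gcongr
    exact norm_add_sub_mul_le (norm_primePow_le_one p (by rw [re_mul_freq]; exact h0.le))
      (norm_primePow_le_one p (by rw [re_mul_freq]; exact h0.le))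
  -- The Euler products with and without `p` differ by the single factor at `p`, and that factor is
  -- `1 + O(|g p|)`.
  have e : ((quadForm g (fun t => F (t + u)) (fun t => F (t + v)) R
      - quadForm (removePrime g p) (fun t => F (t + u)) (fun t => F (t + v)) R : ℝ) : ℂ)
      = ∫ z, a z * ((siftFactor g (σ * freq z.1) (σ * freq z.2) p - 1)
        * siftProduct k (removePrime g p) (σ * freq z.1) (σ * freq z.2)) := by
    rw [Complex.ofReal_sub, hq, hq', ← integral_sub (hint g hg) (hint _ hg')]
    refine integral_congr_ae (Eventually.of_forall fun z => ?_)
    simp only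
    rw [siftProduct_eq_mul hg p (by rwa [re_mul_freq]) (by rwa [re_mul_freq])]
    ring
  have hn : |quadForm g (fun t => F (t + u)) (fun t => F (t + v)) R
      - quadForm (removePrime g p) (fun t => F (t + u)) (fun t => F (t + v)) R|
      ≤ 3 * |g p| * (A * σ ^ k) * B := by
    rw [← Real.norm_eq_abs, ← Complex.norm_real, e, ← integral_const_mul]
    refine (norm_integral_le_integral_norm _).trans ?_
    refine integral_mono_of_nonneg (Eventually.of_forall fun z => norm_nonneg _)
      ((integrable_pow_freq_prod hf (2 * k)).const_mul _) (Eventually.of_forall fun z => ?_)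
    simp only
    rw [norm_mul (a z), norm_mul (siftFactor _ _ _ _ - 1)]
    calc _ ≤ ‖f z.1 * f z.2‖ * ((3 * |g p|) * (A * σ ^ k
          * (‖freq z.1‖ ^ (2 * k) * ‖freq z.2‖ ^ (2 * k)))) := by
          have hm := mul_le_mul (hfac z) (hb z.1 z.2) (norm_nonneg _) (by positivity)
          exact mul_le_mul (ha z) hm (by positivity) (norm_nonneg _)
      _ = _ := by ring
  rw [abs_mul, abs_of_pos (pow_pos hlog k)]
  calc _ ≤ Real.log R ^ k * (3 * |g p| * (A * σ ^ k) * B) := by gcongr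
    _ = (Real.log R * σ) ^ k * (3 * A * B * |g p|) := by rw [mul_pow]; ring
    _ = _ := by rw [mul_inv_cancel₀ hlog.ne', one_pow, one_mul]

end GapsE2
end

noncomputable section

open Filter Asymptotics Topology

namespace GapsE2

/-! ### The sieve densities of the triple and of the pair -/

/-- Density `3 / p` for the condition `p ∣ n (n + 2) (n + 6)`, away from `2` and `3`. -/
def tripleDensity (p : ℕ) : ℝ := if p ≤ 3 then 0 else 3 / p

/-- Density `2 / (p - 1)` for the remaining two factors on reduced classes, away from `2`, `3`. -/
def pairDensity (p : ℕ) : ℝ := if p ≤ 3 then 0 else 2 / (p - 1)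

/-- There is no error at primes above `3`; at `2` and `3` it is `3/p ≤ 9/p²`. -/
theorem summable_tripleDensity : Summable (densityError 3 tripleDensity) := by
  refine (summable_inv_prime_sq.mul_left 9).of_nonneg_of_le (densityError_nonneg _ _) fun ℓ => ?_
  have hp : (0 : ℝ) < (ℓ : ℕ) := by exact_mod_cast ℓ.2.pos
  unfold densityError tripleDensity
  split_ifs with h
  · have h3 : ((ℓ : ℕ) : ℝ) ≤ 3 := by exact_mod_cast h
    rw [zero_sub, abs_neg, abs_of_nonneg (by positivity)]
    push_cast
    rw [inv_pow, ← div_eq_mul_inv, ← div_eq_mul_inv, div_le_div_iff₀ hp (by positivity)]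
    nlinarith
  · push_cast
    rw [div_eq_mul_inv, sub_self, abs_zero]; positivity

theorem five_le_of_three_lt (ℓ : Nat.Primes) (h : ¬ (ℓ : ℕ) ≤ 3) : (5 : ℝ) ≤ (ℓ : ℕ) := by
  have h4 : (ℓ : ℕ) ≠ 4 := fun h4 => by
    have := ℓ.2; rw [h4] at this; revert this; decide
  exact_mod_cast (by omega : 5 ≤ (ℓ : ℕ))

theorem summable_pairDensity : Summable (densityError 2 pairDensity) := by
  refine (summable_inv_prime_sq.mul_left 9).of_nonneg_of_le (densityError_nonneg _ _) fun ℓ => ?_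
  have hp : (0 : ℝ) < (ℓ : ℕ) := by exact_mod_cast ℓ.2.pos
  unfold densityError pairDensity
  split_ifs with h
  · have h3 : ((ℓ : ℕ) : ℝ) ≤ 3 := by exact_mod_cast h
    rw [zero_sub, abs_neg, abs_of_nonneg (by positivity)]
    push_cast
    rw [inv_pow, ← div_eq_mul_inv, ← div_eq_mul_inv, div_le_div_iff₀ hp (by positivity)]
    nlinarith
  · have h5 := five_le_of_three_lt ℓ h
    have e : (2 : ℝ) / (((ℓ : ℕ) : ℝ) - 1) - ((2 : ℕ) : ℝ) * ((ℓ : ℕ) : ℝ)⁻¹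
        = 2 / ((((ℓ : ℕ) : ℝ) - 1) * (ℓ : ℕ)) := by
      have : ((ℓ : ℕ) : ℝ) - 1 ≠ 0 := by linarith
      field_simp; push_cast; ring
    have h1 : 0 < ((ℓ : ℕ) : ℝ) - 1 := by linarith
    rw [e, abs_of_nonneg (by positivity), inv_pow, ← div_eq_mul_inv,
      div_le_div_iff₀ (by positivity) (by positivity)]
    nlinarith

/-- The factor at `ℓ` of the singular series. -/
def singularFactor (k : ℕ) (g : ℕ → ℝ) (ℓ : Nat.Primes) : ℝ :=
  (1 - g ℓ) * ((1 - ((ℓ : ℕ) : ℝ)⁻¹)⁻¹) ^ k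

theorem hasProd_singularFactor (k : ℕ) {g : ℕ → ℝ} (hg : Summable (densityError k g)) :
    HasProd (fun ℓ => (singularFactor k g ℓ : ℂ)) (singularSeries k g) := by
  have h := hasProd_residual k hg (s := 0) (s' := 0) le_rfl le_rfl
  have e : (fun ℓ => (singularFactor k g ℓ : ℂ))
      = fun ℓ => siftFactor g 0 0 ℓ * zetaFactor 0 0 ℓ ^ k := by
    funext ℓ
    have h2 := inv_prime_le_half ℓ
    have hne : (1 : ℂ) - ((ℓ : ℕ) : ℂ)⁻¹ ≠ 0 := by
      have : ((1 - ((ℓ : ℕ) : ℝ)⁻¹ : ℝ) : ℂ) ≠ 0 := Complex.ofReal_ne_zero.2 (by linarith)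
      push_cast at this
      exact this
    simp only [singularFactor, siftFactor, zetaFactor, primePow, neg_zero, Complex.cpow_zero]
    push_cast
    rw [mul_one, mul_one, add_sub_cancel_right, mul_one, div_mul_cancel_left₀ hne]
  rw [e]; exact h

/-- For `ℓ > 3`, `(1 - 2/(ℓ-1)) (1 - 1/ℓ)⁻² = (1 - 3/ℓ) (1 - 1/ℓ)⁻³`, so the local factors agree. At
`2` and `3` both densities vanish and the ratio is `(1 - 1/ℓ)⁻¹`; the two ratios multiply to `2 ·
3/2 = 3`. -/
theorem singularSeries_triple : singularSeries 3 tripleDensity = 3 * singularSeries 2 pairDensity := by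
  set two : Nat.Primes := ⟨2, Nat.prime_two⟩
  set three : Nat.Primes := ⟨3, Nat.prime_three⟩
  have h23 : two ≠ three := fun h => by
    have := congrArg Subtype.val h
    simp [two, three] at this
  set c : Nat.Primes → ℂ := fun ℓ => if (ℓ : ℕ) ≤ 3 then ((1 - ((ℓ : ℕ) : ℂ)⁻¹)⁻¹) else 1
  have hc : HasProd c 3 := by
    classical
    have h : HasProd c (∏ ℓ ∈ {two, three}, c ℓ) := hasProd_prod_of_ne_finset_one fun ℓ hℓ => by
      simp only [c]
      rw [if_neg]
      intro h
      have h2 := ℓ.2.two_le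
      apply hℓ
      rw [Finset.mem_insert, Finset.mem_singleton]
      rcases (by omega : (ℓ : ℕ) = 2 ∨ (ℓ : ℕ) = 3) with h | h
      · exact Or.inl (Subtype.ext h)
      · exact Or.inr (Subtype.ext h)
    rw [Finset.prod_pair h23] at h
    convert! h using 1
    simp only [c, two, three]
    norm_num
  have h := (hasProd_singularFactor 2 summable_pairDensity).mul hc
  have e : (fun ℓ => (singularFactor 2 pairDensity ℓ : ℂ) * c ℓ)
      = fun ℓ => (singularFactor 3 tripleDensity ℓ : ℂ) := by
    funext ℓ
    simp only [c, singularFactor, pairDensity, tripleDensity]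
    split_ifs with h
    · push_cast; ring
    · have h5 := five_le_of_three_lt ℓ h
      have : (1 - 2 / (((ℓ : ℕ) : ℝ) - 1)) * ((1 - ((ℓ : ℕ) : ℝ)⁻¹)⁻¹) ^ 2
          = (1 - 3 / ((ℓ : ℕ) : ℝ)) * ((1 - ((ℓ : ℕ) : ℝ)⁻¹)⁻¹) ^ 3 := by
        have h1 : ((ℓ : ℕ) : ℝ) ≠ 0 := by linarith
        have h2 : ((ℓ : ℕ) : ℝ) - 1 ≠ 0 := by linarith
        field_simp
        ring
      rw [mul_one, this]
  rw [e] at h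
  rw [(hasProd_singularFactor 3 summable_tripleDensity).unique h, mul_comm]

theorem singularFactor_pos (ℓ : Nat.Primes) : 0 < singularFactor 2 pairDensity ℓ := by
  have h2 := inv_prime_le_half ℓ
  refine mul_pos ?_ (pow_pos (inv_pos.2 (by linarith)) _)
  unfold pairDensity
  split_ifs with h
  · norm_num
  · have h5 := five_le_of_three_lt ℓ h
    rw [sub_pos, div_lt_one (by linarith)]; linarith

/-- All local factors are positive and absolutely close to `1`, so the product is the exponential of
a convergent sum of logarithms. -/
theorem singularSeries_pair_pos : 0 < (singularSeries 2 pairDensity).re := by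
  have hs : Summable fun ℓ => ‖singularFactor 2 pairDensity ℓ - 1‖ := by
    refine (summable_residual 2 summable_pairDensity (s := 0) (s' := 0) le_rfl le_rfl).congr
      fun ℓ => ?_
    have h2 := inv_prime_le_half ℓ
    have hne : (1 : ℂ) - ((ℓ : ℕ) : ℂ)⁻¹ ≠ 0 := by
      have : ((1 - ((ℓ : ℕ) : ℝ)⁻¹ : ℝ) : ℂ) ≠ 0 := Complex.ofReal_ne_zero.2 (by linarith)
      push_cast at this
      exact this
    rw [← Complex.norm_real]
    congr 1
    simp only [singularFactor, siftFactor, zetaFactor, primePow, neg_zero, Complex.cpow_zero]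
    push_cast
    rw [mul_one, mul_one, add_sub_cancel_right, mul_one, div_mul_cancel_left₀ hne]
  have hlog : Summable fun ℓ => Real.log (singularFactor 2 pairDensity ℓ) := by
    have := Real.summable_log_one_add_of_summable hs.of_norm
    simpa using this
  have h1 := Real.hasProd_of_hasSum_log singularFactor_pos hlog.hasSum
  have h2 : HasProd (fun ℓ => (singularFactor 2 pairDensity ℓ : ℂ))
      ((Real.exp (∑' ℓ, Real.log (singularFactor 2 pairDensity ℓ)) : ℝ) : ℂ) :=
    h1.map Complex.ofRealHom Complex.continuous_ofReal
  rw [(hasProd_singularFactor 2 summable_pairDensity).unique h2, Complex.ofReal_re]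
  exact Real.exp_pos _

end GapsE2
end

noncomputable section

open Filter Asymptotics Topology MeasureTheory

namespace GapsE2

/-! ### Mertens' estimate and weighted sums over primes -/

/-- The primes up to `x`. -/
def primesTo (x : ℝ) : Finset ℕ := (Finset.Icc 1 ⌊x⌋₊).filter Nat.Prime

theorem mem_primesTo {x : ℝ} (hx : 0 ≤ x) {p : ℕ} : p ∈ primesTo x ↔ p.Prime ∧ (p : ℝ) ≤ x := by
  rw [primesTo, Finset.mem_filter, Finset.mem_Icc, Nat.le_floor_iff hx]
  exact ⟨fun h => ⟨h.2, h.1.2⟩, fun h => ⟨⟨h.1.one_le, h.2⟩, h.1⟩⟩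

/-- The constant `∑_p log p / (p (p - 1))`. -/
def primeLogConst : ℝ :=
  ∑' p : Nat.Primes, Real.log (p : ℕ) / (((p : ℕ) : ℝ) * (((p : ℕ) : ℝ) - 1))

theorem sum_primes_le_tsum {f : Nat.Primes → ℝ} (hf : Summable f) (h0 : ∀ ℓ, 0 ≤ f ℓ)
    (s : Finset ℕ) (hs : ∀ p ∈ s, p.Prime) (φ : ℕ → ℝ) (hφ : ∀ ℓ : Nat.Primes, φ ℓ = f ℓ) :
    ∑ p ∈ s, φ p ≤ ∑' ℓ, f ℓ := by
  let t : Finset Nat.Primes := s.subtype Nat.Prime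
  have e : ∑ p ∈ s, φ p = ∑ ℓ ∈ t, f ℓ := by
    rw [← Finset.sum_subtype_of_mem φ hs]
    exact Finset.sum_congr rfl fun ℓ _ => hφ ℓ
  rw [e]
  exact hf.sum_le_tsum t fun ℓ _ => h0 ℓ

theorem sum_log_div_mul_sub_one_le (x : ℝ) :
    ∑ p ∈ primesTo x, Real.log p / ((p : ℝ) * (p - 1)) ≤ primeLogConst := by
  refine sum_primes_le_tsum summable_C₀ (fun ℓ => ?_) _ (fun p hp => (Finset.mem_filter.1 hp).2) _
    fun ℓ => rfl
  have : (1 : ℝ) ≤ (ℓ : ℕ) := by exact_mod_cast ℓ.2.one_le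
  exact div_nonneg (Real.log_natCast_nonneg _) (mul_nonneg (by positivity) (by linarith))

theorem log_factorial_eq (n : ℕ) : Real.log n.factorial
    = ∑ p ∈ (Finset.Icc 1 n).filter Nat.Prime, (n.factorial.factorization p : ℝ) * Real.log p := by
  have h := Nat.prod_factorization_pow_eq_self n.factorial_ne_zero
  have hs : n.factorial.factorization.support = (Finset.Icc 1 n).filter Nat.Prime := by
    ext p
    rw [Nat.support_factorization, Nat.mem_primeFactors, Finset.mem_filter, Finset.mem_Icc]
    constructor
    · rintro ⟨hp, hd, _⟩
      exact ⟨⟨hp.one_le, hp.dvd_factorial.1 hd⟩, hp⟩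
    · rintro ⟨⟨_, h⟩, hp⟩
      exact ⟨hp, hp.dvd_factorial.2 h, n.factorial_ne_zero⟩
  conv_lhs => rw [← h]
  rw [Finsupp.prod, hs, Nat.cast_prod, Real.log_prod]
  · exact Finset.sum_congr rfl fun p _ => by rw [Nat.cast_pow, Real.log_pow]
  · intro p hp
    have := (Finset.mem_filter.1 hp).2.pos
    positivity

theorem div_le_factorization_factorial {p n : ℕ} (hp : p.Prime) (hpn : p ≤ n) :
    (n : ℝ) / p - 1 ≤ n.factorial.factorization p := by
  rw [Nat.factorization_factorial hp (Nat.lt_succ_self (Nat.log p n))]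
  have h1 : n / p ≤ ∑ i ∈ Finset.Ico 1 (Nat.log p n).succ, n / p ^ i := by
    have hm : 1 ∈ Finset.Ico 1 (Nat.log p n).succ := by
      rw [Finset.mem_Ico]
      exact ⟨le_rfl, Nat.succ_lt_succ (Nat.log_pos hp.one_lt hpn)⟩
    have := Finset.single_le_sum (f := fun i => n / p ^ i) (fun i _ => Nat.zero_le _) hm
    simpa using this
  have h2 : (n : ℝ) / p < (n / p : ℕ) + 1 := by
    rw [div_lt_iff₀ (by exact_mod_cast hp.pos)]
    exact_mod_cast (Nat.lt_succ_iff.2 le_rfl).trans_le (Nat.succ_le_of_lt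
      (by have := Nat.lt_mul_div_succ n hp.pos; rw [mul_comm] at this; exact this))
  have h3 : ((n / p : ℕ) : ℝ) ≤ ((∑ i ∈ Finset.Ico 1 (Nat.log p n).succ, n / p ^ i : ℕ) : ℝ) := by
    exact_mod_cast h1
  linarith

theorem factorization_factorial_le {p n : ℕ} (hp : p.Prime) :
    (n.factorial.factorization p : ℝ) ≤ n / (p - 1) := by
  have := Fact.mk hp
  have h := sub_one_mul_padicValNat_factorial (p := p) n
  rw [← Nat.factorization_def _ hp] at h
  have h2 : (p - 1) * n.factorial.factorization p ≤ n := by omega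
  have hp1 : (1 : ℝ) < p := by exact_mod_cast hp.one_lt
  rw [le_div_iff₀ (by linarith), mul_comm]
  have h3 : (((p - 1) * n.factorial.factorization p : ℕ) : ℝ) ≤ n := by exact_mod_cast h2
  rwa [Nat.cast_mul, Nat.cast_sub hp.one_le, Nat.cast_one] at h3

/-- Mertens' first theorem. -/
theorem exists_mertens : ∃ C : ℝ, 0 ≤ C ∧ ∀ x : ℝ, 1 ≤ x →
    |∑ p ∈ primesTo x, Real.log p / p - Real.log x| ≤ C := by
  have hT : 0 ≤ primeLogConst := tsum_nonneg fun ℓ => by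
    have : (1 : ℝ) ≤ (ℓ : ℕ) := by exact_mod_cast ℓ.2.one_le
    exact div_nonneg (Real.log_natCast_nonneg _) (mul_nonneg (by positivity) (by linarith))
  have hl4 : 0 ≤ Real.log 4 := Real.log_nonneg (by norm_num)
  have hl2 : 0 ≤ Real.log 2 := Real.log_nonneg (by norm_num)
  refine ⟨Real.log 4 + Real.log 2 + 1 + primeLogConst, by positivity, fun x hx => ?_⟩
  set n := ⌊x⌋₊
  have hn : 1 ≤ n := Nat.le_floor (by exact_mod_cast hx)
  have hn0 : (0 : ℝ) < n := by exact_mod_cast hn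
  have hnx : (n : ℝ) ≤ x := Nat.floor_le (by linarith)
  have hxn : x < n + 1 := Nat.lt_floor_add_one x
  have hlog1 : Real.log n ≤ Real.log x := Real.log_le_log hn0 hnx
  have hlog2 : Real.log x ≤ Real.log n + Real.log 2 := by
    rw [← Real.log_mul hn0.ne' (by norm_num)]
    refine Real.log_le_log (by linarith) ?_
    have : (1 : ℝ) ≤ n := by exact_mod_cast hn
    linarith
  -- The size of `log n!` comes from `n! ≤ n^n` and `n^n / n! ≤ e^n`.
  have hup : Real.log n.factorial ≤ n * Real.log n := by
    rw [← Real.log_pow]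
    exact Real.log_le_log (by exact_mod_cast n.factorial_pos) (by exact_mod_cast n.factorial_le_pow)
  have hlo : n * Real.log n - n ≤ Real.log n.factorial := by
    have h := Real.pow_div_factorial_le_exp n hn0.le n
    have hf : (0 : ℝ) < n.factorial := by exact_mod_cast n.factorial_pos
    have := Real.log_le_log (by positivity) h
    rw [Real.log_exp, Real.log_div (by positivity) hf.ne', Real.log_pow] at this
    linarith
  have hfac := log_factorial_eq n
  set M := ∑ p ∈ primesTo x, Real.log p / p
  have hpr : ∀ p ∈ (Finset.Icc 1 n).filter Nat.Prime, p.Prime ∧ p ≤ n := fun p hp =>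
    ⟨(Finset.mem_filter.1 hp).2, (Finset.mem_Icc.1 (Finset.mem_filter.1 hp).1).2⟩
  -- The exponent of `p` in `n!` is at least `n/p - 1`; the `-1` costs `∑ log p`, which Chebyshev
  -- bounds by `n log 4`.
  have h1 : n * M - Real.log 4 * n ≤ Real.log n.factorial := by
    have hth := Chebyshev.theta_le_log4_mul_x hn0.le
    rw [Chebyshev.theta_eq_sum_Icc, Nat.floor_natCast] at hth
    have hth2 : ∑ p ∈ (Finset.Icc 1 n).filter Nat.Prime, Real.log p ≤ Real.log 4 * n := by
      refine le_trans (Finset.sum_le_sum_of_subset_of_nonneg ?_ fun p _ _ =>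
        Real.log_natCast_nonneg p) hth
      exact Finset.filter_subset_filter _ (Finset.Icc_subset_Icc_left (Nat.zero_le 1))
    have : n * M - ∑ p ∈ (Finset.Icc 1 n).filter Nat.Prime, Real.log p ≤ Real.log n.factorial := by
      rw [hfac, Finset.mul_sum, primesTo, ← Finset.sum_sub_distrib]
      refine Finset.sum_le_sum fun p hp => ?_
      have h := div_le_factorization_factorial (hpr p hp).1 (hpr p hp).2
      have hlp : 0 ≤ Real.log p := Real.log_natCast_nonneg p
      calc _ = ((n : ℝ) / p - 1) * Real.log p := by ring
        _ ≤ _ := by gcongr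
    linarith
  -- The exponent of `p` in `n!` is at most `n/(p-1)`, and `1/(p-1) = 1/p + 1/(p(p-1))`.
  have h2 : Real.log n.factorial ≤ n * M + n * primeLogConst := by
    have hT2 := sum_log_div_mul_sub_one_le x
    refine le_trans ?_ (add_le_add_right (mul_le_mul_of_nonneg_left hT2 hn0.le) _)
    rw [hfac, ← mul_add, ← Finset.sum_add_distrib, Finset.mul_sum, primesTo]
    refine Finset.sum_le_sum fun p hp => ?_
    have h := factorization_factorial_le (n := n) (hpr p hp).1
    have hlp : 0 ≤ Real.log p := Real.log_natCast_nonneg p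
    have hp1 : (1 : ℝ) < p := by exact_mod_cast (hpr p hp).1.one_lt
    have hp2 : (p : ℝ) - 1 ≠ 0 := by linarith
    have hp3 : (p : ℝ) ≠ 0 := by linarith
    calc _ ≤ n / ((p : ℝ) - 1) * Real.log p := by gcongr
      _ = _ := by field_simp; ring
  have h3 : M ≤ Real.log n + Real.log 4 := by
    have : n * M ≤ n * (Real.log n + Real.log 4) := by nlinarith
    exact le_of_mul_le_mul_left this hn0
  have h4 : Real.log n - 1 - primeLogConst ≤ M := by
    have : n * (Real.log n - 1 - primeLogConst) ≤ n * M := by nlinarith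
    exact le_of_mul_le_mul_left this hn0
  rw [abs_le]
  constructor <;> linarith

/-- The normalised sum `(log R)⁻¹ ∑_{p ≤ R} (log p / p) φ(log p / log R)`. -/
def primeMean (φ : ℝ → ℝ) (R : ℝ) : ℝ :=
  (Real.log R)⁻¹ * ∑ p ∈ primesTo R, Real.log p / p * φ (Real.log p / Real.log R)

/-- The condition cuts the sum at `R^a`, where Mertens gives `a log R + O(1)`. -/
theorem tendsto_primeMean_indicator {a : ℝ} (ha : 0 ≤ a) (ha1 : a ≤ 1) :
    Tendsto (primeMean fun u => if u ≤ a then 1 else 0) atTop (𝓝 a) := by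
  obtain ⟨C, hC, hM⟩ := exists_mertens
  have hlim : Tendsto (fun R : ℝ => C * (Real.log R)⁻¹) atTop (𝓝 0) := by
    simpa using (tendsto_inv_atTop_zero.comp Real.tendsto_log_atTop).const_mul C
  refine tendsto_iff_norm_sub_tendsto_zero.2 (squeeze_zero' (Eventually.of_forall fun _ =>
    norm_nonneg _) ?_ hlim)
  filter_upwards [eventually_gt_atTop 1] with R hR
  have hl := Real.log_pos hR
  have hR0 : 0 < R := by linarith
  have h1 : (1 : ℝ) ≤ R ^ a := Real.one_le_rpow hR.le ha
  have e : ∑ p ∈ primesTo R, Real.log p / p * (if Real.log p / Real.log R ≤ a then 1 else 0)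
      = ∑ p ∈ primesTo (R ^ a), Real.log p / p := by
    have hs : primesTo (R ^ a) = (primesTo R).filter fun p : ℕ => Real.log p / Real.log R ≤ a := by
      ext p
      rw [mem_primesTo (by linarith), Finset.mem_filter, mem_primesTo hR0.le]
      have key : p.Prime → (Real.log p / Real.log R ≤ a ↔ (p : ℝ) ≤ R ^ a) := fun hp => by
        rw [div_le_iff₀ hl, ← Real.log_rpow hR0, Real.log_le_log_iff (by exact_mod_cast hp.pos)
          (by linarith)]
      constructor
      · rintro ⟨hp, h⟩
        refine ⟨⟨hp, h.trans ?_⟩, (key hp).2 h⟩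
        calc R ^ a ≤ R ^ (1 : ℝ) := Real.rpow_le_rpow_of_exponent_le hR.le ha1
          _ = R := Real.rpow_one R
      · rintro ⟨⟨hp, _⟩, h⟩
        exact ⟨hp, (key hp).1 h⟩
    rw [hs, Finset.sum_filter]
    exact Finset.sum_congr rfl fun p _ => by split_ifs <;> simp
  have h2 := hM _ h1
  rw [Real.log_rpow hR0] at h2
  rw [primeMean, e, Real.norm_eq_abs]
  have e2 : (Real.log R)⁻¹ * ∑ p ∈ primesTo (R ^ a), Real.log p / p - a
      = (Real.log R)⁻¹ * (∑ p ∈ primesTo (R ^ a), Real.log p / p - a * Real.log R) := by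
    field_simp
  rw [e2, abs_mul, abs_of_pos (inv_pos.2 hl), mul_comm]
  gcongr

/-- The step function interpolating `φ` at the right end points of the intervals of length `1/M`. -/
def stepFun (φ : ℝ → ℝ) (M : ℕ) (u : ℝ) : ℝ :=
  φ 1 * (if u ≤ 1 then 1 else 0)
    - ∑ j ∈ Finset.range M, (φ ((j + 1 : ℕ) / M) - φ ((j : ℕ) / M)) * (if u ≤ (j : ℝ) / M then 1 else 0)

/-- The indicator of `u ≤ j/M` is active exactly from `j = ⌈u M⌉` on, so the sum telescopes. -/
theorem stepFun_eq (φ : ℝ → ℝ) {M : ℕ} (hM : 0 < M) {u : ℝ} (hu : u ≤ 1) :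
    stepFun φ M u = φ ((⌈u * M⌉₊ : ℕ) / M) := by
  have hM' : (0 : ℝ) < M := by exact_mod_cast hM
  have hc : ⌈u * M⌉₊ ≤ M := Nat.ceil_le.2 (by nlinarith)
  have hiff : ∀ j : ℕ, u ≤ (j : ℝ) / M ↔ ⌈u * M⌉₊ ≤ j := fun j => by
    rw [le_div_iff₀ hM', Nat.ceil_le]
  set c := ⌈u * M⌉₊
  rw [stepFun, if_pos hu, mul_one]
  have : ∑ j ∈ Finset.range M, (φ ((j + 1 : ℕ) / M) - φ ((j : ℕ) / M))
      * (if u ≤ (j : ℝ) / M then 1 else 0)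
      = ∑ j ∈ Finset.Ico c M, (φ ((j + 1 : ℕ) / M) - φ ((j : ℕ) / M)) := by
    have hsub : Finset.Ico c M = (Finset.range M).filter fun j : ℕ => u ≤ (j : ℝ) / M := by
      ext j
      rw [Finset.mem_Ico, Finset.mem_filter, Finset.mem_range, hiff]
      tauto
    rw [hsub, Finset.sum_filter]
    exact Finset.sum_congr rfl fun p _ => by split_ifs <;> simp
  rw [this, Finset.sum_Ico_eq_sub _ hc, Finset.sum_range_sub (fun j : ℕ => φ ((j : ℕ) / M)),
    Finset.sum_range_sub (fun j : ℕ => φ ((j : ℕ) / M)), div_self hM'.ne']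
  ring

theorem integral_indicator_le {a : ℝ} (ha : 0 ≤ a) (ha1 : a ≤ 1) :
    ∫ u in Set.Ioc (0 : ℝ) 1, (if u ≤ a then (1 : ℝ) else 0) = a := by
  have e : (fun u : ℝ => if u ≤ a then (1 : ℝ) else 0) = (Set.Iic a).indicator 1 := by
    funext u; simp [Set.indicator_apply]
  rw [e, integral_indicator measurableSet_Iic, Measure.restrict_restrict measurableSet_Iic]
  have : Set.Iic a ∩ Set.Ioc 0 1 = Set.Ioc 0 a := by
    ext u; simp only [Set.mem_inter_iff, Set.mem_Iic, Set.mem_Ioc]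
    exact ⟨fun h => ⟨h.2.1, h.1⟩, fun h => ⟨h.2, h.1, h.2.trans ha1⟩⟩
  rw [this]
  simp [ha]

theorem integrable_indicator_le (a : ℝ) :
    IntegrableOn (fun u : ℝ => if u ≤ a then (1 : ℝ) else 0) (Set.Ioc 0 1) := by
  have e : (fun u : ℝ => if u ≤ a then (1 : ℝ) else 0) = (Set.Iic a).indicator 1 := by
    funext u; simp [Set.indicator_apply]
  rw [e]
  have h : IntegrableOn (1 : ℝ → ℝ) (Set.Ioc 0 1) := by
    show IntegrableOn (fun _ : ℝ => (1 : ℝ)) (Set.Ioc 0 1) volume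
    simp
  exact Integrable.indicator h measurableSet_Iic

theorem integrableOn_stepFun (φ : ℝ → ℝ) (M : ℕ) : IntegrableOn (stepFun φ M) (Set.Ioc 0 1) := by
  unfold stepFun
  exact ((integrable_indicator_le 1).const_mul _).sub
    (integrable_finsetSum _ fun j _ => (integrable_indicator_le _).const_mul _)

theorem tendsto_primeMean_stepFun (φ : ℝ → ℝ) {M : ℕ} (hM : 0 < M) :
    Tendsto (primeMean (stepFun φ M)) atTop (𝓝 (∫ u in Set.Ioc (0 : ℝ) 1, stepFun φ M u)) := by
  have hM' : (0 : ℝ) < M := by exact_mod_cast hM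
  have hj : ∀ j ∈ Finset.range M, (j : ℝ) / M ≤ 1 := fun j hj => by
    rw [div_le_one hM']; exact_mod_cast (Finset.mem_range.1 hj).le
  have e1 : ∫ u in Set.Ioc (0 : ℝ) 1, stepFun φ M u = φ 1 * 1
      - ∑ j ∈ Finset.range M, (φ ((j + 1 : ℕ) / M) - φ ((j : ℕ) / M)) * ((j : ℝ) / M) := by
    unfold stepFun
    rw [integral_sub ((integrable_indicator_le 1).const_mul _)
      (integrable_finsetSum _ fun j _ => (integrable_indicator_le _).const_mul _),
      integral_finsetSum _ fun j _ => (integrable_indicator_le _).const_mul _,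
      integral_const_mul, integral_indicator_le zero_le_one le_rfl]
    congr 1
    refine Finset.sum_congr rfl fun j hj' => ?_
    rw [integral_const_mul, integral_indicator_le (by positivity) (hj j hj')]
  have e2 : primeMean (stepFun φ M) = fun R => φ 1 * primeMean (fun u => if u ≤ 1 then 1 else 0) R
      - ∑ j ∈ Finset.range M, (φ ((j + 1 : ℕ) / M) - φ ((j : ℕ) / M))
        * primeMean (fun u => if u ≤ (j : ℝ) / M then 1 else 0) R := by
    funext R
    simp only [primeMean, stepFun, mul_sub, Finset.sum_sub_distrib, Finset.mul_sum]
    rw [Finset.sum_comm]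
    congr 1
    · exact Finset.sum_congr rfl fun p _ => by ring
    · exact Finset.sum_congr rfl fun p _ => Finset.sum_congr rfl fun j _ => by ring
  rw [e1, e2]
  exact ((tendsto_primeMean_indicator zero_le_one le_rfl).const_mul _).sub
    (tendsto_finsetSum _ fun j hj' =>
      (tendsto_primeMean_indicator (by positivity) (hj j hj')).const_mul _)

theorem abs_primeMean_sub_le {φ ψ : ℝ → ℝ} {ε : ℝ} (h : ∀ u, 0 ≤ u → u ≤ 1 → |φ u - ψ u| ≤ ε)
    {R : ℝ} (hR : 1 < R) :
    |primeMean φ R - primeMean ψ R| ≤ ε * ((Real.log R)⁻¹ * ∑ p ∈ primesTo R, Real.log p / p) := by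
  have hl := Real.log_pos hR
  rw [primeMean, primeMean, ← mul_sub, ← Finset.sum_sub_distrib, abs_mul, abs_of_pos (inv_pos.2 hl),
    ← mul_left_comm]
  gcongr
  rw [Finset.mul_sum]
  refine (Finset.abs_sum_le_sum_abs _ _).trans (Finset.sum_le_sum fun p hp => ?_)
  obtain ⟨hp, hpR⟩ := (mem_primesTo (by linarith)).1 hp
  have hlp : 0 ≤ Real.log p := Real.log_natCast_nonneg p
  rw [← mul_sub, abs_mul, abs_of_nonneg (by positivity), mul_comm]
  gcongr
  refine h _ (by positivity) ?_
  rw [div_le_one hl]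
  exact Real.log_le_log (by exact_mod_cast hp.pos) hpR

/-- The primes `p ≤ R`, weighted by `log p / (p log R)`, equidistribute in `log p / log R`. -/
theorem tendsto_primeMean {φ : ℝ → ℝ} (hφ : ContinuousOn φ (Set.Icc 0 1)) :
    Tendsto (primeMean φ) atTop (𝓝 (∫ u in Set.Ioc (0 : ℝ) 1, φ u)) := by
  obtain ⟨C, hC, hMert⟩ := exists_mertens
  rw [Metric.tendsto_atTop']
  intro ε hε
  set η := ε / 8
  have hη : 0 < η := by positivity
  have huc := isCompact_Icc.uniformContinuousOn_of_continuous hφ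
  rw [Metric.uniformContinuousOn_iff] at huc
  obtain ⟨δ, hδ, huc⟩ := huc η hη
  obtain ⟨M, hMδ⟩ := exists_nat_gt (1 / δ)
  have hM' : (0 : ℝ) < M := lt_trans (by positivity) hMδ
  have hM : 0 < M := by exact_mod_cast hM'
  have hMδ' : 1 / (M : ℝ) < δ := by
    rw [div_lt_iff₀ hM']; rw [div_lt_iff₀ hδ] at hMδ; linarith
  have happ : ∀ u, 0 ≤ u → u ≤ 1 → |φ u - stepFun φ M u| ≤ η := fun u h0 h1 => by
    rw [stepFun_eq φ hM h1]
    have hc1 : u ≤ (⌈u * M⌉₊ : ℝ) / M := by rw [le_div_iff₀ hM']; exact Nat.le_ceil _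
    have hc2 : (⌈u * M⌉₊ : ℝ) / M < u + 1 / M := by
      rw [div_lt_iff₀ hM', add_mul, one_div, inv_mul_cancel₀ hM'.ne']
      exact Nat.ceil_lt_add_one (by positivity)
    have hc3 : (⌈u * M⌉₊ : ℝ) / M ≤ 1 := by
      rw [div_le_one hM']; exact_mod_cast Nat.ceil_le.2 (by nlinarith)
    refine (huc u ⟨h0, h1⟩ _ ⟨h0.trans hc1, hc3⟩ ?_).le
    rw [Real.dist_eq, abs_lt]
    constructor <;> linarith
  have hint : |(∫ u in Set.Ioc (0 : ℝ) 1, stepFun φ M u) - ∫ u in Set.Ioc (0 : ℝ) 1, φ u| ≤ η := by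
    have hφi : IntegrableOn φ (Set.Ioc 0 1) :=
      (hφ.integrableOn_compact isCompact_Icc).mono_set Set.Ioc_subset_Icc_self
    rw [← integral_sub (integrableOn_stepFun φ M) hφi]
    have := norm_setIntegral_le_of_norm_le_const (μ := volume) (s := Set.Ioc (0 : ℝ) 1) (C := η)
      (f := fun u => stepFun φ M u - φ u) (by simp) (fun u hu => by
        rw [Real.norm_eq_abs, abs_sub_comm]; exact happ u hu.1.le hu.2)
    simpa using this
  have hstep := Metric.tendsto_atTop'.1 (tendsto_primeMean_stepFun φ hM) η hη
  obtain ⟨R₁, hR₁⟩ := hstep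
  -- Beyond `exp (C + 1)` the Mertens error is at most `log R`, so the normalised prime weights have
  -- total mass at most `2`.
  refine ⟨max R₁ (Real.exp (C + 1)), fun R hR => ?_⟩
  have hR1 : R₁ < R := lt_of_le_of_lt (le_max_left _ _) hR
  have hR2 : Real.exp (C + 1) < R := lt_of_le_of_lt (le_max_right _ _) hR
  have hR3 : 1 < R := lt_trans (Real.one_lt_exp_iff.2 (by linarith)) hR2
  have hl := Real.log_pos hR3
  have hlC : C ≤ Real.log R := by
    have := (Real.lt_log_iff_exp_lt (by linarith)).2 hR2
    linarith
  have h1 := abs_primeMean_sub_le happ hR3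
  have h2 := hR₁ R hR1
  have h3 : (Real.log R)⁻¹ * ∑ p ∈ primesTo R, Real.log p / p ≤ 2 := by
    have := (abs_le.1 (hMert R hR3.le)).2
    rw [inv_mul_le_iff₀ hl]; linarith
  rw [Real.dist_eq] at h2 ⊢
  have h4 : η * ((Real.log R)⁻¹ * ∑ p ∈ primesTo R, Real.log p / p) ≤ η * 2 := by gcongr
  have h5 : primeMean φ R - ∫ u in Set.Ioc (0 : ℝ) 1, φ u
      = (primeMean φ R - primeMean (stepFun φ M) R)
        + (primeMean (stepFun φ M) R - ∫ u in Set.Ioc (0 : ℝ) 1, stepFun φ M u)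
        + ((∫ u in Set.Ioc (0 : ℝ) 1, stepFun φ M u) - ∫ u in Set.Ioc (0 : ℝ) 1, φ u) := by ring
  rw [h5]
  refine (abs_add_three _ _ _).trans_lt ?_
  have : ε = 8 * η := by simp only [η]; ring
  linarith

end GapsE2
end

noncomputable section

open Filter Asymptotics Topology

namespace GapsE2

/-! ### Residue classes cut out by a product of shifts -/

/-- `q` divides the product of the shifts `n + a`, `a ∈ S`. -/
def ShiftDvd (S : Finset ℤ) (q n : ℕ) : Prop := (q : ℤ) ∣ ∏ a ∈ S, ((n : ℤ) + a)

instance (S : Finset ℤ) (q : ℕ) : DecidablePred (ShiftDvd S q) := fun _ => by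
  unfold ShiftDvd; infer_instance

theorem shiftDvd_mod (S : Finset ℤ) {q m : ℕ} (h : q ∣ m) (n : ℕ) :
    ShiftDvd S q (n % m) ↔ ShiftDvd S q n := by
  unfold ShiftDvd
  rw [← Int.modEq_zero_iff_dvd, ← Int.modEq_zero_iff_dvd]
  have hp : ∏ a ∈ S, (((n % m : ℕ) : ℤ) + a) ≡ ∏ a ∈ S, ((n : ℤ) + a) [ZMOD q] := by
    refine Int.ModEq.prod fun a _ => Int.ModEq.add_right _ ?_
    push_cast
    exact (Int.mod_modEq (n : ℤ) m).of_dvd (by exact_mod_cast h)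
  exact ⟨fun h => hp.symm.trans h, fun h => hp.trans h⟩

theorem shiftDvd_mul_iff (S : Finset ℤ) {m n : ℕ} (h : Nat.Coprime m n) (r : ℕ) :
    ShiftDvd S (m * n) r ↔ ShiftDvd S m r ∧ ShiftDvd S n r := by
  unfold ShiftDvd
  push_cast
  constructor
  · exact fun h => ⟨(Dvd.intro _ rfl).trans h, (Dvd.intro_left _ rfl).trans h⟩
  · exact fun h' => IsCoprime.mul_dvd (Nat.isCoprime_iff_coprime.2 h) h'.1 h'.2

theorem card_filter_range_mul {m n : ℕ} (hm : 0 < m) (hn : 0 < n) (hmn : Nat.Coprime m n)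
    (A B : ℕ → Prop) [DecidablePred A] [DecidablePred B] (hA : ∀ r, A (r % m) ↔ A r)
    (hB : ∀ r, B (r % n) ↔ B r) :
    ((Finset.range (m * n)).filter fun r => A r ∧ B r).card
      = ((Finset.range m).filter A).card * ((Finset.range n).filter B).card := by
  rw [← Finset.card_product]
  refine Finset.card_bij (fun r _ => (r % m, r % n)) ?_ ?_ ?_
  · intro r hr
    rw [Finset.mem_filter] at hr
    rw [Finset.mem_product, Finset.mem_filter, Finset.mem_filter, Finset.mem_range,
      Finset.mem_range, hA, hB]
    exact ⟨⟨Nat.mod_lt _ hm, hr.2.1⟩, Nat.mod_lt _ hn, hr.2.2⟩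
  · intro r hr s hs h
    rw [Finset.mem_filter, Finset.mem_range] at hr hs
    rw [Prod.mk.injEq] at h
    have := (Nat.modEq_and_modEq_iff_modEq_mul hmn).1 h
    exact Nat.ModEq.eq_of_lt_of_lt this hr.1 hs.1
  · rintro ⟨r, s⟩ h
    rw [Finset.mem_product, Finset.mem_filter, Finset.mem_filter, Finset.mem_range,
      Finset.mem_range] at h
    obtain ⟨⟨hr, hAr⟩, hs, hBs⟩ := h
    simp only at hr hAr hs hBs
    obtain ⟨x, hx⟩ := Nat.chineseRemainder hmn r s
    have h1 : x % (m * n) % m = r := by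
      rw [Nat.mod_mul_right_mod]; exact Nat.mod_eq_of_modEq hx.1 hr
    have h2 : x % (m * n) % n = s := by
      rw [Nat.mod_mul_left_mod]; exact Nat.mod_eq_of_modEq hx.2 hs
    refine ⟨x % (m * n), ?_, by rw [h1, h2]⟩
    rw [Finset.mem_filter, Finset.mem_range, ← hA, ← hB, h1, h2]
    exact ⟨Nat.mod_lt _ (by positivity), hAr, hBs⟩

/-- The shifts in `S` are distinct modulo `p`. -/
def DistinctMod (S : Finset ℤ) (p : ℕ) : Prop :=
  ∀ a ∈ S, ∀ b ∈ S, (p : ℤ) ∣ a - b → a = b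

/-- The roots are the classes of `-a`, `a ∈ S`, and `DistinctMod` says that they do not collide. -/
theorem card_roots_prime (S : Finset ℤ) {p : ℕ} (hp : p.Prime) (hS : DistinctMod S p) :
    ((Finset.range p).filter (ShiftDvd S p)).card = S.card := by
  have hp0 : (0 : ℤ) < p := by exact_mod_cast hp.pos
  have hcast : ∀ a : ℤ, (((-a) % p).toNat : ℤ) = (-a) % p := fun a =>
    Int.toNat_of_nonneg (Int.emod_nonneg _ hp0.ne')
  have e : (Finset.range p).filter (ShiftDvd S p) = S.image fun a => ((-a) % p).toNat := by
    ext r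
    rw [Finset.mem_filter, Finset.mem_range, Finset.mem_image, ShiftDvd,
      (Nat.prime_iff_prime_int.1 hp).dvd_finsetProd_iff]
    constructor
    · rintro ⟨hr, a, ha, hd⟩
      refine ⟨a, ha, ?_⟩
      have h1 : (-a) % p = (r : ℤ) % p :=
        Int.ModEq.symm ((Int.modEq_iff_dvd.2 (by
          rw [show (r : ℤ) - -a = r + a by ring]; exact hd)).symm)
      rw [h1, Int.emod_eq_of_lt (Int.natCast_nonneg r) (by exact_mod_cast hr), Int.toNat_natCast]
    · rintro ⟨a, ha, rfl⟩
      refine ⟨?_, a, ha, ?_⟩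
      · have := Int.emod_lt_of_pos (-a) hp0
        have h2 := hcast a
        omega
      · rw [hcast]
        have := Int.emod_add_mul_ediv (-a) p
        exact ⟨-(-a / p), by linarith⟩
  rw [e, Finset.card_image_of_injOn]
  intro a ha b hb h
  have h' : (-a) % (p : ℤ) = (-b) % p := by rw [← hcast a, ← hcast b]; exact_mod_cast h
  refine hS a ha b hb ?_
  have := Int.ModEq.dvd (show -a ≡ -b [ZMOD p] from h')
  rwa [show -b - -a = a - b by ring] at this

theorem card_roots (S : Finset ℤ) {q : ℕ} (hq : Squarefree q)
    (hS : ∀ p : ℕ, p.Prime → p ∣ q → DistinctMod S p) :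
    ((Finset.range q).filter (ShiftDvd S q)).card = S.card ^ q.primeFactors.card := by
  induction q using induction_on_primes with
  | zero => exact absurd hq not_squarefree_zero
  | one => simp [Finset.filter_singleton, ShiftDvd]
  | prime_mul p a hp ih =>
    obtain ⟨hc, -, ha⟩ := Nat.squarefree_mul_iff.1 hq
    rw [hc.primeFactors_mul, Finset.card_union_of_disjoint hc.disjoint_primeFactors,
      hp.primeFactors, Finset.card_singleton, pow_add, pow_one,
      ← ih ha fun l hl hla => hS l hl (hla.mul_left p),
      ← card_roots_prime S hp (hS p hp (Dvd.intro _ rfl)),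
      ← card_filter_range_mul hp.pos ha.ne_zero.bot_lt hc _ _ (shiftDvd_mod S dvd_rfl)
        (shiftDvd_mod S dvd_rfl)]
    congr 1
    exact Finset.filter_congr fun r _ => shiftDvd_mul_iff S hc r

/-- The residues modulo `12 q` that are `c` modulo `12` and roots of the shifts modulo `q`. -/
def residues (S : Finset ℤ) (c q : ℕ) : Finset ℕ :=
  (Finset.range (12 * q)).filter fun r => r % 12 = c ∧ ShiftDvd S q r

theorem card_residues (S : Finset ℤ) {c q : ℕ} (hc : c < 12) (hq : Squarefree q)
    (h12 : Nat.Coprime 12 q) (hS : ∀ p : ℕ, p.Prime → p ∣ q → DistinctMod S p) :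
    (residues S c q).card = S.card ^ q.primeFactors.card := by
  rw [residues, card_filter_range_mul (by norm_num) hq.ne_zero.bot_lt h12
    (fun r => r % 12 = c) (ShiftDvd S q) (fun r => by rw [Nat.mod_mod]) (shiftDvd_mod S dvd_rfl),
    card_roots S hq hS]
  have : (Finset.range 12).filter (fun r => r % 12 = c) = {c} := by
    ext r
    rw [Finset.mem_filter, Finset.mem_range, Finset.mem_singleton]
    omega
  rw [this, Finset.card_singleton, one_mul]

theorem sum_filter_eq_sum_residues (S : Finset ℤ) (c : ℕ) {q : ℕ} (hq : 0 < q) (p : ℕ)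
    (s : Finset ℕ) (f : ℕ → ℝ) :
    ∑ n ∈ s.filter (fun n => (p * n) % 12 = c ∧ ShiftDvd S q (p * n)), f n
      = ∑ r ∈ residues S c q, ∑ n ∈ s.filter (fun n => (p * n) % (12 * q) = r), f n := by
  rw [← Finset.sum_fiberwise_of_maps_to (s := s.filter (fun n => (p * n) % 12 = c ∧
    ShiftDvd S q (p * n))) (t := residues S c q) (g := fun n => (p * n) % (12 * q))]
  · refine Finset.sum_congr rfl fun r hr => Finset.sum_congr ?_ fun _ _ => rfl
    ext n
    rw [residues, Finset.mem_filter] at hr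
    simp only [Finset.mem_filter]
    constructor
    · exact fun h => ⟨h.1.1, h.2⟩
    · rintro ⟨h1, h2⟩
      refine ⟨⟨h1, ?_, ?_⟩, h2⟩
      · rw [← hr.2.1, ← h2, Nat.mod_mul_right_mod]
      · rw [← shiftDvd_mod S (Dvd.intro_left 12 rfl), h2]; exact hr.2.2
  · intro n hn
    rw [Finset.mem_filter] at hn
    rw [residues, Finset.mem_filter, Finset.mem_range, Nat.mod_mul_right_mod,
      shiftDvd_mod S (Dvd.intro_left 12 rfl)]
    exact ⟨Nat.mod_lt _ (by positivity), hn.2⟩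

theorem filter_eq_dyadic {p M r : ℕ} (hpM : Nat.Coprime p M) (hr : r < M) (n : ℕ) :
    (p * n) % M = r ↔ (n : ZMod M) = ((p : ZMod M)⁻¹ * (r : ZMod M)) := by
  have hu : (p : ZMod M) * (p : ZMod M)⁻¹ = 1 := ZMod.coe_mul_inv_eq_one p hpM
  have e : (p * n) % M = r ↔ ((p * n : ℕ) : ZMod M) = (r : ZMod M) := by
    rw [ZMod.natCast_eq_natCast_iff', Nat.mod_eq_of_lt hr]
  rw [e]
  push_cast
  constructor
  · intro h
    rw [← h, ← mul_assoc, mul_comm (p : ZMod M)⁻¹, hu, one_mul]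
  · intro h
    rw [h, ← mul_assoc, hu, one_mul]

/-- A prime dividing both `r` and `q` divides some `r + a`, hence `a`. Coprimality is needed because
the distribution hypotheses speak only of reduced classes. -/
theorem coprime_of_mem_residues {S : Finset ℤ} {c q r : ℕ} (hc : Nat.Coprime c 12)
    (hS : ∀ p : ℕ, p.Prime → p ∣ q → ∀ a ∈ S, ¬ (p : ℤ) ∣ a) (hr : r ∈ residues S c q) :
    Nat.Coprime r (12 * q) := by
  rw [residues, Finset.mem_filter] at hr
  refine Nat.Coprime.mul_right ?_ ?_
  · have h : r ≡ c [MOD 12] := by rw [← hr.2.1]; exact (Nat.mod_modEq r 12).symm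
    exact (Nat.ModEq.gcd_eq h).trans hc
  · refine Nat.coprime_of_dvd fun p hp hpr hpq => ?_
    have h1 : (p : ℤ) ∣ ∏ a ∈ S, ((r : ℤ) + a) :=
      (Int.natCast_dvd_natCast.2 hpq).trans hr.2.2
    rw [(Nat.prime_iff_prime_int.1 hp).dvd_finsetProd_iff] at h1
    obtain ⟨a, ha, hd⟩ := h1
    exact hS p hp hpq a ha ((dvd_add_right (Int.natCast_dvd_natCast.2 hpr)).1 hd)

end GapsE2
end

noncomputable section

open Filter Asymptotics Topology

namespace GapsE2

/-! ### Squares of sieve sums -/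

/-- The bilinear form of the sieve weights attached to `F` and `H`, with kernel `V` evaluated at
least common multiples. -/
def lcmForm (V : ℕ → ℝ) (F H : ℝ → ℝ) (R : ℝ) : ℝ :=
  ∑ d ∈ Finset.Icc 1 ⌊R⌋₊, ∑ d' ∈ Finset.Icc 1 ⌊R⌋₊,
    ((ArithmeticFunction.moebius d : ℝ) * F (Real.log d / Real.log R))
      * ((ArithmeticFunction.moebius d' : ℝ) * H (Real.log d' / Real.log R)) * V (d.lcm d')

theorem quadForm_eq_lcmForm (g : ℕ → ℝ) (F H : ℝ → ℝ) (R : ℝ) :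
    quadForm g F H R = lcmForm (siftWeight g) F H R := rfl

theorem lcmForm_sub (V W : ℕ → ℝ) (F H : ℝ → ℝ) (R : ℝ) :
    lcmForm (fun q => V q - W q) F H R = lcmForm V F H R - lcmForm W F H R := by
  unfold lcmForm
  simp only [mul_sub, Finset.sum_sub_distrib]

theorem lcmForm_const_mul (a : ℝ) (V : ℕ → ℝ) (F H : ℝ → ℝ) (R : ℝ) :
    lcmForm (fun q => a * V q) F H R = a * lcmForm V F H R := by
  unfold lcmForm
  simp only [Finset.mul_sum]
  exact Finset.sum_congr rfl fun d _ => Finset.sum_congr rfl fun d' _ => by ring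

theorem lcmForm_sum {ι : Type*} (s : Finset ι) (V : ι → ℕ → ℝ) (F H : ℝ → ℝ) (R : ℝ) :
    lcmForm (fun q => ∑ i ∈ s, V i q) F H R = ∑ i ∈ s, lcmForm (V i) F H R := by
  unfold lcmForm
  simp only [Finset.mul_sum]
  rw [Finset.sum_comm (s := s)]
  refine Finset.sum_congr rfl fun d _ => ?_
  rw [Finset.sum_comm]

/-- The sieve weight: the sum of `μ(d) F(log d / log R)` over the `d ≤ R` coprime to `M` which
divide the product of the shifts of `n`. -/
def sieveSum (M : ℕ) (F : ℝ → ℝ) (R : ℝ) (S : Finset ℤ) (n : ℕ) : ℝ :=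
  ∑ d ∈ Finset.Icc 1 ⌊R⌋₊, if Nat.Coprime d M ∧ ShiftDvd S d n then
    (ArithmeticFunction.moebius d : ℝ) * F (Real.log d / Real.log R) else 0

theorem shiftDvd_lcm (S : Finset ℤ) (d e n : ℕ) :
    ShiftDvd S (d.lcm e) n ↔ ShiftDvd S d n ∧ ShiftDvd S e n := by
  unfold ShiftDvd
  rw [← Int.coe_lcm_dvd_iff]; rfl

theorem coprime_lcm_iff (d e M : ℕ) :
    Nat.Coprime (d.lcm e) M ↔ Nat.Coprime d M ∧ Nat.Coprime e M := by
  constructor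
  · exact fun h => ⟨h.coprime_dvd_left (Nat.dvd_lcm_left d e),
      h.coprime_dvd_left (Nat.dvd_lcm_right d e)⟩
  · exact fun h => (Nat.Coprime.mul_left h.1 h.2).coprime_dvd_left (Nat.lcm_dvd_mul d e)

/-- Two moduli divide the product of the shifts exactly when their least common multiple does. The
map `e` allows for sums over multiples `p n`. -/
theorem sum_mul_sieveSum (M : ℕ) (F H : ℝ → ℝ) (R : ℝ) (S : Finset ℤ) (s : Finset ℕ)
    (w : ℕ → ℝ) (e : ℕ → ℕ) :
    ∑ n ∈ s, w n * (sieveSum M F R S (e n) * sieveSum M H R S (e n))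
      = lcmForm (fun q => if Nat.Coprime q M then
          ∑ n ∈ s.filter (fun n => ShiftDvd S q (e n)), w n else 0) F H R := by
  unfold sieveSum lcmForm
  simp only [Finset.sum_mul_sum]
  simp_rw [Finset.mul_sum (s := Finset.Icc 1 ⌊R⌋₊)]
  rw [Finset.sum_comm]
  refine Finset.sum_congr rfl fun d _ => ?_
  rw [Finset.sum_comm]
  refine Finset.sum_congr rfl fun d' _ => ?_
  simp only [coprime_lcm_iff, shiftDvd_lcm]
  by_cases h : Nat.Coprime d M ∧ Nat.Coprime d' M
  · rw [if_pos h, Finset.mul_sum, Finset.sum_filter]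
    refine Finset.sum_congr rfl fun n _ => ?_
    have h1' : Nat.Coprime d M = True := eq_true h.1
    have h2' : Nat.Coprime d' M = True := eq_true h.2
    simp only [h1', h2', true_and]
    by_cases h1 : ShiftDvd S d (e n) <;> by_cases h2 : ShiftDvd S d' (e n)
    · rw [if_pos h1, if_pos h2, if_pos ⟨h1, h2⟩]; ring
    all_goals simp [h1, h2]
  · rw [if_neg h, mul_zero]
    refine Finset.sum_eq_zero fun n _ => ?_
    by_cases h1 : Nat.Coprime d M
    · have h2 : ¬ Nat.Coprime d' M := fun h2 => h ⟨h1, h2⟩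
      simp [h2]
    · simp [h1]

/-- Each prime of `q` divides the first entry only, the second only, or both. -/
theorem card_filter_lcm_le {q : ℕ} (hq : Squarefree q) (s t : Finset ℕ) :
    ((s ×ˢ t).filter fun x => x.1.lcm x.2 = q).card ≤ 3 ^ q.primeFactors.card := by
  have h := Nat.card_pair_lcm_eq hq
  rw [ArithmeticFunction.cardDistinctFactors_apply, ← List.card_toFinset] at h
  rw [Nat.primeFactors, ← h]
  refine Finset.card_le_card fun x hx => ?_
  rw [Finset.mem_filter] at hx ⊢
  rw [Finset.mem_product, Nat.mem_divisors, Nat.mem_divisors]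
  exact ⟨⟨⟨hx.2 ▸ Nat.dvd_lcm_left _ _, hq.ne_zero⟩, hx.2 ▸ Nat.dvd_lcm_right _ _, hq.ne_zero⟩,
    hx.2⟩

/-- Squarefree moduli up to `y` coprime to `M`. -/
def moduli (y : ℝ) (M : ℕ) : Finset ℕ :=
  (Finset.Icc 1 ⌊y⌋₊).filter fun q => Squarefree q ∧ Nat.Coprime q M

/-- The second weight has its own support bound `T`, so the moduli reach only `R T`. Taking `T = R /
p` for the shifted weights is what makes the cross terms accessible. -/
theorem abs_lcmForm_le {V : ℕ → ℝ} {M : ℕ} (hV : ∀ q, ¬ Nat.Coprime q M → V q = 0)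
    {F H : ℝ → ℝ} {R T CF CH : ℝ} (hF : ∀ t, |F t| ≤ CF) (hH : ∀ t, |H t| ≤ CH) (hR : 0 ≤ R)
    (hHT : ∀ d : ℕ, 0 < d → T < d → H (Real.log d / Real.log R) = 0) :
    |lcmForm V F H R| ≤ CF * CH * ∑ q ∈ moduli (R * T) M, 3 ^ q.primeFactors.card * |V q| := by
  have hCF : 0 ≤ CF := (abs_nonneg _).trans (hF 0)
  have hCH : 0 ≤ CH := (abs_nonneg _).trans (hH 0)
  set s := Finset.Icc 1 ⌊R⌋₊ with hs
  set c : ℕ × ℕ → ℝ := fun x =>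
    ((ArithmeticFunction.moebius x.1 : ℝ) * F (Real.log x.1 / Real.log R))
      * ((ArithmeticFunction.moebius x.2 : ℝ) * H (Real.log x.2 / Real.log R)) with hc
  have hmu : ∀ d : ℕ, |(ArithmeticFunction.moebius d : ℝ)| ≤ 1 := fun d => by
    exact_mod_cast ArithmeticFunction.abs_moebius_le_one
  have hcb : ∀ x, |c x| ≤ CF * CH := fun x => by
    rw [hc]
    simp only [abs_mul]
    have h1 := mul_le_mul (hmu x.1) (hF (Real.log x.1 / Real.log R)) (abs_nonneg _) zero_le_one
    have h2 := mul_le_mul (hmu x.2) (hH (Real.log x.2 / Real.log R)) (abs_nonneg _) zero_le_one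
    rw [one_mul] at h1 h2
    exact mul_le_mul h1 h2 (by positivity) hCF
  have e : lcmForm V F H R = ∑ x ∈ s ×ˢ s, c x * V (x.1.lcm x.2) := by
    rw [Finset.sum_product]; rfl
  have e2 : ∑ x ∈ s ×ˢ s, c x * V (x.1.lcm x.2)
      = ∑ x ∈ (s ×ˢ s).filter (fun x => x.1.lcm x.2 ∈ moduli (R * T) M),
        c x * V (x.1.lcm x.2) := by
    refine (Finset.sum_filter_of_ne fun x hx hne => ?_).symm
    rw [hs, Finset.mem_product, Finset.mem_Icc, Finset.mem_Icc] at hx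
    obtain ⟨⟨h1, h1'⟩, h2, h2'⟩ := hx
    have hc0 : c x ≠ 0 := left_ne_zero_of_mul hne
    have hV0 : V (x.1.lcm x.2) ≠ 0 := right_ne_zero_of_mul hne
    have hm1 : ArithmeticFunction.moebius x.1 ≠ 0 := fun h => by simp [hc, h] at hc0
    have hm2 : ArithmeticFunction.moebius x.2 ≠ 0 := fun h => by simp [hc, h] at hc0
    have hHx : H (Real.log x.2 / Real.log R) ≠ 0 := fun h => by simp [hc, h] at hc0
    have hx2 : (x.2 : ℝ) ≤ T := by
      by_contra! h
      exact hHx (hHT x.2 h2 h)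
    have hx1 : (x.1 : ℝ) ≤ R := (Nat.le_floor_iff hR).1 h1'
    rw [moduli, Finset.mem_filter, Finset.mem_Icc]
    refine ⟨⟨Nat.lcm_pos h1 h2, Nat.le_floor ?_⟩, ?_, ?_⟩
    · have : x.1.lcm x.2 ≤ x.1 * x.2 := Nat.le_of_dvd (Nat.mul_pos h1 h2) (Nat.lcm_dvd_mul _ _)
      calc ((x.1.lcm x.2 : ℕ) : ℝ) ≤ ((x.1 * x.2 : ℕ) : ℝ) := by exact_mod_cast this
        _ = x.1 * x.2 := by push_cast; ring
        _ ≤ R * T := by gcongr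
    · rw [ArithmeticFunction.moebius_ne_zero_iff_squarefree] at hm1 hm2
      rw [Nat.squarefree_iff_factorization_le_one (Nat.lcm_pos h1 h2).ne']
      intro p
      rw [Nat.factorization_lcm (by omega) (by omega), Finsupp.sup_apply]
      exact sup_le (hm1.natFactorization_le_one p) (hm2.natFactorization_le_one p)
    · by_contra h
      exact hV0 (hV _ h)
  rw [e, e2, ← Finset.sum_fiberwise_of_maps_to (t := moduli (R * T) M)
    (g := fun x : ℕ × ℕ => x.1.lcm x.2) (fun x hx => (Finset.mem_filter.1 hx).2), Finset.mul_sum]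
  refine (Finset.abs_sum_le_sum_abs _ _).trans (Finset.sum_le_sum fun q hq => ?_)
  have hqs : Squarefree q := (Finset.mem_filter.1 hq).2.1
  rw [Finset.filter_filter]
  calc |∑ x ∈ (s ×ˢ s).filter (fun x => x.1.lcm x.2 ∈ moduli (R * T) M ∧ x.1.lcm x.2 = q),
        c x * V (x.1.lcm x.2)|
      ≤ ∑ x ∈ (s ×ˢ s).filter (fun x => x.1.lcm x.2 ∈ moduli (R * T) M ∧ x.1.lcm x.2 = q),
        (CF * CH) * |V q| := by
        refine (Finset.abs_sum_le_sum_abs _ _).trans (Finset.sum_le_sum fun x hx => ?_)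
        rw [(Finset.mem_filter.1 hx).2.2, abs_mul]
        exact mul_le_mul_of_nonneg_right (hcb x) (abs_nonneg _)
    _ ≤ (3 : ℝ) ^ q.primeFactors.card * ((CF * CH) * |V q|) := by
        rw [Finset.sum_const, nsmul_eq_mul]
        refine mul_le_mul_of_nonneg_right ?_ (by positivity)
        have h1 := card_filter_lcm_le hqs s s
        have h2 : ((s ×ˢ s).filter (fun x => x.1.lcm x.2 ∈ moduli (R * T) M
            ∧ x.1.lcm x.2 = q)).card ≤ ((s ×ˢ s).filter (fun x => x.1.lcm x.2 = q)).card :=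
          Finset.card_le_card fun x hx => by
            rw [Finset.mem_filter] at hx ⊢
            exact ⟨hx.1, hx.2.2⟩
        exact_mod_cast h2.trans h1
    _ = _ := by ring

theorem siftWeight_eq_zero {g : ℕ → ℝ} {M q : ℕ} (hM : ∀ p : ℕ, p.Prime → p ∣ M → g p = 0)
    (hq : q ≠ 0) (h : ¬ Nat.Coprime q M) : siftWeight g q = 0 := by
  obtain ⟨p, hp, hpq, hpM⟩ := Nat.Prime.not_coprime_iff_dvd.1 h
  exact Finset.prod_eq_zero (Nat.mem_primeFactors.2 ⟨hp, hpq, hq⟩) (hM p hp hpM)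

end GapsE2
end

noncomputable section

open Filter Asymptotics Topology

namespace GapsE2

/-! ### Elementary bounds for arithmetic functions -/

/-- Induction on `m`: for squarefree `q`, `(m+1)^ω(q)` is the sum of `m^ω(a)` over `a ∣ q`. The pair
`(a, q/a)` determines `q`, so each step costs at most one harmonic sum. -/
theorem sum_pow_card_primeFactors_div_le (m n : ℕ) :
    ∑ q ∈ (Finset.Icc 1 n).filter Squarefree, (m : ℝ) ^ q.primeFactors.card / q
      ≤ (1 + Real.log n) ^ m := by
  have hharm : ∑ b ∈ Finset.Icc 1 n, (1 : ℝ) / b ≤ 1 + Real.log n := by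
    have h := harmonic_le_one_add_log n
    rw [harmonic_eq_sum_Icc] at h
    push_cast at h
    simpa only [one_div] using h
  have h1 : 0 ≤ 1 + Real.log n := by
    have := Real.log_natCast_nonneg n
    linarith
  induction m with
  | zero =>
    rw [pow_zero]
    -- With `0 ^ 0 = 1`, only `q = 1` survives.
    have : ∀ q ∈ (Finset.Icc 1 n).filter Squarefree, q ≠ 1 →
        ((0 : ℕ) : ℝ) ^ q.primeFactors.card / q = 0 := by
      intro q hq h
      have : q.primeFactors.card ≠ 0 := by
        rw [Finset.card_ne_zero, Nat.nonempty_primeFactors]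
        have := (Finset.mem_Icc.1 (Finset.mem_filter.1 hq).1).1
        omega
      rw [Nat.cast_zero, zero_pow this, zero_div]
    by_cases h : 1 ∈ (Finset.Icc 1 n).filter Squarefree
    · rw [Finset.sum_eq_single_of_mem 1 h this]; simp
    · rw [Finset.sum_eq_zero fun q hq => this q hq fun hh => h (hh ▸ hq)]; norm_num
  | succ m ih =>
    set s := (Finset.Icc 1 n).filter Squarefree with hs
    have hdiv : ∀ q ∈ s, ((m + 1 : ℕ) : ℝ) ^ q.primeFactors.card / q
        = ∑ a ∈ q.divisors, ((m : ℝ) ^ a.primeFactors.card / a) * (1 / (q / a : ℕ)) := by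
      intro q hq
      have hsq : Squarefree q := (Finset.mem_filter.1 hq).2
      have h := (ArithmeticFunction.IsMultiplicative.prodPrimeFactors
        (fun _ => (m : ℝ))).prodPrimeFactors_one_add_of_squarefree hsq
      have h2 : ∀ p ∈ q.primeFactors, 1 + (ArithmeticFunction.prodPrimeFactors
          (fun _ => (m : ℝ))) p = ((m + 1 : ℕ) : ℝ) := by
        intro p hp
        have hp' := Nat.prime_of_mem_primeFactors hp
        rw [ArithmeticFunction.prodPrimeFactors_apply hp'.ne_zero, hp'.primeFactors,
          Finset.prod_singleton]
        push_cast; ring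
      rw [Finset.prod_congr rfl h2, Finset.prod_const] at h
      rw [h, Finset.sum_div]
      refine Finset.sum_congr rfl fun a ha => ?_
      have hd := Nat.dvd_of_mem_divisors ha
      have ha0 : a ≠ 0 := fun h0 => hsq.ne_zero (Nat.eq_zero_of_zero_dvd (h0 ▸ hd))
      rw [ArithmeticFunction.prodPrimeFactors_apply ha0, Finset.prod_const,
        Nat.cast_div hd (by exact_mod_cast ha0)]
      have : (a : ℝ) ≠ 0 := by exact_mod_cast ha0
      have : (q : ℝ) ≠ 0 := by exact_mod_cast hsq.ne_zero
      field_simp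
    rw [Finset.sum_congr rfl hdiv, Finset.sum_sigma', pow_succ]
    calc ∑ x ∈ s.sigma fun q => q.divisors,
          ((m : ℝ) ^ x.2.primeFactors.card / x.2) * (1 / (x.1 / x.2 : ℕ))
        = ∑ y ∈ (s.sigma fun q => q.divisors).image (fun x => (x.2, x.1 / x.2)),
          ((m : ℝ) ^ y.1.primeFactors.card / y.1) * (1 / (y.2 : ℕ)) := by
          rw [Finset.sum_image]
          rintro ⟨q, a⟩ hx ⟨q', a'⟩ hy h
          rw [Finset.mem_coe, Finset.mem_sigma, Nat.mem_divisors] at hx hy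
          simp only at hx hy
          simp only [Prod.mk.injEq] at h
          obtain ⟨rfl, h2⟩ := h
          have : q = q' := by
            rw [← Nat.mul_div_cancel' hx.2.1, ← Nat.mul_div_cancel' hy.2.1, h2]
          subst this
          rfl
      _ ≤ ∑ y ∈ s ×ˢ Finset.Icc 1 n, ((m : ℝ) ^ y.1.primeFactors.card / y.1) * (1 / (y.2 : ℕ)) := by
          refine Finset.sum_le_sum_of_subset_of_nonneg ?_ fun _ _ _ => by positivity
          intro y hy
          rw [Finset.mem_image] at hy
          obtain ⟨⟨q, a⟩, hx, rfl⟩ := hy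
          rw [Finset.mem_sigma, Nat.mem_divisors] at hx
          simp only [hs, Finset.mem_filter, Finset.mem_Icc] at hx
          obtain ⟨⟨⟨hq1, hqn⟩, hsq⟩, had, -⟩ := hx
          rw [Finset.mem_product, hs, Finset.mem_filter, Finset.mem_Icc, Finset.mem_Icc]
          have hqa := Nat.div_dvd_of_dvd had
          exact ⟨⟨⟨Nat.pos_of_dvd_of_pos had hq1, (Nat.le_of_dvd hq1 had).trans hqn⟩,
            hsq.squarefree_of_dvd had⟩, Nat.pos_of_dvd_of_pos hqa hq1,
            (Nat.le_of_dvd hq1 hqa).trans hqn⟩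
      _ = (∑ a ∈ s, (m : ℝ) ^ a.primeFactors.card / a) * ∑ b ∈ Finset.Icc 1 n, (1 : ℝ) / b := by
          rw [Finset.sum_mul_sum, Finset.sum_product]
      _ ≤ (1 + Real.log n) ^ m * (1 + Real.log n) :=
          mul_le_mul ih hharm (Finset.sum_nonneg fun _ _ => by positivity) (by positivity)

theorem sum_moduli_pow_div_le (m M : ℕ) {y : ℝ} (hy : 1 ≤ y) :
    ∑ q ∈ moduli y M, (m : ℝ) ^ q.primeFactors.card / q ≤ (1 + Real.log y) ^ m := by
  have h1 : 1 ≤ ⌊y⌋₊ := Nat.le_floor (by simpa using hy)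
  refine le_trans (Finset.sum_le_sum_of_subset_of_nonneg ?_ fun _ _ _ => by positivity)
    ((sum_pow_card_primeFactors_div_le m ⌊y⌋₊).trans ?_)
  · exact fun q hq => Finset.mem_filter.2
      ⟨(Finset.mem_filter.1 hq).1, (Finset.mem_filter.1 hq).2.1⟩
  · have := Real.log_natCast_nonneg ⌊y⌋₊
    have h2 : Real.log ⌊y⌋₊ ≤ Real.log y :=
      Real.log_le_log (by exact_mod_cast h1) (Nat.floor_le (by linarith))
    gcongr

theorem totient_eq_prod_of_squarefree {q : ℕ} (hq : Squarefree q) :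
    q.totient = ∏ p ∈ q.primeFactors, (p - 1) := by
  have h := Nat.totient_mul_prod_primeFactors q
  rw [Nat.prod_primeFactors_of_squarefree hq, mul_comm] at h
  exact Nat.eq_of_mul_eq_mul_left hq.ne_zero.bot_lt h

theorem le_two_pow_mul_totient {q : ℕ} (hq : Squarefree q) :
    q ≤ 2 ^ q.primeFactors.card * q.totient := by
  rw [totient_eq_prod_of_squarefree hq, ← Finset.prod_const, ← Finset.prod_mul_distrib]
  conv_lhs => rw [← Nat.prod_primeFactors_of_squarefree hq]
  refine Finset.prod_le_prod' fun p hp => ?_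
  have := (Nat.prime_of_mem_primeFactors hp).two_le
  omega

theorem totient_twelve_mul {q : ℕ} (hq : Nat.Coprime q 6) : (12 * q).totient = 4 * q.totient := by
  have h : Nat.Coprime 12 q := (Nat.Coprime.pow_right 2 hq).symm.coprime_dvd_left (by norm_num)
  rw [Nat.totient_mul h]
  rfl

theorem coprime_twelve_of_coprime_six {q : ℕ} (hq : Nat.Coprime q 6) : Nat.Coprime 12 q :=
  (Nat.Coprime.pow_right 2 hq).symm.coprime_dvd_left (by norm_num)

theorem three_lt_of_coprime_six {q p : ℕ} (hq : Nat.Coprime q 6) (hp : p.Prime) (hpq : p ∣ q) :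
    3 < p := by
  have h := hq.coprime_dvd_left hpq
  by_contra! h3
  have := hp.two_le
  interval_cases p
  · exact absurd h (by decide)
  · exact absurd h (by decide)

theorem siftWeight_pairDensity {q : ℕ} (hq : Squarefree q) (h6 : Nat.Coprime q 6) :
    siftWeight pairDensity q = 2 ^ q.primeFactors.card / q.totient := by
  rw [siftWeight, totient_eq_prod_of_squarefree hq, ← Finset.prod_const]
  push_cast
  rw [← Finset.prod_div_distrib]
  refine Finset.prod_congr rfl fun p hp => ?_
  have hp' := Nat.prime_of_mem_primeFactors hp
  have := three_lt_of_coprime_six h6 hp' (Nat.dvd_of_mem_primeFactors hp)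
  rw [pairDensity, if_neg (by omega), Nat.cast_sub (by omega), Nat.cast_one]

theorem siftWeight_tripleDensity {q : ℕ} (hq : Squarefree q) (h6 : Nat.Coprime q 6) :
    siftWeight tripleDensity q = 3 ^ q.primeFactors.card / q := by
  conv_rhs => arg 2; rw [← Nat.prod_primeFactors_of_squarefree hq]
  rw [siftWeight, ← Finset.prod_const]
  push_cast
  rw [← Finset.prod_div_distrib]
  refine Finset.prod_congr rfl fun p hp => ?_
  have hp' := Nat.prime_of_mem_primeFactors hp
  have := three_lt_of_coprime_six h6 hp' (Nat.dvd_of_mem_primeFactors hp)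
  rw [tripleDensity, if_neg (by omega)]

theorem sum_primeFactors_log_div_le {r : ℕ} (hr : r ≠ 0) :
    ∑ p ∈ r.primeFactors, Real.log p / p ≤ Real.log r := by
  have h1 : ∑ p ∈ r.primeFactors, Real.log p / p ≤ ∑ p ∈ r.primeFactors, Real.log p := by
    refine Finset.sum_le_sum fun p hp => div_le_self (Real.log_natCast_nonneg p) ?_
    exact_mod_cast (Nat.prime_of_mem_primeFactors hp).one_le
  refine h1.trans ?_
  rw [← Real.log_prod fun p hp => by
    exact_mod_cast (Nat.prime_of_mem_primeFactors hp).ne_zero]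
  have h2 : (0 : ℝ) < ∏ p ∈ r.primeFactors, (p : ℝ) := Finset.prod_pos fun p hp => by
    exact_mod_cast (Nat.prime_of_mem_primeFactors hp).pos
  refine Real.log_le_log h2 ?_
  rw [← Nat.cast_prod]
  exact_mod_cast Nat.le_of_dvd hr.bot_lt (Nat.prod_primeFactors_dvd r)

theorem sum_primeFactors_log_div_nonneg (r : ℕ) : 0 ≤ ∑ p ∈ r.primeFactors, Real.log p / p :=
  Finset.sum_nonneg fun p _ => div_nonneg (Real.log_natCast_nonneg p) (Nat.cast_nonneg p)

theorem varpi_le_log (n : ℕ) : varpi n ≤ Real.log n := by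
  unfold varpi
  split_ifs
  · exact le_rfl
  · exact Real.log_natCast_nonneg n

theorem varpi_le_vonMangoldt (n : ℕ) : varpi n ≤ ArithmeticFunction.vonMangoldt n := by
  unfold varpi
  split_ifs with h
  · rw [ArithmeticFunction.vonMangoldt_apply_prime h]
  · exact ArithmeticFunction.vonMangoldt_nonneg

/-- `ϖ` is dominated by von Mangoldt's function, whose divisor sum is `log n`; the other factor is
at most `log n`. -/
theorem varpi2_le_log_sq {n : ℕ} : varpi2 n ≤ Real.log n ^ 2 := by
  unfold varpi2
  rw [sq, ← ArithmeticFunction.vonMangoldt_sum (n := n), Finset.sum_mul,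
    ArithmeticFunction.vonMangoldt_sum]
  refine Finset.sum_le_sum fun d hd => ?_
  refine mul_le_mul (varpi_le_vonMangoldt d) ((varpi_le_log _).trans ?_) (varpi_nonneg _)
    ArithmeticFunction.vonMangoldt_nonneg
  have hn : n ≠ 0 := (Nat.mem_divisors.1 hd).2
  have h1 := Nat.dvd_of_mem_divisors hd
  refine Real.log_le_log ?_ (by exact_mod_cast Nat.div_le_self n d)
  exact_mod_cast Nat.div_pos (Nat.le_of_dvd hn.bot_lt h1) (Nat.pos_of_mem_divisors hd)

theorem abs_card_Ioc_modEq_sub_le {a b r : ℕ} (hab : a ≤ b) (hr : 0 < r) (v : ℕ) :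
    |(((Finset.Ioc a b).filter fun n => n % r = v % r).card : ℝ) - ((b : ℝ) - a) / r| ≤ 1 := by
  have h := Nat.Ioc_filter_modEq_card a b hr v
  have hr' : (0 : ℚ) < r := by exact_mod_cast hr
  have hab' : (a : ℚ) ≤ b := by exact_mod_cast hab
  have hmono : ⌊((a : ℚ) - v) / r⌋ ≤ ⌊((b : ℚ) - v) / r⌋ := Int.floor_le_floor (by gcongr)
  rw [max_eq_left (by linarith)] at h
  have h1 : ((((Finset.Ioc a b).filter fun n => n ≡ v [MOD r]).card : ℕ) : ℚ)
      = (⌊((b : ℚ) - v) / r⌋ : ℚ) - (⌊((a : ℚ) - v) / r⌋ : ℚ) := by exact_mod_cast h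
  have e : ((b : ℚ) - a) / r = ((b : ℚ) - v) / r - ((a : ℚ) - v) / r := by ring
  have h2 : |((((Finset.Ioc a b).filter fun n => n ≡ v [MOD r]).card : ℕ) : ℚ)
      - ((b : ℚ) - a) / r| ≤ 1 := by
    rw [h1, e, abs_le]
    have f1 := Int.floor_le (((b : ℚ) - v) / r)
    have f2 := Int.lt_floor_add_one (((b : ℚ) - v) / r)
    have f3 := Int.floor_le (((a : ℚ) - v) / r)
    have f4 := Int.lt_floor_add_one (((a : ℚ) - v) / r)
    constructor <;> linarith
  have h3 := (Rat.cast_le (K := ℝ)).2 h2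
  push_cast at h3
  exact h3

theorem zmod_eq_iff_mod {r : ℕ} (hr : 0 < r) (a : ZMod r) (n : ℕ) :
    (n : ZMod r) = a ↔ n % r = a.val % r := by
  have : NeZero r := ⟨hr.ne'⟩
  conv_lhs => rw [← ZMod.natCast_zmod_val a]
  exact ZMod.natCast_eq_natCast_iff' n a.val r

theorem card_dyadic_class_le {x : ℝ} (hx : 1 ≤ x) {r : ℕ} (hr : 0 < r) (a : ZMod r) :
    (((Finset.Ioc ⌊x⌋₊ ⌊2 * x⌋₊).filter fun n : ℕ => (n : ZMod r) = a).card : ℝ)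
      ≤ x / r + 2 := by
  have hle : ⌊x⌋₊ ≤ ⌊2 * x⌋₊ := Nat.floor_le_floor (by linarith)
  have h := (abs_le.1 (abs_card_Ioc_modEq_sub_le hle hr a.val)).2
  rw [Finset.filter_congr fun n _ => zmod_eq_iff_mod hr a n]
  have h1 := Nat.floor_le (show (0 : ℝ) ≤ 2 * x by linarith)
  have h2 := Nat.lt_floor_add_one x
  have hr' : (1 : ℝ) ≤ r := by exact_mod_cast hr
  have h3 : ((⌊2 * x⌋₊ : ℝ) - ⌊x⌋₊) / r ≤ (x + 1) / r := by gcongr; linarith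
  have h4 : (1 : ℝ) / r ≤ 1 := by rw [div_le_one (by linarith)]; exact hr'
  rw [add_div] at h3
  linarith

theorem dyadicSum_le {f : ℕ → ℝ} (hf : ∀ n, 0 ≤ f n) {x B : ℝ} (hx : 1 ≤ x)
    (hB : ∀ n : ℕ, 0 < n → (n : ℝ) ≤ 2 * x → f n ≤ B) {r : ℕ} (hr : 0 < r) (a : ZMod r) :
    dyadicSum f x r a ≤ (x / r + 2) * B := by
  have hB0 : 0 ≤ B := (hf 1).trans (hB 1 one_pos (by push_cast; linarith))
  unfold dyadicSum
  refine (Finset.sum_le_card_nsmul _ _ B fun n hn => ?_).trans ?_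
  · rw [Finset.mem_filter, Finset.mem_Ioc] at hn
    exact hB n (by omega) ((Nat.le_floor_iff (by linarith)).1 hn.1.2)
  · rw [nsmul_eq_mul]
    exact mul_le_mul_of_nonneg_right (card_dyadic_class_le hx hr a) hB0

theorem dyadicSum_nonneg {f : ℕ → ℝ} (hf : ∀ n, 0 ≤ f n) (x : ℝ) (r : ℕ) (a : ZMod r) :
    0 ≤ dyadicSum f x r a := Finset.sum_nonneg fun n _ => hf n

theorem errMax_nonneg (x : ℝ) (q : ℕ) : 0 ≤ errMax x q := Real.iSup_nonneg fun _ => abs_nonneg _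

theorem err2Max_nonneg (x : ℝ) (q : ℕ) : 0 ≤ err2Max x q := Real.iSup_nonneg fun _ => abs_nonneg _

theorem errStar_nonneg (N : ℝ) (q : ℕ) : 0 ≤ errStar N q :=
  Real.sSup_nonneg (by rintro _ ⟨x, -, rfl⟩; exact errMax_nonneg x q)

theorem err2Star_nonneg (N : ℝ) (q : ℕ) : 0 ≤ err2Star N q :=
  Real.sSup_nonneg (by rintro _ ⟨x, -, rfl⟩; exact err2Max_nonneg x q)

theorem abs_err_le_errStar {N x : ℝ} (h1 : 1 ≤ x) (hx : x ≤ N) {q : ℕ} (hq : 0 < q)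
    (a : (ZMod q)ˣ) : |err x q a| ≤ errStar N q := by
  have : NeZero q := ⟨hq.ne'⟩
  exact (le_ciSup (f := fun a : (ZMod q)ˣ => |err x q a|) (Set.finite_range _).bddAbove a).trans
    (le_csSup (bddAbove_errStar N q) ⟨x, ⟨h1, hx⟩, rfl⟩)

theorem abs_err2_le_err2Star {N x : ℝ} (h1 : 1 ≤ x) (hx : x ≤ N) {q : ℕ} (hq : 0 < q)
    (a : (ZMod q)ˣ) : |err2 x q a| ≤ err2Star N q := by
  have : NeZero q := ⟨hq.ne'⟩
  exact (le_ciSup (f := fun a : (ZMod q)ˣ => |err2 x q a|) (Set.finite_range _).bddAbove a).trans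
    (le_csSup (bddAbove_err2Star N q) ⟨x, ⟨h1, hx⟩, rfl⟩)

theorem div_add_two_le {x N : ℝ} (hx : x ≤ N) {r : ℕ} (hr : 0 < r) (hrN : (r : ℝ) ≤ N) :
    x / r + 2 ≤ 3 * (N / r.totient) := by
  have hr' : (0 : ℝ) < r := by exact_mod_cast hr
  have ht : (0 : ℝ) < r.totient := by exact_mod_cast Nat.totient_pos.2 hr
  have h1 : (r.totient : ℝ) ≤ r := by exact_mod_cast Nat.totient_le r
  have h2 : x / r ≤ N / r := by gcongr
  have h3 : N / r ≤ N / r.totient := by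
    have : 0 ≤ N := by linarith
    gcongr
  have h4 : 1 ≤ N / r := by rw [le_div_iff₀ hr']; linarith
  linarith

/-- A trivial bound from counting integers in a class. It only feeds the Cauchy–Schwarz argument
that removes the weights `6^ω(q)`, where a loss of logarithms does no harm. -/
theorem errStar_le {N : ℝ} (hN : 3 ≤ N) {r : ℕ} (hr : 0 < r) (hrN : (r : ℝ) ≤ N) :
    errStar N r ≤ 13 * (N / r.totient) * Real.log N ^ 2 := by
  have ht : (0 : ℝ) < r.totient := by exact_mod_cast Nat.totient_pos.2 hr
  have hL : 1 ≤ Real.log N := by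
    rw [Real.le_log_iff_exp_le (by linarith)]
    exact (Real.exp_one_lt_d9.le.trans (by norm_num)).trans hN
  have hNt : 0 ≤ N / r.totient := by positivity
  have hL2 : Real.log N ≤ Real.log N ^ 2 := by nlinarith
  refine Real.sSup_le ?_ (by positivity)
  rintro _ ⟨x, ⟨h1, hx⟩, rfl⟩
  refine Real.iSup_le (fun a => ?_) (by positivity)
  refine (abs_sub _ _).trans ?_
  rw [abs_of_nonneg (dyadicSum_nonneg varpi_nonneg _ _ _),
    abs_of_nonneg (by positivity : 0 ≤ x / (r.totient : ℝ))]
  have hB : ∀ n : ℕ, 0 < n → (n : ℝ) ≤ 2 * x → varpi n ≤ 2 * Real.log N := by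
    intro n hn hnx
    refine (varpi_le_log n).trans ?_
    rw [← Nat.cast_two, ← Real.log_pow]
    exact Real.log_le_log (by exact_mod_cast hn) (by nlinarith)
  have h2 := dyadicSum_le varpi_nonneg h1 hB hr (a : ZMod r)
  have h3 := mul_le_mul_of_nonneg_right (div_add_two_le hx hr hrN)
    (by positivity : 0 ≤ 2 * Real.log N)
  have h4 : x / (r.totient : ℝ) ≤ N / r.totient := by gcongr
  nlinarith [mul_le_mul_of_nonneg_left hL2 hNt, mul_le_mul_of_nonneg_left hL hNt]

theorem err2Star_le {N : ℝ} (hN : 3 ≤ N) {r : ℕ} (hr : 0 < r) (hrN : (r : ℝ) ≤ N) :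
    err2Star N r ≤ (15 + |C₀|) * (N / r.totient) * Real.log N ^ 2 := by
  have ht : (0 : ℝ) < r.totient := by exact_mod_cast Nat.totient_pos.2 hr
  have hL : 1 ≤ Real.log N := by
    rw [Real.le_log_iff_exp_le (by linarith)]
    exact (Real.exp_one_lt_d9.le.trans (by norm_num)).trans hN
  have hNt : 0 ≤ N / r.totient := by positivity
  have hL2 : Real.log N ≤ Real.log N ^ 2 := by nlinarith
  have hC := abs_nonneg C₀
  refine Real.sSup_le ?_ (by positivity)
  rintro _ ⟨x, ⟨h1, hx⟩, rfl⟩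
  refine Real.iSup_le (fun a => ?_) (by positivity)
  refine (abs_sub _ _).trans ?_
  rw [abs_of_nonneg (dyadicSum_nonneg varpi2_nonneg _ _ _), abs_mul,
    abs_of_nonneg (by positivity : 0 ≤ x / (r.totient : ℝ))]
  have hB : ∀ n : ℕ, 0 < n → (n : ℝ) ≤ 2 * x → varpi2 n ≤ (2 * Real.log N) ^ 2 := by
    intro n hn hnx
    refine varpi2_le_log_sq.trans (pow_le_pow_left₀ (Real.log_natCast_nonneg n) ?_ 2)
    rw [← Nat.cast_two, ← Real.log_pow]
    exact Real.log_le_log (by exact_mod_cast hn) (by nlinarith)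
  have h2 := dyadicSum_le varpi2_nonneg h1 hB hr (a : ZMod r)
  have h3 := mul_le_mul_of_nonneg_right (div_add_two_le hx hr hrN)
    (by positivity : 0 ≤ (2 * Real.log N) ^ 2)
  have h4 : x / (r.totient : ℝ) ≤ N / r.totient := by gcongr
  have h5 : |Real.log x + C₀ - 2 * ∑ p ∈ r.primeFactors, Real.log p / (p : ℝ)|
      ≤ (3 + |C₀|) * Real.log N ^ 2 := by
    have k1 : 0 ≤ Real.log x := Real.log_nonneg h1
    have k2 : Real.log x ≤ Real.log N := Real.log_le_log (by linarith) hx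
    have k3 := sum_primeFactors_log_div_nonneg r
    have k4 := (sum_primeFactors_log_div_le hr.ne').trans
      (Real.log_le_log (by exact_mod_cast hr) hrN)
    have k5 := le_abs_self C₀
    have k6 := neg_abs_le C₀
    have k7 : |C₀| ≤ |C₀| * Real.log N ^ 2 := by nlinarith
    rw [abs_le]
    constructor <;> nlinarith
  have h6 := mul_le_mul h4 h5 (abs_nonneg _) hNt
  nlinarith

end GapsE2
end

noncomputable section

open Filter Asymptotics Topology

namespace GapsE2

/-! ### Weighted averages over moduli -/

/-- Cauchy–Schwarz on `6^ω E = (6^ω √E) · √E`. The sum of `36^ω E` is bounded trivially: `q ≤ 2^ω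
φ(q)` turns it into a sum of `72^ω / q`, giving `N (log N)^74`. The sum of `E` is bounded by
hypothesis with exponent `2 A + 74`, and the square root leaves `A`. -/
theorem exists_weighted_bound {E : ℝ → ℕ → ℝ} (hE0 : ∀ N q, 0 ≤ E N q) {K : ℝ} (hK : 0 ≤ K)
    (hEK : ∀ N : ℝ, 3 ≤ N → ∀ r : ℕ, 0 < r → (r : ℝ) ≤ N →
      E N r ≤ K * (N / r.totient) * Real.log N ^ 2) {τ : ℝ} (hτ : τ ≤ 1)
    (hBV : ∀ A : ℝ, 0 < A → (fun N : ℝ => ∑ q ∈ Finset.Icc 1 ⌊N ^ τ⌋₊, E N q)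
      =O[atTop] (fun N : ℝ => N * Real.log N ^ (-A))) {A : ℝ} (hA : 0 < A) :
    ∃ C : ℝ, 0 ≤ C ∧ ∀ᶠ N : ℝ in atTop, ∀ y : ℝ, 12 * y ≤ N ^ τ →
      ∑ q ∈ moduli y 6, 6 ^ q.primeFactors.card * E N (12 * q) ≤ C * (N * Real.log N ^ (-A)) := by
  obtain ⟨c, hc, hb⟩ := (hBV (2 * A + 74) (by linarith)).exists_pos
  rw [isBigOWith_iff] at hb
  refine ⟨Real.sqrt (K * 2 ^ 72 * c), Real.sqrt_nonneg _, ?_⟩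
  filter_upwards [hb, eventually_ge_atTop (3 : ℝ)] with N hN hN3 y hy
  have hL : 1 ≤ Real.log N := by
    rw [Real.le_log_iff_exp_le (by linarith)]
    exact (Real.exp_one_lt_d9.le.trans (by norm_num)).trans hN3
  have hL0 : 0 < Real.log N := by linarith
  have hN0 : 0 < N := by linarith
  have hNτ : N ^ τ ≤ N := by
    calc N ^ τ ≤ N ^ (1 : ℝ) := Real.rpow_le_rpow_of_exponent_le (by linarith) hτ
      _ = N := Real.rpow_one N
  have hmem : ∀ q ∈ moduli y 6, Squarefree q ∧ Nat.Coprime q 6 ∧ 0 < q ∧ ((12 * q : ℕ) : ℝ) ≤ N ^ τ := by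
    intro q hq
    rw [moduli, Finset.mem_filter, Finset.mem_Icc] at hq
    refine ⟨hq.2.1, hq.2.2, hq.1.1, ?_⟩
    have := Nat.floor_pos.1 (lt_of_lt_of_le hq.1.1 hq.1.2)
    have := (Nat.le_floor_iff (by linarith)).1 hq.1.2
    push_cast
    linarith
  have h1 : ∑ q ∈ moduli y 6, (36 : ℝ) ^ q.primeFactors.card * E N (12 * q)
      ≤ K * 2 ^ 72 * N * Real.log N ^ 74 := by
    have hterm : ∀ q ∈ moduli y 6, (36 : ℝ) ^ q.primeFactors.card * E N (12 * q)
        ≤ (K * N * Real.log N ^ 2) * (((72 : ℕ) : ℝ) ^ q.primeFactors.card / q) := by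
      intro q hq
      obtain ⟨hs, h6, h0, hle⟩ := hmem q hq
      have hE := hEK N hN3 (12 * q) (by omega) (hle.trans hNτ)
      rw [totient_twelve_mul h6] at hE
      have hq0 : (0 : ℝ) < q := by exact_mod_cast h0
      have ht : (0 : ℝ) < q.totient := by exact_mod_cast Nat.totient_pos.2 h0
      have h2 : (q : ℝ) ≤ 2 ^ q.primeFactors.card * q.totient := by
        exact_mod_cast le_two_pow_mul_totient hs
      have h3 : N / ((4 * q.totient : ℕ) : ℝ) ≤ N * (2 ^ q.primeFactors.card / q) := by
        rw [div_eq_mul_inv]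
        refine mul_le_mul_of_nonneg_left ?_ hN0.le
        push_cast
        rw [inv_eq_one_div, div_le_div_iff₀ (by positivity) hq0]
        nlinarith [show (0 : ℝ) ≤ 2 ^ q.primeFactors.card * q.totient by positivity]
      calc (36 : ℝ) ^ q.primeFactors.card * E N (12 * q)
          ≤ 36 ^ q.primeFactors.card * (K * (N * (2 ^ q.primeFactors.card / q))
            * Real.log N ^ 2) := by
            refine mul_le_mul_of_nonneg_left (hE.trans ?_) (by positivity)
            gcongr
        _ = (K * N * Real.log N ^ 2) * (((72 : ℕ) : ℝ) ^ q.primeFactors.card / q) := by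
            rw [show ((72 : ℕ) : ℝ) = 36 * 2 by norm_num, mul_pow]
            ring
    refine (Finset.sum_le_sum hterm).trans ?_
    rw [← Finset.mul_sum]
    have h2 : ∑ q ∈ moduli y 6, (((72 : ℕ) : ℝ) ^ q.primeFactors.card / q)
        ≤ (2 * Real.log N) ^ 72 := by
      refine le_trans (Finset.sum_le_sum_of_subset_of_nonneg (fun q hq => Finset.mem_filter.2
        ⟨(Finset.mem_filter.1 hq).1, (Finset.mem_filter.1 hq).2.1⟩) fun _ _ _ => by positivity)
        ((sum_pow_card_primeFactors_div_le 72 ⌊y⌋₊).trans ?_)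
      have h3 : Real.log ⌊y⌋₊ ≤ Real.log N := by
        rcases Nat.eq_zero_or_pos ⌊y⌋₊ with h | h
        · rw [h]; simpa using hL0.le
        · have := Nat.floor_pos.1 h
          refine Real.log_le_log (by exact_mod_cast h) ?_
          have := Nat.floor_le (show 0 ≤ y by linarith)
          linarith
      have := Real.log_natCast_nonneg ⌊y⌋₊
      exact pow_le_pow_left₀ (by linarith) (by linarith) _
    calc _ ≤ (K * N * Real.log N ^ 2) * (2 * Real.log N) ^ 72 :=
          mul_le_mul_of_nonneg_left h2 (by positivity)
      _ = _ := by ring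
  have h2 : ∑ q ∈ moduli y 6, E N (12 * q) ≤ c * (N * Real.log N ^ (-(2 * A + 74))) := by
    rw [Real.norm_of_nonneg (Finset.sum_nonneg fun _ _ => hE0 _ _),
      Real.norm_of_nonneg (by positivity)] at hN
    refine le_trans ?_ hN
    rw [← Finset.sum_image (f := fun r => E N r) (g := fun q => 12 * q) (fun a _ b _ h => by
      simpa using h)]
    refine Finset.sum_le_sum_of_subset_of_nonneg ?_ fun _ _ _ => hE0 _ _
    intro r hr
    obtain ⟨q, hq, rfl⟩ := Finset.mem_image.1 hr
    obtain ⟨-, -, h0, hle⟩ := hmem q hq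
    exact Finset.mem_Icc.2 ⟨by omega, Nat.le_floor hle⟩
  have h3 := Finset.sum_mul_sq_le_sq_mul_sq (moduli y 6)
    (fun q => 6 ^ q.primeFactors.card * Real.sqrt (E N (12 * q)))
    (fun q => Real.sqrt (E N (12 * q)))
  simp only [mul_pow, Real.sq_sqrt (hE0 _ _), mul_assoc, Real.mul_self_sqrt (hE0 _ _)] at h3
  have h36 : ∀ k : ℕ, ((6 : ℝ) ^ k) ^ 2 = 36 ^ k := fun k => by rw [pow_right_comm]; norm_num
  simp only [h36] at h3
  have h4 : (∑ q ∈ moduli y 6, 6 ^ q.primeFactors.card * E N (12 * q)) ^ 2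
      ≤ (Real.sqrt (K * 2 ^ 72 * c) * (N * Real.log N ^ (-A))) ^ 2 := by
    refine h3.trans ((mul_le_mul h1 h2 (Finset.sum_nonneg fun _ _ => hE0 _ _)
      (by positivity)).trans (le_of_eq ?_))
    rw [mul_pow, Real.sq_sqrt (by positivity), mul_pow]
    have e : Real.log N ^ 74 * Real.log N ^ (-(2 * A + 74)) = (Real.log N ^ (-A)) ^ 2 := by
      rw [← Real.rpow_natCast, ← Real.rpow_natCast, ← Real.rpow_mul hL0.le, ← Real.rpow_add hL0]
      congr 1
      push_cast
      ring
    rw [← e]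
    ring
  exact (le_abs_self _).trans (abs_le_of_sq_le_sq h4 (by positivity))

end GapsE2
end

noncomputable section

open Filter Asymptotics Topology

namespace GapsE2

/-! ### Sums over the residue classes cut out by shifts -/

/-- The shifts and their differences have no prime factor greater than `3`. -/
def Admissible (S : Finset ℤ) : Prop :=
  ∀ p : ℕ, p.Prime → 3 < p → DistinctMod S p ∧ ∀ a ∈ S, ¬ (p : ℤ) ∣ a

/-- All shifts in use and their differences, apart from zero, divide `12`, so only the primes `2`
and `3` could be exceptional. -/
theorem not_dvd_of_dvd_twelve {p : ℕ} (hp : p.Prime) (h3 : 3 < p) {a : ℤ} (ha : a ∣ 12) :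
    ¬ (p : ℤ) ∣ a := fun h => by
  have h1 : p ∣ 12 := by exact_mod_cast h.trans ha
  have h2 : p ≤ 12 := Nat.le_of_dvd (by norm_num) h1
  interval_cases p <;> first | omega | exact absurd hp (by decide)

theorem admissible_pair {α β : ℤ} (hα : α ∣ 12) (hβ : β ∣ 12) (hαβ : α - β ∣ 12) :
    Admissible {α, β} := by
  intro p hp h3
  constructor
  · intro a ha b hb h
    rw [Finset.mem_insert, Finset.mem_singleton] at ha hb
    rcases ha with rfl | rfl <;> rcases hb with rfl | rfl
    · rfl
    · exact absurd h (not_dvd_of_dvd_twelve hp h3 hαβ)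
    · rw [← dvd_neg, neg_sub] at h
      exact absurd h (not_dvd_of_dvd_twelve hp h3 hαβ)
    · rfl
  · intro a ha
    rw [Finset.mem_insert, Finset.mem_singleton] at ha
    rcases ha with rfl | rfl
    · exact not_dvd_of_dvd_twelve hp h3 hα
    · exact not_dvd_of_dvd_twelve hp h3 hβ

theorem distinctMod_triple {p : ℕ} (hp : p.Prime) (h3 : 3 < p) : DistinctMod {0, 2, 6} p := by
  intro a ha b hb h
  by_contra hab
  refine not_dvd_of_dvd_twelve hp h3 ?_ h
  simp only [Finset.mem_insert, Finset.mem_singleton] at ha hb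
  rcases ha with rfl | rfl | rfl <;> rcases hb with rfl | rfl | rfl <;>
    first | exact absurd rfl hab | decide

theorem sum_filter_eq_sum_dyadicSum (S : Finset ℤ) (c : ℕ) {q p : ℕ} (hq : 0 < q)
    (hp : Nat.Coprime p (12 * q)) (f : ℕ → ℝ) (x : ℝ) :
    ∑ n ∈ (Finset.Ioc ⌊x⌋₊ ⌊2 * x⌋₊).filter (fun n => (p * n) % 12 = c ∧ ShiftDvd S q (p * n)), f n
      = ∑ r ∈ residues S c q,
        dyadicSum f x (12 * q) ((p : ZMod (12 * q))⁻¹ * (r : ZMod (12 * q))) := by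
  rw [sum_filter_eq_sum_residues S c hq]
  refine Finset.sum_congr rfl fun r hr => ?_
  have hr' : r < 12 * q := Finset.mem_range.1 (Finset.mem_filter.1 hr).1
  unfold dyadicSum
  exact Finset.sum_congr (Finset.filter_congr fun n _ => filter_eq_dyadic hp hr' n)
    fun _ _ => rfl

/-- The condition selects `S.card ^ ω(q)` reduced classes for `p n` modulo `12 q`; division by `p`
maps them to reduced classes for `n`, each with error at most `B`. -/
theorem abs_sum_filter_sub_le {S : Finset ℤ} (hS : Admissible S) {c : ℕ} (hc12 : c < 12)
    (hc : Nat.Coprime c 12) {q p : ℕ} (hq : Squarefree q) (h6 : Nat.Coprime q 6)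
    (hp : Nat.Coprime p (12 * q)) (f : ℕ → ℝ) (x : ℝ) {X B : ℝ}
    (hB : ∀ a : (ZMod (12 * q))ˣ, |dyadicSum f x (12 * q) a - X| ≤ B) :
    |∑ n ∈ (Finset.Ioc ⌊x⌋₊ ⌊2 * x⌋₊).filter
        (fun n => (p * n) % 12 = c ∧ ShiftDvd S q (p * n)), f n
      - S.card ^ q.primeFactors.card * X| ≤ S.card ^ q.primeFactors.card * B := by
  have hS' : ∀ l : ℕ, l.Prime → l ∣ q → DistinctMod S l ∧ ∀ a ∈ S, ¬ (l : ℤ) ∣ a := fun l hl hlq =>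
    hS l hl (three_lt_of_coprime_six h6 hl hlq)
  have hcard := card_residues S hc12 hq (coprime_twelve_of_coprime_six h6)
    fun l hl hlq => (hS' l hl hlq).1
  rw [sum_filter_eq_sum_dyadicSum S c hq.ne_zero.bot_lt hp]
  have e : ((S.card : ℝ)) ^ q.primeFactors.card = ((residues S c q).card : ℝ) := by
    rw [hcard]; push_cast; rfl
  rw [e, ← nsmul_eq_mul, ← nsmul_eq_mul, ← Finset.sum_const, ← Finset.sum_sub_distrib]
  refine (Finset.abs_sum_le_sum_abs _ _).trans ((Finset.sum_le_sum fun r hr => ?_).trans_eq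
    (Finset.sum_const B))
  have hr' : Nat.Coprime r (12 * q) :=
    coprime_of_mem_residues hc (fun l hl hlq => (hS' l hl hlq).2) hr
  have h := hB ((ZMod.unitOfCoprime p hp)⁻¹ * ZMod.unitOfCoprime r hr')
  rwa [Units.val_mul, ZMod.coe_unitOfCoprime, ← ZMod.inv_coe_unit, ZMod.coe_unitOfCoprime] at h

theorem abs_sum_varpi_sub_le {S : Finset ℤ} (hS : Admissible S) (hS2 : S.card = 2) {c : ℕ}
    (hc12 : c < 12) (hc : Nat.Coprime c 12) {q p : ℕ} (hq : Squarefree q) (h6 : Nat.Coprime q 6)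
    (hp : Nat.Coprime p (12 * q)) {x : ℝ} (hx : 1 ≤ x) :
    |∑ n ∈ (Finset.Ioc ⌊x⌋₊ ⌊2 * x⌋₊).filter
        (fun n => (p * n) % 12 = c ∧ ShiftDvd S q (p * n)), varpi n
      - x / 4 * siftWeight pairDensity q| ≤ 2 ^ q.primeFactors.card * errStar x (12 * q) := by
  have h0 := hq.ne_zero.bot_lt
  have h := abs_sum_filter_sub_le hS hc12 hc hq h6 hp varpi x
    (X := x / ((12 * q).totient : ℝ)) (B := errStar x (12 * q))
    fun a => abs_err_le_errStar hx le_rfl (by omega) a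
  rw [hS2, totient_twelve_mul h6, Nat.cast_two] at h
  rw [siftWeight_pairDensity hq h6]
  convert h using 3
  push_cast
  ring

/-- In the correction `2 ∑ log p / p` over the primes of `12 q`, the primes `2` and `3` give the
constant `log 2 + (2/3) log 3`; the primes of `q` stay as a separate sum. -/
theorem abs_sum_varpi2_sub_le {S : Finset ℤ} (hS : Admissible S) (hS2 : S.card = 2) {c : ℕ}
    (hc12 : c < 12) (hc : Nat.Coprime c 12) {q : ℕ} (hq : Squarefree q) (h6 : Nat.Coprime q 6)
    {x : ℝ} (hx : 1 ≤ x) :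
    |∑ n ∈ (Finset.Ioc ⌊x⌋₊ ⌊2 * x⌋₊).filter (fun n => n % 12 = c ∧ ShiftDvd S q n), varpi2 n
      - x / 4 * (siftWeight pairDensity q * (Real.log x + (C₀ - Real.log 2 - 2 / 3 * Real.log 3))
        - 2 * ∑ p ∈ q.primeFactors, Real.log p / p * siftWeight pairDensity q)|
      ≤ 2 ^ q.primeFactors.card * err2Star x (12 * q) := by
  have h0 := hq.ne_zero.bot_lt
  have h := abs_sum_filter_sub_le hS hc12 hc hq h6 (p := 1) (Nat.coprime_one_left _) varpi2 x
    (X := x / ((12 * q).totient : ℝ) * (Real.log x + C₀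
      - 2 * ∑ p ∈ (12 * q).primeFactors, Real.log p / (p : ℝ)))
    (B := err2Star x (12 * q)) fun a => abs_err2_le_err2Star hx le_rfl (by omega) a
  have h12 := coprime_twelve_of_coprime_six h6
  have e12 : (12 : ℕ).primeFactors = {2, 3} := by
    rw [show 12 = 2 ^ 2 * 3 by norm_num, Nat.primeFactors_mul (by norm_num) (by norm_num),
      Nat.primeFactors_prime_pow (by norm_num) Nat.prime_two, Nat.prime_three.primeFactors]
    rfl
  simp only [one_mul] at h
  rw [hS2, totient_twelve_mul h6, h12.primeFactors_mul,
    Finset.sum_union h12.disjoint_primeFactors, e12, Finset.sum_pair (by norm_num),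
    Nat.cast_two] at h
  rw [siftWeight_pairDensity hq h6, ← Finset.sum_mul]
  convert h using 3
  push_cast
  ring

theorem abs_card_filter_sub_le {q : ℕ} (hq : Squarefree q) (h6 : Nat.Coprime q 6) {a b : ℕ}
    (hab : a ≤ b) :
    |(((Finset.Ioc a b).filter fun n => n % 12 = 5 ∧ ShiftDvd {0, 2, 6} q n).card : ℝ)
      - ((b : ℝ) - a) / 12 * siftWeight tripleDensity q| ≤ 3 ^ q.primeFactors.card := by
  have hcard := card_residues {0, 2, 6} (c := 5) (by norm_num) hq
    (coprime_twelve_of_coprime_six h6)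
    fun l hl hlq => distinctMod_triple hl (three_lt_of_coprime_six h6 hl hlq)
  rw [show (({0, 2, 6} : Finset ℤ)).card = 3 by rfl] at hcard
  have h := sum_filter_eq_sum_residues {0, 2, 6} 5 hq.ne_zero.bot_lt 1 (Finset.Ioc a b)
    fun _ => (1 : ℝ)
  simp only [one_mul, Finset.sum_const, nsmul_eq_mul, mul_one] at h
  have e : ((b : ℝ) - a) / 12 * siftWeight tripleDensity q
      = ∑ r ∈ residues {0, 2, 6} 5 q, ((b : ℝ) - a) / ((12 * q : ℕ) : ℝ) := by
    rw [Finset.sum_const, hcard, siftWeight_tripleDensity hq h6, nsmul_eq_mul]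
    push_cast
    ring
  rw [h, e, ← Finset.sum_sub_distrib]
  refine (Finset.abs_sum_le_sum_abs _ _).trans ((Finset.sum_le_sum fun r hr => ?_).trans_eq
    (b := ∑ r ∈ residues {0, 2, 6} 5 q, (1 : ℝ)) ?_)
  · have hr' : r < 12 * q := Finset.mem_range.1 (Finset.mem_filter.1 hr).1
    have := abs_card_Ioc_modEq_sub_le hab (show 0 < 12 * q by
      have := hq.ne_zero.bot_lt; omega) r
    rwa [Nat.mod_eq_of_lt hr'] at this
  · rw [Finset.sum_const, hcard, nsmul_eq_mul, mul_one]
    push_cast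
    rfl

end GapsE2
end

noncomputable section

open Filter Asymptotics Topology

namespace GapsE2

/-! ### The sum of the squared weights -/

theorem tendsto_quadForm {k : ℕ} (hk : 0 < k) {g : ℕ → ℝ} (hg : Summable (densityError k g))
    {F : ℝ → ℝ} (hFs : ContDiff ℝ (⊤ : ℕ∞) F) (hFc : HasCompactSupport F)
    (hF : ∀ t, 1 ≤ t → F t = 0) :
    Tendsto (fun R => Real.log R ^ k * quadForm g F F R) atTop
      (𝓝 ((singularSeries k g).re * sieveForm k F 0 0)) := by
  obtain ⟨δ, hδ, h⟩ := exists_quadForm_error hk hg hFs hFc hF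
  refine tendsto_iff_norm_sub_tendsto_zero.2 (squeeze_zero' (Eventually.of_forall fun _ =>
    norm_nonneg _) ?_ hδ)
  filter_upwards [h] with R hR
  have := hR 0 0 le_rfl le_rfl
  simp only [add_zero] at this
  exact this

theorem exists_bound {F : ℝ → ℝ} (hFs : ContDiff ℝ (⊤ : ℕ∞) F) (hFc : HasCompactSupport F) :
    ∃ C : ℝ, 0 ≤ C ∧ ∀ t, |F t| ≤ C := by
  obtain ⟨C, hC⟩ := hFc.exists_bound_of_continuous hFs.continuous
  exact ⟨C, (norm_nonneg _).trans (hC 0), hC⟩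

theorem tendsto_log_pow_mul_rpow (k : ℕ) {c : ℝ} (hc : c < 0) :
    Tendsto (fun N : ℝ => Real.log N ^ k * N ^ c) atTop (𝓝 0) := by
  have h := (isLittleO_log_rpow_rpow_atTop (k : ℝ) (neg_pos.2 hc)).tendsto_div_nhds_zero
  refine h.congr' ?_
  filter_upwards [eventually_gt_atTop (0 : ℝ)] with N hN
  rw [Real.rpow_natCast, Real.rpow_neg hN.le, div_inv_eq_mul]

theorem log_rpow_half {N : ℝ} (hN : 0 < N) (η : ℝ) :
    Real.log (N ^ (η / 2)) = η / 2 * Real.log N := Real.log_rpow hN _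

theorem rpow_half_mul_self {N : ℝ} (hN : 0 < N) (η : ℝ) : N ^ (η / 2) * N ^ (η / 2) = N ^ η := by
  rw [← Real.rpow_add hN]
  congr 1
  ring

theorem support_of_vanish {F : ℝ → ℝ} (hF : ∀ t, 1 ≤ t → F t = 0) {R : ℝ} (hR : 1 < R) {d : ℕ}
    (hd : R < d) : F (Real.log d / Real.log R) = 0 := by
  refine hF _ ?_
  rw [le_div_iff₀ (Real.log_pos hR), one_mul]
  exact Real.log_le_log (by linarith) hd.le

theorem sum_moduli_pow_le (m M : ℕ) {y : ℝ} (hy : 1 ≤ y) :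
    ∑ q ∈ moduli y M, (m : ℝ) ^ q.primeFactors.card ≤ y * (1 + Real.log y) ^ m := by
  refine le_trans ?_ (mul_le_mul_of_nonneg_left (sum_moduli_pow_div_le m M hy) (by linarith))
  rw [Finset.mul_sum]
  refine Finset.sum_le_sum fun q hq => ?_
  rw [moduli, Finset.mem_filter, Finset.mem_Icc] at hq
  have h1 : (1 : ℝ) ≤ q := by exact_mod_cast hq.1.1
  have h2 := (Nat.le_floor_iff (by linarith)).1 hq.1.2
  rw [mul_div_assoc', le_div_iff₀ (by linarith), mul_comm]
  exact mul_le_mul_of_nonneg_right h2 (by positivity)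

/-- The sum of the squared weights over `N - 6 < n ≤ 2 N`, `n ≡ 5 (mod 12)`. -/
def weightSum (F : ℝ → ℝ) (η N : ℝ) : ℝ :=
  ∑ n ∈ (Finset.Ioc (⌊N⌋₊ - 6) ⌊2 * N⌋₊).filter (fun n => n % 12 = 5),
    sieveSum 6 F (N ^ (η / 2)) {0, 2, 6} n ^ 2

theorem tripleDensity_eq_zero {p : ℕ} (hp : p.Prime) (h : p ∣ 6) : tripleDensity p = 0 := by
  have h1 : p ∣ 2 * 3 := h
  rw [tripleDensity, if_pos]
  rcases (hp.dvd_mul).1 h1 with h | h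
  · exact (Nat.le_of_dvd (by norm_num) h).trans (by norm_num)
  · exact Nat.le_of_dvd (by norm_num) h

theorem pairDensity_eq_zero {p : ℕ} (hp : p.Prime) (h : p ∣ 6) : pairDensity p = 0 := by
  have h1 : p ∣ 2 * 3 := h
  rw [pairDensity, if_pos]
  rcases (hp.dvd_mul).1 h1 with h | h
  · exact (Nat.le_of_dvd (by norm_num) h).trans (by norm_num)
  · exact Nat.le_of_dvd (by norm_num) h

/-- A weighted sum of products of sieve sums is the form attached to an approximation `V` of the
weighted counts of the residue classes, up to the errors `B` of this approximation. -/
theorem abs_sum_mul_sieveSum_sub_le {M : ℕ} {F H : ℝ → ℝ} {R T CF CH : ℝ}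
    (hF : ∀ t, |F t| ≤ CF) (hH : ∀ t, |H t| ≤ CH) (hR : 0 ≤ R)
    (hHT : ∀ d : ℕ, 0 < d → T < d → H (Real.log d / Real.log R) = 0) (S : Finset ℤ)
    (s : Finset ℕ) (w : ℕ → ℝ) (e : ℕ → ℕ) {V B : ℕ → ℝ}
    (hV : ∀ q, 0 < q → ¬ Nat.Coprime q M → V q = 0)
    (hB : ∀ q ∈ moduli (R * T) M,
      |∑ n ∈ s.filter (fun n => ShiftDvd S q (e n)), w n - V q| ≤ B q) :
    |∑ n ∈ s, w n * (sieveSum M F R S (e n) * sieveSum M H R S (e n)) - lcmForm V F H R|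
      ≤ CF * CH * ∑ q ∈ moduli (R * T) M, 3 ^ q.primeFactors.card * B q := by
  have hCF : 0 ≤ CF := (abs_nonneg _).trans (hF 0)
  have hCH : 0 ≤ CH := (abs_nonneg _).trans (hH 0)
  have e1 : lcmForm V F H R = lcmForm (fun q => if Nat.Coprime q M then V q else 0) F H R := by
    unfold lcmForm
    refine Finset.sum_congr rfl fun d hd => Finset.sum_congr rfl fun d' hd' => ?_
    rw [Finset.mem_Icc] at hd hd'
    dsimp only
    split_ifs with h
    · rfl
    · rw [hV _ (Nat.lcm_pos hd.1 hd'.1) h]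
  rw [sum_mul_sieveSum, e1, ← lcmForm_sub]
  refine (abs_lcmForm_le (M := M) (fun q hq => by simp only [if_neg hq, sub_zero]) hF hH hR
    hHT).trans ?_
  refine mul_le_mul_of_nonneg_left (Finset.sum_le_sum fun q hq => ?_) (by positivity)
  have hc : Nat.Coprime q M := (Finset.mem_filter.1 hq).2.2
  simp only [if_pos hc]
  exact mul_le_mul_of_nonneg_left (hB q hq) (by positivity)

/-- Each class modulo `12 q` is counted with error at most `1`, and `q ≤ R² = N^η`. Since `η < 1`,
the total error is a power of `N` below the main term. -/
theorem tendsto_weightSum {F : ℝ → ℝ} (hFs : ContDiff ℝ (⊤ : ℕ∞) F) (hFc : HasCompactSupport F)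
    (hF : ∀ t, 1 ≤ t → F t = 0) {η : ℝ} (h0 : 0 < η) (h1 : η < 1) :
    Tendsto (fun N => Real.log (N ^ (η / 2)) ^ 3 / N * weightSum F η N) atTop
      (𝓝 ((singularSeries 3 tripleDensity).re / 12 * sieveForm 3 F 0 0)) := by
  obtain ⟨CF, hCF, hb⟩ := exists_bound hFs hFc
  have hR : Tendsto (fun N : ℝ => N ^ (η / 2)) atTop atTop := tendsto_rpow_atTop (by linarith)
  have hQ := (tendsto_quadForm (by norm_num) summable_tripleDensity hFs hFc hF).comp hR
  set X : ℝ → ℝ := fun N => ((⌊2 * N⌋₊ : ℝ) - ((⌊N⌋₊ - 6 : ℕ) : ℝ)) / 12 with hX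
  have hXN : Tendsto (fun N => X N / N) atTop (𝓝 (1 / 12)) := by
    have hlim : Tendsto (fun N : ℝ => 8 * N⁻¹) atTop (𝓝 0) := by
      simpa using tendsto_inv_atTop_zero.const_mul (8 : ℝ)
    refine tendsto_iff_norm_sub_tendsto_zero.2 (squeeze_zero' (Eventually.of_forall fun _ =>
      norm_nonneg _) ?_ hlim)
    filter_upwards [eventually_ge_atTop (10 : ℝ)] with N hN
    have h6 : 6 ≤ ⌊N⌋₊ := Nat.le_floor (by norm_num; linarith)
    have f1 := Nat.floor_le (show 0 ≤ N by linarith)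
    have f2 := Nat.lt_floor_add_one N
    have f3 := Nat.floor_le (show 0 ≤ 2 * N by linarith)
    have f4 := Nat.lt_floor_add_one (2 * N)
    have : X N / N - 1 / 12 = (X N - N / 12) * N⁻¹ := by field_simp
    rw [Real.norm_eq_abs, this, abs_mul, abs_of_nonneg (by positivity : 0 ≤ N⁻¹)]
    refine mul_le_mul_of_nonneg_right ?_ (by positivity)
    simp only [hX]
    rw [Nat.cast_sub h6, abs_le]
    push_cast
    constructor <;> linarith
  have hmain : Tendsto (fun N => X N / N * (Real.log (N ^ (η / 2)) ^ 3
      * quadForm tripleDensity F F (N ^ (η / 2)))) atTop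
      (𝓝 ((singularSeries 3 tripleDensity).re / 12 * sieveForm 3 F 0 0)) := by
    rw [show (singularSeries 3 tripleDensity).re / 12 * sieveForm 3 F 0 0
      = 1 / 12 * ((singularSeries 3 tripleDensity).re * sieveForm 3 F 0 0) by ring]
    exact hXN.mul hQ
  have herr : Tendsto (fun N => Real.log (N ^ (η / 2)) ^ 3 / N * weightSum F η N
      - X N / N * (Real.log (N ^ (η / 2)) ^ 3 * quadForm tripleDensity F F (N ^ (η / 2))))
      atTop (𝓝 0) := by
    -- Nine logarithms come from `3^ω · 3^ω` (pairs with a given least common multiple, times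
    -- roots), and three from the normalisation.
    have hlim := (tendsto_log_pow_mul_rpow 12 (show η - 1 < 0 by linarith)).const_mul
      (CF * CF * 2 ^ 9)
    rw [mul_zero] at hlim
    refine squeeze_zero_norm' ?_ hlim
    filter_upwards [eventually_ge_atTop (10 : ℝ), hR.eventually_gt_atTop 1] with N hN hR1
    have hN0 : 0 < N := by linarith
    set R := N ^ (η / 2) with hRdef
    have hlogR : Real.log R = η / 2 * Real.log N := log_rpow_half hN0 η
    have hL : 1 ≤ Real.log N := by
      rw [Real.le_log_iff_exp_le (by linarith)]
      exact (Real.exp_one_lt_d9.le.trans (by norm_num)).trans hN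
    have hab : ⌊N⌋₊ - 6 ≤ ⌊2 * N⌋₊ :=
      (Nat.sub_le _ _).trans (Nat.floor_le_floor (by linarith))
    have h := abs_sum_mul_sieveSum_sub_le (M := 6) (T := R) hb hb (by linarith : 0 ≤ R)
      (fun d _ hd => support_of_vanish hF hR1 hd) {0, 2, 6}
      ((Finset.Ioc (⌊N⌋₊ - 6) ⌊2 * N⌋₊).filter (fun n => n % 12 = 5)) (fun _ => 1) id
      (V := fun q => X N * siftWeight tripleDensity q) (B := fun q => 3 ^ q.primeFactors.card)
      (fun q hq hc => by
        rw [siftWeight_eq_zero (fun p hp h => tripleDensity_eq_zero hp h) hq.ne' hc, mul_zero])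
      (fun q hq => by
        rw [Finset.sum_const, nsmul_eq_mul, mul_one, Finset.filter_filter]
        rw [moduli, Finset.mem_filter] at hq
        exact abs_card_filter_sub_le hq.2.1 hq.2.2 hab)
    rw [lcmForm_const_mul, ← quadForm_eq_lcmForm] at h
    have hw : ∑ n ∈ (Finset.Ioc (⌊N⌋₊ - 6) ⌊2 * N⌋₊).filter (fun n => n % 12 = 5),
        1 * (sieveSum 6 F R {0, 2, 6} (id n) * sieveSum 6 F R {0, 2, 6} (id n))
        = weightSum F η N := by
      refine Finset.sum_congr rfl fun n _ => ?_
      rw [one_mul, ← sq]; rfl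
    rw [hw] at h
    have h9 : ∑ q ∈ moduli (R * R) 6, (3 : ℝ) ^ q.primeFactors.card * 3 ^ q.primeFactors.card
        ≤ N ^ η * (2 * Real.log N) ^ 9 := by
      have hRR : R * R = N ^ η := rpow_half_mul_self hN0 η
      have k1 : 1 ≤ R * R := by nlinarith
      have k2 := sum_moduli_pow_le 9 6 k1
      have k3 : Real.log (R * R) = η * Real.log N := by rw [hRR, Real.log_rpow hN0]
      have k4 : 0 ≤ Real.log (R * R) := Real.log_nonneg k1
      have k5 : ∑ q ∈ moduli (R * R) 6, (3 : ℝ) ^ q.primeFactors.card * 3 ^ q.primeFactors.card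
          = ∑ q ∈ moduli (R * R) 6, ((9 : ℕ) : ℝ) ^ q.primeFactors.card :=
        Finset.sum_congr rfl fun q _ => by rw [← mul_pow]; norm_num
      rw [k5]
      refine k2.trans ?_
      rw [hRR] at k4 k3 ⊢
      refine mul_le_mul_of_nonneg_left (pow_le_pow_left₀ (by linarith) ?_ _) (by positivity)
      rw [k3]
      nlinarith
    have hfin := h.trans (mul_le_mul_of_nonneg_left h9 (by positivity : 0 ≤ CF * CF))
    have e2 : Real.log R ^ 3 / N * weightSum F η N
        - X N / N * (Real.log R ^ 3 * quadForm tripleDensity F F R)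
        = Real.log R ^ 3 / N * (weightSum F η N - X N * quadForm tripleDensity F F R) := by ring
    have hR0 : 0 ≤ Real.log R := Real.log_nonneg hR1.le
    have hRL : Real.log R ≤ Real.log N := by rw [hlogR]; nlinarith
    rw [e2, Real.norm_eq_abs, abs_mul, abs_of_nonneg (by positivity)]
    calc Real.log R ^ 3 / N * |weightSum F η N - X N * quadForm tripleDensity F F R|
        ≤ Real.log N ^ 3 / N * (CF * CF * (N ^ η * (2 * Real.log N) ^ 9)) := by gcongr
      _ = CF * CF * 2 ^ 9 * (Real.log N ^ 12 * N ^ (η - 1)) := by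
        rw [Real.rpow_sub hN0, Real.rpow_one]
        field_simp
  have := herr.add hmain
  simpa using this

end GapsE2
end

noncomputable section

open Filter Asymptotics Topology

namespace GapsE2

/-! ### Removing the shift carrying the weight -/

theorem varpi2_eq_sum_primeFactors (m : ℕ) :
    varpi2 m = ∑ p ∈ m.primeFactors, Real.log p * varpi (m / p) := by
  have e : m.primeFactors = m.divisors.filter Nat.Prime := by
    ext p
    rw [Nat.mem_primeFactors, Finset.mem_filter, Nat.mem_divisors]
    tauto
  rw [e, Finset.sum_filter]
  refine Finset.sum_congr rfl fun d _ => ?_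
  unfold varpi
  by_cases h : d.Prime <;> simp [h]

theorem varpi2_prime_mul {p l : ℕ} (hp : p.Prime) (hl : l.Prime) (h : p ≠ l) :
    varpi2 (p * l) = 2 * Real.log p * Real.log l := by
  rw [varpi2_eq_sum_primeFactors, Nat.primeFactors_mul hp.ne_zero hl.ne_zero, hp.primeFactors,
    hl.primeFactors, ← Finset.insert_eq, Finset.sum_pair h, Nat.mul_div_cancel_left _ hp.pos,
    Nat.mul_div_cancel _ hl.pos, varpi, varpi, if_pos hp, if_pos hl]
  ring

theorem exists_of_varpi2_ne_zero {m : ℕ} (h : varpi2 m ≠ 0) :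
    ∃ p l : ℕ, p.Prime ∧ l.Prime ∧ m = p * l := by
  rw [varpi2_eq_sum_primeFactors] at h
  obtain ⟨p, hp, hne⟩ := Finset.exists_ne_zero_of_sum_ne_zero h
  have hl : (m / p).Prime := by
    by_contra hl
    exact hne (by rw [varpi, if_neg hl, mul_zero])
  exact ⟨p, m / p, Nat.prime_of_mem_primeFactors hp, hl,
    (Nat.mul_div_cancel' (Nat.dvd_of_mem_primeFactors hp)).symm⟩

theorem shiftDvd_insert_zero {S : Finset ℤ} (h0 : (0 : ℤ) ∉ S) (d m : ℕ) :
    ShiftDvd (insert 0 S) d m ↔ (d : ℤ) ∣ m * ∏ a ∈ S, ((m : ℤ) + a) := by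
  unfold ShiftDvd
  rw [Finset.prod_insert h0, add_zero]

theorem shiftDvd_insert_zero_of_coprime {S : Finset ℤ} (h0 : (0 : ℤ) ∉ S) {d m : ℕ}
    (h : Nat.Coprime d m) : ShiftDvd (insert 0 S) d m ↔ ShiftDvd S d m := by
  rw [shiftDvd_insert_zero h0]
  exact ⟨fun hd => (Nat.isCoprime_iff_coprime.2 h).dvd_of_dvd_mul_left hd, fun hd => hd.mul_left _⟩

theorem Admissible.not_shiftDvd {S : Finset ℤ} (hS : Admissible S) {p m : ℕ} (hp : p.Prime)
    (h3 : 3 < p) (hpm : p ∣ m) : ¬ ShiftDvd S p m := by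
  unfold ShiftDvd
  rw [(Nat.prime_iff_prime_int.1 hp).dvd_finsetProd_iff]
  rintro ⟨a, ha, hd⟩
  exact (hS p hp h3).2 a ha ((dvd_add_right (Int.natCast_dvd_natCast.2 hpm)).1 hd)

theorem shiftDvd_of_dvd {S : Finset ℤ} {d e m : ℕ} (h : d ∣ e) (he : ShiftDvd S e m) :
    ShiftDvd S d m := (Int.natCast_dvd_natCast.2 h).trans he

theorem sieveSum_insert_zero_of_coprime {S : Finset ℤ} (h0 : (0 : ℤ) ∉ S) (M : ℕ) (F : ℝ → ℝ)
    {R : ℝ} {m : ℕ} (h : ∀ d ∈ Finset.Icc 1 ⌊R⌋₊, Nat.Coprime d m) :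
    sieveSum M F R (insert 0 S) m = sieveSum M F R S m := by
  unfold sieveSum
  refine Finset.sum_congr rfl fun d hd => ?_
  simp only [shiftDvd_insert_zero_of_coprime h0 (h d hd)]

/-- As `p ∣ m` and `p` divides no element of `S`, it cannot divide the product of the shifts, so the
extra coprimality is automatic. It is imposed because `p` must be invertible modulo `12 q`. -/
theorem sieveSum_mul_prime {S : Finset ℤ} (hS : Admissible S) {p : ℕ} (hp : p.Prime) (h3 : 3 < p)
    (M : ℕ) (F : ℝ → ℝ) (R : ℝ) {m : ℕ} (hpm : p ∣ m) :
    sieveSum M F R S m = sieveSum (M * p) F R S m := by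
  unfold sieveSum
  refine Finset.sum_congr rfl fun d _ => if_congr ?_ rfl rfl
  refine and_congr_left fun hd => ?_
  rw [Nat.coprime_mul_iff_right]
  refine ⟨fun h => ⟨h, ?_⟩, fun h => h.1⟩
  rw [Nat.coprime_comm, hp.coprime_iff_not_dvd]
  exact fun h => hS.not_shiftDvd hp h3 hpm (shiftDvd_of_dvd h hd)

/-- No `d ≤ R` is divisible by `l`. A divisor prime to `p` divides the shifts in `S`; one of the
form `p e` has `e` dividing them, with `μ(p e) = -μ(e)` and `log (p e)` producing the translate of
`F`. The range for `e` may be extended to `R` because `F` vanishes once `p e > R`. -/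
theorem sieveSum_insert_zero {S : Finset ℤ} (hS : Admissible S) (h0 : (0 : ℤ) ∉ S) {F : ℝ → ℝ}
    (hF : ∀ t, 1 ≤ t → F t = 0) {R : ℝ} (hR : 1 < R) {p l : ℕ} (hp : p.Prime) (h3 : 3 < p)
    (hl : l.Prime) (hlR : R < l) :
    sieveSum 6 F R (insert 0 S) (p * l) = sieveSum 6 F R S (p * l)
      - sieveSum 6 (fun t => F (t + Real.log p / Real.log R)) R S (p * l) := by
  have hlog : 0 < Real.log R := Real.log_pos hR
  set m := p * l with hm
  have hpm : p ∣ m := Dvd.intro _ rfl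
  set h : ℕ → ℝ := fun d => if p ∣ d ∧ Nat.Coprime d 6 ∧ ShiftDvd S (d / p) m then
    (ArithmeticFunction.moebius d : ℝ) * F (Real.log d / Real.log R) else 0 with hh
  have hp6 : Nat.Coprime p 6 := by
    rw [hp.coprime_iff_not_dvd]
    intro hd
    have : p ≤ 6 := Nat.le_of_dvd (by norm_num) hd
    interval_cases p <;> first | omega | exact absurd hp (by decide)
  have key : ∀ d ∈ Finset.Icc 1 ⌊R⌋₊,
      (if Nat.Coprime d 6 ∧ ShiftDvd (insert 0 S) d m then
        (ArithmeticFunction.moebius d : ℝ) * F (Real.log d / Real.log R) else 0)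
      = (if Nat.Coprime d 6 ∧ ShiftDvd S d m then
        (ArithmeticFunction.moebius d : ℝ) * F (Real.log d / Real.log R) else 0) + h d := by
    intro d hd
    rw [Finset.mem_Icc] at hd
    have hdl : Nat.Coprime d l := by
      rw [Nat.coprime_comm, hl.coprime_iff_not_dvd]
      intro hld
      have h1 : l ≤ ⌊R⌋₊ := (Nat.le_of_dvd hd.1 hld).trans hd.2
      have := (Nat.le_floor_iff (by linarith)).1 h1
      linarith
    by_cases hsq : Squarefree d
    swap
    · rw [hh]
      simp [ArithmeticFunction.moebius_eq_zero_of_not_squarefree hsq]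
    by_cases hpd : p ∣ d
    · obtain ⟨e, rfl⟩ := hpd
      have hpe : Nat.Coprime p e := (Nat.squarefree_mul_iff.1 hsq).1
      have n1 : ¬ ShiftDvd S (p * e) m := fun hd' =>
        hS.not_shiftDvd hp h3 hpm (shiftDvd_of_dvd (Dvd.intro _ rfl) hd')
      have n2 : ShiftDvd (insert 0 S) (p * e) m ↔ ShiftDvd S e m := by
        have hle : IsCoprime (e : ℤ) (l : ℤ) :=
          Nat.isCoprime_iff_coprime.2 (hdl.coprime_dvd_left (Dvd.intro_left p rfl))
        rw [shiftDvd_insert_zero h0, hm]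
        push_cast
        rw [mul_assoc, mul_dvd_mul_iff_left (by exact_mod_cast hp.ne_zero)]
        unfold ShiftDvd
        push_cast
        exact ⟨fun hd' => hle.dvd_of_dvd_mul_left hd', fun hd' => hd'.mul_left _⟩
      rw [hh]
      simp only [n1, n2, Nat.mul_div_cancel_left _ hp.pos, and_false, if_false,
        zero_add, dvd_mul_right, true_and]
    · have hdm : Nat.Coprime d m :=
        Nat.Coprime.mul_right ((hp.coprime_iff_not_dvd.2 hpd).symm) hdl
      rw [hh]
      simp only [shiftDvd_insert_zero_of_coprime h0 hdm, hpd, false_and, if_false, add_zero]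
  have hsum : ∑ d ∈ Finset.Icc 1 ⌊R⌋₊, h d
      = ∑ d ∈ (Finset.Icc 1 ⌊R⌋₊).image (fun e => p * e), h d := by
    refine Finset.sum_congr_of_eq_on_inter ?_ ?_ fun _ _ _ => rfl
    · intro d hd hd'
      rw [hh]
      refine if_neg fun hc => hd' ?_
      obtain ⟨e, rfl⟩ := hc.1
      rw [Finset.mem_Icc] at hd
      refine Finset.mem_image.2 ⟨e, Finset.mem_Icc.2 ⟨?_, ?_⟩, rfl⟩
      · exact Nat.pos_of_mul_pos_left hd.1
      · exact (Nat.le_mul_of_pos_left e hp.pos).trans hd.2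
    · intro d hd hd'
      obtain ⟨e, he, rfl⟩ := Finset.mem_image.1 hd
      rw [Finset.mem_Icc] at he
      have h1 : R < ((p * e : ℕ) : ℝ) := by
        by_contra! hle
        refine hd' (Finset.mem_Icc.2 ⟨Nat.mul_pos hp.pos he.1, Nat.le_floor hle⟩)
      rw [hh]
      simp only [support_of_vanish hF hR h1, mul_zero, ite_self]
  rw [Finset.sum_image (fun a _ b _ hab => Nat.eq_of_mul_eq_mul_left hp.pos hab)] at hsum
  unfold sieveSum
  rw [Finset.sum_congr rfl key, Finset.sum_add_distrib, hsum, sub_eq_add_neg,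
    ← Finset.sum_neg_distrib]
  congr 1
  refine Finset.sum_congr rfl fun e he => ?_
  rw [Finset.mem_Icc] at he
  rw [hh]
  simp only [Nat.mul_div_cancel_left _ hp.pos, dvd_mul_right, true_and]
  have hc6 : Nat.Coprime (p * e) 6 ↔ Nat.Coprime e 6 :=
    ⟨fun hc => hc.coprime_dvd_left (Dvd.intro_left p rfl), fun hc => Nat.Coprime.mul_left hp6 hc⟩
  simp only [hc6]
  split_ifs with hc
  · have hpe : ¬ p ∣ e := fun hd => hS.not_shiftDvd hp h3 hpm (shiftDvd_of_dvd hd hc.2)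
    rw [ArithmeticFunction.isMultiplicative_moebius.map_mul_of_coprime
      (hp.coprime_iff_not_dvd.2 hpe), ArithmeticFunction.moebius_apply_prime hp]
    have h2 : Real.log ((p * e : ℕ) : ℝ) / Real.log R
        = Real.log e / Real.log R + Real.log p / Real.log R := by
      push_cast
      rw [Real.log_mul (by exact_mod_cast hp.ne_zero) (by exact_mod_cast (by omega : e ≠ 0)),
        add_div, add_comm]
    rw [h2]
    push_cast
    ring
  · rw [neg_zero]

/-- The shift `F(· + log p / log R)` attached to the prime `p`. -/
def primeShift (F : ℝ → ℝ) (R : ℝ) (p : ℕ) (t : ℝ) : ℝ := F (t + Real.log p / Real.log R)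

/-- The contribution of the prime factor `p ≤ R` of the weighted shift. -/
def crossTerm (F : ℝ → ℝ) (R : ℝ) (S : Finset ℤ) (p m : ℕ) : ℝ :=
  -2 * (sieveSum 6 F R S m * sieveSum 6 (primeShift F R p) R S m)
    + sieveSum 6 (primeShift F R p) R S m * sieveSum 6 (primeShift F R p) R S m

/-- As `m > R²`, a factorisation `m = p l` has at most one factor `≤ R`. If there is one, `(A - B)²
= A² - 2AB + B²` produces the cross term, and nonsquareness gives `ϖ * ϖ (m) = 2 log p log l`. If
both primes exceed `R`, the shift `0` does not affect the weight. -/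
theorem varpi2_mul_sieveSum_sq {S : Finset ℤ} (hS : Admissible S) (h0 : (0 : ℤ) ∉ S) {F : ℝ → ℝ}
    (hF : ∀ t, 1 ≤ t → F t = 0) {R : ℝ} (hR : 1 < R) {m : ℕ} (hm : R * R < m)
    (h6 : Nat.Coprime m 6) (hsq : ∀ k, m ≠ k * k) :
    varpi2 m * sieveSum 6 F R (insert 0 S) m ^ 2 = varpi2 m * sieveSum 6 F R S m ^ 2
      + ∑ p ∈ (primesTo R).filter (fun p => p ∣ m),
        2 * Real.log p * (varpi (m / p) * crossTerm F R S p m) := by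
  by_cases hex : ∃ p ∈ primesTo R, p ∣ m ∧ (m / p).Prime
  · obtain ⟨p, hpR, ⟨l, rfl⟩, hl⟩ := hex
    rw [mem_primesTo (by linarith)] at hpR
    obtain ⟨hp, hpR⟩ := hpR
    rw [Nat.mul_div_cancel_left _ hp.pos] at hl
    have hlR : R < l := by
      by_contra! h
      push_cast at hm
      have hp0 : (0 : ℝ) ≤ p := Nat.cast_nonneg p
      nlinarith
    have hpl : p ≠ l := fun h => hsq p (by rw [← h])
    have h3 := three_lt_of_coprime_six h6 hp (Dvd.intro _ rfl)
    have hfil : (primesTo R).filter (fun q => q ∣ p * l) = {p} := by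
      ext q
      rw [Finset.mem_filter, mem_primesTo (by linarith), Finset.mem_singleton]
      constructor
      · rintro ⟨⟨hq, hqR⟩, hd⟩
        rcases (Nat.Prime.dvd_mul hq).1 hd with h | h
        · exact (Nat.prime_dvd_prime_iff_eq hq hp).1 h
        · rw [(Nat.prime_dvd_prime_iff_eq hq hl).1 h] at hqR
          linarith
      · rintro rfl
        exact ⟨⟨hp, hpR⟩, Dvd.intro _ rfl⟩
    rw [hfil, Finset.sum_singleton, Nat.mul_div_cancel_left _ hp.pos, varpi2_prime_mul hp hl hpl,
      sieveSum_insert_zero hS h0 hF hR hp h3 hl hlR, varpi, if_pos hl, crossTerm]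
    unfold primeShift
    ring
  · rw [Finset.sum_eq_zero, add_zero]
    · by_cases h : varpi2 m = 0
      · rw [h, zero_mul, zero_mul]
      · obtain ⟨p, l, hp, hl, rfl⟩ := exists_of_varpi2_ne_zero h
        have hpR : R < p := by
          by_contra! h
          exact hex ⟨p, (mem_primesTo (by linarith)).2 ⟨hp, h⟩, Dvd.intro _ rfl, by
            rwa [Nat.mul_div_cancel_left _ hp.pos]⟩
        have hlR : R < l := by
          by_contra! h
          exact hex ⟨l, (mem_primesTo (by linarith)).2 ⟨hl, h⟩, Dvd.intro_left _ rfl, by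
            rwa [Nat.mul_div_cancel _ hl.pos]⟩
        have hcop : ∀ {q : ℕ}, q.Prime → R < q → ∀ d ∈ Finset.Icc 1 ⌊R⌋₊, Nat.Coprime d q := by
          intro q hq hqR d hd
          rw [Finset.mem_Icc] at hd
          rw [Nat.coprime_comm, hq.coprime_iff_not_dvd]
          intro hqd
          have := (Nat.le_floor_iff (by linarith)).1 ((Nat.le_of_dvd hd.1 hqd).trans hd.2)
          linarith
        rw [sieveSum_insert_zero_of_coprime h0 6 F fun d hd =>
          Nat.Coprime.mul_right (hcop hp hpR d hd) (hcop hl hlR d hd)]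
    · intro p hp
      rw [Finset.mem_filter] at hp
      have : ¬ (m / p).Prime := fun h => hex ⟨p, hp.1, hp.2, h⟩
      rw [varpi, if_neg this, zero_mul, mul_zero]

/-- The sum of the squared weights against `ϖ * ϖ` at the shift `0`. -/
def pairSum (F : ℝ → ℝ) (S : Finset ℤ) (c : ℕ) (R N : ℝ) : ℝ :=
  ∑ m ∈ (Finset.Ioc ⌊N⌋₊ ⌊2 * N⌋₊).filter (fun m => m % 12 = c),
    varpi2 m * sieveSum 6 F R S m ^ 2

/-- The contribution to `pairSum` of the prime factor `p ≤ R`. -/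
def crossSum (F : ℝ → ℝ) (S : Finset ℤ) (c : ℕ) (R N : ℝ) (p : ℕ) : ℝ :=
  ∑ n ∈ (Finset.Ioc ⌊N / p⌋₊ ⌊2 * (N / p)⌋₊).filter (fun n => (p * n) % 12 = c),
    varpi n * crossTerm F R S p (p * n)

theorem coprime_six_of_mod {c m : ℕ} (hc : Nat.Coprime c 12) (hm : m % 12 = c) :
    Nat.Coprime m 6 := by
  have h : m ≡ c [MOD 12] := by rw [← hm]; exact (Nat.mod_modEq m 12).symm
  exact Nat.Coprime.coprime_dvd_right (by norm_num) ((Nat.ModEq.gcd_eq h).trans hc)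

theorem pairSum_insert_zero {S : Finset ℤ} (hS : Admissible S) (h0 : (0 : ℤ) ∉ S) {F : ℝ → ℝ}
    (hF : ∀ t, 1 ≤ t → F t = 0) {R N : ℝ} (hR : 1 < R) (hRN : R * R ≤ N) {c : ℕ}
    (hc : Nat.Coprime c 12) (hsq : ∀ k, (k * k) % 12 ≠ c) :
    pairSum F (insert 0 S) c R N = pairSum F S c R N
      + ∑ p ∈ primesTo R, 2 * Real.log p * crossSum F S c R N p := by
  have hN : 0 < N := by nlinarith
  unfold pairSum
  rw [Finset.sum_congr rfl (g := fun m => varpi2 m * sieveSum 6 F R S m ^ 2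
      + ∑ p ∈ (primesTo R).filter (fun p => p ∣ m),
        2 * Real.log p * (varpi (m / p) * crossTerm F R S p m)), Finset.sum_add_distrib]
  swap
  · intro m hm
    rw [Finset.mem_filter, Finset.mem_Ioc] at hm
    refine varpi2_mul_sieveSum_sq hS h0 hF hR (hRN.trans_lt ?_) (coprime_six_of_mod hc hm.2)
      fun k hk => hsq k (hk ▸ hm.2)
    exact (Nat.floor_lt hN.le).1 hm.1.1
  congr 1
  rw [Finset.sum_comm' (s' := fun p => ((Finset.Ioc ⌊N⌋₊ ⌊2 * N⌋₊).filter
    (fun m => m % 12 = c)).filter fun m => p ∣ m) (t' := primesTo R)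
    (by intro m p; simp only [Finset.mem_filter]; tauto)]
  refine Finset.sum_congr rfl fun p hp => ?_
  have hp' := ((mem_primesTo (by linarith)).1 hp).1
  have hp0 : (0 : ℝ) < p := by exact_mod_cast hp'.pos
  rw [crossSum, ← Finset.mul_sum]
  congr 1
  have e : ((Finset.Ioc ⌊N⌋₊ ⌊2 * N⌋₊).filter (fun m => m % 12 = c)).filter (fun m => p ∣ m)
      = ((Finset.Ioc ⌊N / p⌋₊ ⌊2 * (N / p)⌋₊).filter (fun n => (p * n) % 12 = c)).image
        (fun n => p * n) := by
    ext m
    simp only [Finset.mem_filter, Finset.mem_Ioc, Finset.mem_image]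
    -- Writing `m = p n` rescales the dyadic interval at `N` to the one at `N / p`.
    have key : ∀ n : ℕ, (⌊N⌋₊ < p * n ∧ p * n ≤ ⌊2 * N⌋₊)
        ↔ (⌊N / p⌋₊ < n ∧ n ≤ ⌊2 * (N / p)⌋₊) := by
      intro n
      rw [Nat.floor_lt hN.le, Nat.floor_lt (by positivity), Nat.le_floor_iff (by positivity),
        Nat.le_floor_iff (by positivity), div_lt_iff₀ hp0, mul_div_assoc', le_div_iff₀ hp0]
      push_cast
      rw [mul_comm (p : ℝ)]
    constructor
    · rintro ⟨⟨h1, h2⟩, n, rfl⟩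
      exact ⟨n, ⟨(key n).1 h1, h2⟩, rfl⟩
    · rintro ⟨n, ⟨h1, h2⟩, rfl⟩
      exact ⟨⟨(key n).2 h1, h2⟩, Dvd.intro _ rfl⟩
  rw [e, Finset.sum_image fun a _ b _ hab => Nat.eq_of_mul_eq_mul_left hp'.pos hab]
  refine Finset.sum_congr rfl fun n _ => ?_
  rw [Nat.mul_div_cancel_left _ hp'.pos]

end GapsE2
end

noncomputable section

open Filter Asymptotics Topology

namespace GapsE2

/-! ### The sieve weights coprime to the weighted shift -/

theorem lcmForm_congr {V W : ℕ → ℝ} {F H : ℝ → ℝ} {R : ℝ}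
    (h : ∀ q : ℕ, q ≠ 0 → (∀ p : ℕ, p.Prime → p ∣ q → p ≤ ⌊R⌋₊) → V q = W q) :
    lcmForm V F H R = lcmForm W F H R := by
  unfold lcmForm
  refine Finset.sum_congr rfl fun d hd => Finset.sum_congr rfl fun d' hd' => ?_
  rw [Finset.mem_Icc] at hd hd'
  rw [h _ (Nat.lcm_pos hd.1 hd'.1).ne' fun p hp hpd => ?_]
  rcases (hp.dvd_lcm).1 hpd with h | h
  · exact (Nat.le_of_dvd hd.1 h).trans hd.2
  · exact (Nat.le_of_dvd hd'.1 h).trans hd'.2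

theorem siftWeight_removePrime (g : ℕ → ℝ) (p : ℕ) (q : ℕ) :
    siftWeight (removePrime g p) q = if p ∈ q.primeFactors then 0 else siftWeight g q := by
  split_ifs with h
  · exact Finset.prod_eq_zero h (by rw [removePrime, Function.update_self])
  · refine Finset.prod_congr rfl fun l hl => ?_
    rw [removePrime, Function.update_of_ne]
    rintro rfl
    exact h hl

/-- The part of the form in which `p` divides the least common multiple is the whole form minus the
form whose density is zero at `p`. -/
theorem lcmForm_sum_primeFactors (g : ℕ → ℝ) (F H : ℝ → ℝ) (R : ℝ) (a : ℕ → ℝ) :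
    lcmForm (fun q => ∑ p ∈ q.primeFactors, a p * siftWeight g q) F H R
      = ∑ p ∈ primesTo R, a p * (quadForm g F H R - quadForm (removePrime g p) F H R) := by
  simp only [quadForm_eq_lcmForm, ← lcmForm_sub, ← lcmForm_const_mul]
  rw [← lcmForm_sum]
  refine lcmForm_congr fun q hq hp => ?_
  simp only [siftWeight_removePrime]
  rw [← Finset.sum_subset (s₁ := q.primeFactors) (s₂ := primesTo R)]
  · exact Finset.sum_congr rfl fun p hp => by rw [if_pos hp, sub_zero]
  · intro p hpq
    have h1 := Nat.prime_of_mem_primeFactors hpq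
    exact Finset.mem_filter.2 ⟨Finset.mem_Icc.2 ⟨h1.one_le,
      hp p h1 (Nat.dvd_of_mem_primeFactors hpq)⟩, h1⟩
  · intro p _ hpq
    rw [if_neg hpq, sub_self, mul_zero]

theorem abs_pairDensity_le {p : ℕ} (hp : 2 ≤ p) : |pairDensity p| ≤ 2 / ((p : ℝ) - 1) := by
  have h : (2 : ℝ) ≤ p := by exact_mod_cast hp
  have h1 : (0 : ℝ) < p - 1 := by linarith
  rw [pairDensity]
  split_ifs
  · rw [abs_zero]; positivity
  · rw [abs_of_pos (by positivity)]

theorem one_le_log_of_three_le {N : ℝ} (hN : 3 ≤ N) : 1 ≤ Real.log N := by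
  rw [Real.le_log_iff_exp_le (by linarith)]
  exact (Real.exp_one_lt_d9.le.trans (by norm_num)).trans hN

theorem HypBV.level {θ τ : ℝ} (h : HypBV θ) (hτ : τ < θ) {A : ℝ} (hA : 0 < A) :
    (fun N : ℝ => ∑ q ∈ Finset.Icc 1 ⌊N ^ τ⌋₊, errStar N q)
      =O[atTop] (fun N : ℝ => N * Real.log N ^ (-A)) := by
  simpa using h A hA (θ - τ) (by linarith)

theorem HypBV2.level {θ τ : ℝ} (h : HypBV2 θ) (hτ : τ < θ) {A : ℝ} (hA : 0 < A) :
    (fun N : ℝ => ∑ q ∈ Finset.Icc 1 ⌊N ^ τ⌋₊, err2Star N q)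
      =O[atTop] (fun N : ℝ => N * Real.log N ^ (-A)) := by
  simpa using h A hA (θ - τ) (by linarith)

theorem eventually_twelve_mul_rpow_le {η τ : ℝ} (h : η < τ) :
    ∀ᶠ N : ℝ in atTop, 12 * N ^ η ≤ N ^ τ := by
  filter_upwards [(tendsto_rpow_atTop (sub_pos.2 h)).eventually_ge_atTop 12,
    eventually_gt_atTop (0 : ℝ)] with N hN hN0
  calc 12 * N ^ η ≤ N ^ (τ - η) * N ^ η := by gcongr
    _ = N ^ τ := by rw [← Real.rpow_add hN0]; congr 1; ring

theorem three_pow_mul_two_pow (k : ℕ) (x : ℝ) : 3 ^ k * (2 ^ k * x) = 6 ^ k * x := by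
  rw [← mul_assoc, ← mul_pow]
  norm_num

theorem log_pow_mul_rpow_neg {N : ℝ} (hN : 1 < N) (j k : ℕ) :
    Real.log N ^ j * Real.log N ^ (-((j + k : ℕ) : ℝ)) = (Real.log N ^ k)⁻¹ := by
  have h := Real.log_pos hN
  rw [Real.rpow_neg h.le, Real.rpow_natCast, pow_add]
  field_simp

theorem tendsto_inv_log : Tendsto (fun N : ℝ => (Real.log N)⁻¹) atTop (𝓝 0) :=
  tendsto_inv_atTop_zero.comp Real.tendsto_log_atTop

/-- The factor `log N = (2/η) log R` supplies the logarithm missing for dimension `2`. The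
correction over primes dividing the modulus is of lower order: removing `p` changes the form by
`O((log R)⁻² /(p-1))`, and `∑ log p / (p(p-1))` converges. -/
theorem tendsto_pairSum {θ : ℝ} (hθ : θ ≤ 1) (hBV2 : HypBV2 θ) {F : ℝ → ℝ}
    (hFs : ContDiff ℝ (⊤ : ℕ∞) F) (hFc : HasCompactSupport F) (hF : ∀ t, 1 ≤ t → F t = 0)
    {η : ℝ} (h0 : 0 < η) (h1 : η < θ) {S : Finset ℤ} (hS : Admissible S) (hS2 : S.card = 2)
    {c : ℕ} (hc12 : c < 12) (hc : Nat.Coprime c 12) :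
    Tendsto (fun N => Real.log (N ^ (η / 2)) / N * pairSum F S c (N ^ (η / 2)) N) atTop
      (𝓝 ((singularSeries 2 pairDensity).re * sieveForm 2 F 0 0 / (2 * η))) := by
  obtain ⟨CF, hCF, hb⟩ := exists_bound hFs hFc
  have hR : Tendsto (fun N : ℝ => N ^ (η / 2)) atTop atTop := tendsto_rpow_atTop (by linarith)
  have hQ := (tendsto_quadForm (by norm_num) summable_pairDensity hFs hFc hF).comp hR
  obtain ⟨D, hD, hrem⟩ := exists_quadForm_removePrime_le 2 summable_pairDensity hFs hFc hF
  set τ := (η + θ) / 2 with hτ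
  obtain ⟨C, hC, hbv⟩ := exists_weighted_bound err2Star_nonneg
    (by positivity : (0 : ℝ) ≤ 15 + |C₀|) (fun N hN r hr hrN => err2Star_le hN hr hrN)
    (show τ ≤ 1 by linarith) (fun A hA => hBV2.level (show τ < θ by linarith) hA)
    -- One logarithm pays for the normalisation `log R / N`; the other makes the error tend to zero.
    (A := ((1 + 1 : ℕ) : ℝ)) (by norm_num)
  set κ := C₀ - Real.log 2 - 2 / 3 * Real.log 3 with hκ
  set P : ℝ → ℝ := fun R => ∑ p ∈ primesTo R, Real.log p / p *
    (quadForm pairDensity F F R - quadForm (removePrime pairDensity p) F F R) with hP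
  have hP0 : Tendsto (fun R => Real.log R * P R) atTop (𝓝 0) := by
    have hlim : Tendsto (fun R : ℝ => 2 * D * primeLogConst * (Real.log R)⁻¹) atTop (𝓝 0) := by
      simpa using tendsto_inv_log.const_mul (2 * D * primeLogConst)
    refine squeeze_zero_norm' ?_ hlim
    filter_upwards [hrem, eventually_gt_atTop (1 : ℝ)] with R hr hR1
    have hl := Real.log_pos hR1
    have hterm : ∀ p ∈ primesTo R, |Real.log R ^ 2 * (Real.log p / p *
        (quadForm pairDensity F F R - quadForm (removePrime pairDensity p) F F R))|
        ≤ 2 * D * (Real.log p / ((p : ℝ) * (p - 1))) := by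
      intro p hp
      have hp' := ((mem_primesTo (by linarith)).1 hp).1
      have hp2 : (2 : ℝ) ≤ p := by exact_mod_cast hp'.two_le
      have hlp : 0 ≤ Real.log p / p := div_nonneg (Real.log_natCast_nonneg p) (by linarith)
      have h := hr ⟨p, hp'⟩ 0 0 le_rfl le_rfl
      simp only [add_zero] at h
      have h2 := h.trans (mul_le_mul_of_nonneg_left (abs_pairDensity_le hp'.two_le) hD)
      rw [mul_left_comm, abs_mul, abs_of_nonneg hlp]
      refine (mul_le_mul_of_nonneg_left h2 hlp).trans (le_of_eq ?_)
      have : (p : ℝ) - 1 ≠ 0 := by linarith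
      have : (p : ℝ) ≠ 0 := by linarith
      field_simp
    have hsum : |Real.log R ^ 2 * P R| ≤ 2 * D * primeLogConst := by
      rw [hP]
      simp only [Finset.mul_sum]
      refine (Finset.abs_sum_le_sum_abs _ _).trans ((Finset.sum_le_sum hterm).trans ?_)
      rw [← Finset.mul_sum]
      exact mul_le_mul_of_nonneg_left (sum_log_div_mul_sub_one_le R) (by positivity)
    have e : Real.log R * P R = (Real.log R ^ 2 * P R) * (Real.log R)⁻¹ := by
      field_simp
    rw [e, norm_mul, Real.norm_eq_abs, Real.norm_of_nonneg (by positivity)]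
    exact mul_le_mul_of_nonneg_right hsum (by positivity)
  have hmain : Tendsto (fun N => Real.log (N ^ (η / 2)) / N * (N / 4 * (
      quadForm pairDensity F F (N ^ (η / 2)) * (Real.log N + κ) - 2 * P (N ^ (η / 2))))) atTop
      (𝓝 ((singularSeries 2 pairDensity).re * sieveForm 2 F 0 0 / (2 * η))) := by
    have h2 : Tendsto (fun N : ℝ => 2 / η + κ * (Real.log (N ^ (η / 2)))⁻¹) atTop
        (𝓝 (2 / η + κ * 0)) :=
      tendsto_const_nhds.add ((tendsto_inv_log.comp hR).const_mul κ)
    have h3 := ((hQ.mul h2).sub ((hP0.comp hR).const_mul 2)).const_mul (1 / 4)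
    refine (h3.congr' ?_).trans (le_of_eq ?_)
    · filter_upwards [eventually_gt_atTop (1 : ℝ)] with N hN
      have hN0 : N ≠ 0 := by linarith
      have hl := Real.log_pos hN
      simp only [Function.comp_apply]
      rw [log_rpow_half (by linarith)]
      field_simp
    · congr 1
      field_simp
      ring
  have herr : Tendsto (fun N => Real.log (N ^ (η / 2)) / N * pairSum F S c (N ^ (η / 2)) N
      - Real.log (N ^ (η / 2)) / N * (N / 4 * (
      quadForm pairDensity F F (N ^ (η / 2)) * (Real.log N + κ) - 2 * P (N ^ (η / 2)))))
      atTop (𝓝 0) := by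
    have hlim := tendsto_inv_log.const_mul (CF * CF * C)
    rw [mul_zero] at hlim
    refine squeeze_zero_norm' ?_ hlim
    filter_upwards [eventually_ge_atTop (3 : ℝ), hR.eventually_gt_atTop 1, hbv,
      eventually_twelve_mul_rpow_le (show η < τ by linarith)] with N hN hR1 hbvN h12
    have hN0 : 0 < N := by linarith
    set R := N ^ (η / 2) with hRdef
    have hlogR : Real.log R = η / 2 * Real.log N := log_rpow_half hN0 η
    have hL := one_le_log_of_three_le hN
    have hRR : R * R = N ^ η := rpow_half_mul_self hN0 η
    have h := abs_sum_mul_sieveSum_sub_le (M := 6) (T := R) hb hb (by linarith : 0 ≤ R)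
      (fun d _ hd => support_of_vanish hF hR1 hd) S
      ((Finset.Ioc ⌊N⌋₊ ⌊2 * N⌋₊).filter (fun n => n % 12 = c)) varpi2 id
      (V := fun q => N / 4 * (siftWeight pairDensity q * (Real.log N + κ)
        - 2 * ∑ p ∈ q.primeFactors, Real.log p / p * siftWeight pairDensity q))
      (B := fun q => 2 ^ q.primeFactors.card * err2Star N (12 * q))
      (fun q hq hc => by
        rw [siftWeight_eq_zero (fun p hp h => pairDensity_eq_zero hp h) hq.ne' hc]
        simp)
      (fun q hq => by
        rw [Finset.filter_filter]
        rw [moduli, Finset.mem_filter] at hq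
        exact abs_sum_varpi2_sub_le hS hS2 hc12 hc hq.2.1 hq.2.2 (by linarith))
    have eV : lcmForm (fun q => N / 4 * (siftWeight pairDensity q * (Real.log N + κ)
        - 2 * ∑ p ∈ q.primeFactors, Real.log p / p * siftWeight pairDensity q)) F F R
        = N / 4 * (quadForm pairDensity F F R * (Real.log N + κ) - 2 * P R) := by
      rw [lcmForm_const_mul, lcmForm_sub, lcmForm_const_mul, lcmForm_sum_primeFactors]
      simp only [mul_comm (siftWeight pairDensity _)]
      rw [lcmForm_const_mul, ← quadForm_eq_lcmForm, mul_comm (Real.log N + κ)]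
    rw [eV] at h
    have hw : ∑ n ∈ (Finset.Ioc ⌊N⌋₊ ⌊2 * N⌋₊).filter (fun n => n % 12 = c),
        varpi2 n * (sieveSum 6 F R S (id n) * sieveSum 6 F R S (id n)) = pairSum F S c R N := by
      refine Finset.sum_congr rfl fun n _ => ?_
      rw [← sq]; rfl
    rw [hw] at h
    simp only [three_pow_mul_two_pow] at h
    have hfin := h.trans (mul_le_mul_of_nonneg_left (hbvN (R * R) (by rw [hRR]; exact h12))
      (by positivity : 0 ≤ CF * CF))
    rw [← mul_sub, Real.norm_eq_abs, abs_mul,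
      abs_of_nonneg (div_nonneg (Real.log_nonneg hR1.le) hN0.le)]
    have hRL : Real.log R ≤ Real.log N := by rw [hlogR]; nlinarith
    calc _ ≤ Real.log N / N * (CF * CF * (C * (N * Real.log N ^ (-((1 + 1 : ℕ) : ℝ))))) := by
          gcongr
      _ = CF * CF * C * (Real.log N ^ 1 * Real.log N ^ (-((1 + 1 : ℕ) : ℝ))) := by
          field_simp
      _ = _ := by rw [log_pow_mul_rpow_neg (by linarith), pow_one]
  have := herr.add hmain
  simpa using this

end GapsE2
end

noncomputable section

open Filter Asymptotics Topology

namespace GapsE2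

/-! ### The sieve weights sharing a prime with the weighted shift -/

theorem iteratedDeriv_eq_zero_of_vanish {F : ℝ → ℝ} (hF : ∀ t, 1 ≤ t → F t = 0) (k : ℕ) {t : ℝ}
    (ht : 1 < t) : iteratedDeriv k F t = 0 := by
  have h : F =ᶠ[𝓝 t] fun _ => 0 := by
    filter_upwards [lt_mem_nhds ht] with x hx using hF x hx.le
  rw [h.iteratedDeriv_eq]
  simp

theorem sieveForm_eq_setIntegral {F : ℝ → ℝ} (hF : ∀ t, 1 ≤ t → F t = 0) (k : ℕ) {u v : ℝ}
    (hu : 0 ≤ u) : sieveForm k F u v = ∫ t in Set.Icc (0 : ℝ) 1,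
      iteratedDeriv k F (t + u) * iteratedDeriv k F (t + v) * (t ^ (k - 1) / (k - 1).factorial) := by
  rw [MeasureTheory.integral_Icc_eq_integral_Ioc, sieveForm]
  refine MeasureTheory.setIntegral_eq_of_subset_of_forall_sdiff_eq_zero measurableSet_Ioi
    Set.Ioc_subset_Ioi_self ?_
  rintro t ⟨h0, h1⟩
  have ht : 1 < t := by
    by_contra! h
    exact h1 ⟨h0, h⟩
  rw [iteratedDeriv_eq_zero_of_vanish hF k (by linarith : 1 < t + u)]
  ring

/-- The density of the contribution of the primes `R ^ u`. -/
def crossDensity (F : ℝ → ℝ) (u : ℝ) : ℝ := -2 * sieveForm 2 F 0 u + sieveForm 2 F u u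

theorem continuousOn_crossDensity {F : ℝ → ℝ} (hFs : ContDiff ℝ (⊤ : ℕ∞) F)
    (hF : ∀ t, 1 ≤ t → F t = 0) : ContinuousOn (crossDensity F) (Set.Icc 0 1) := by
  have hc : Continuous (iteratedDeriv 2 F) := hFs.continuous_iteratedDeriv 2 (by norm_cast)
  have h1 : Continuous fun u : ℝ => ∫ t in Set.Icc (0 : ℝ) 1,
      iteratedDeriv 2 F (t + 0) * iteratedDeriv 2 F (t + u)
        * (t ^ (2 - 1) / ((2 - 1).factorial : ℝ)) :=
    continuous_parametric_integral_of_continuous (by fun_prop) isCompact_Icc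
  have h2 : Continuous fun u : ℝ => ∫ t in Set.Icc (0 : ℝ) 1,
      iteratedDeriv 2 F (t + u) * iteratedDeriv 2 F (t + u)
        * (t ^ (2 - 1) / ((2 - 1).factorial : ℝ)) :=
    continuous_parametric_integral_of_continuous (by fun_prop) isCompact_Icc
  refine ((h1.const_mul (-2)).add h2).continuousOn.congr fun u hu => ?_
  rw [crossDensity, sieveForm_eq_setIntegral hF 2 le_rfl, sieveForm_eq_setIntegral hF 2 hu.1]
  rfl

theorem crossSum_eq_zero_of_le_three {F : ℝ → ℝ} {S : Finset ℤ} {c : ℕ} (hc : Nat.Coprime c 12)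
    (R N : ℝ) {p : ℕ} (hp : p.Prime) (h3 : p ≤ 3) : crossSum F S c R N p = 0 := by
  refine Finset.sum_eq_zero fun n hn => ?_
  have h6 := coprime_six_of_mod hc (Finset.mem_filter.1 hn).2
  have := three_lt_of_coprime_six h6 hp (Dvd.intro _ rfl)
  omega

theorem moduli_anti (y : ℝ) {M M' : ℕ} (h : M ∣ M') : moduli y M' ⊆ moduli y M := fun q hq => by
  rw [moduli, Finset.mem_filter] at hq ⊢
  exact ⟨hq.1, hq.2.1, hq.2.2.coprime_dvd_right h⟩

/-- With `m = p n`, only moduli coprime to `p` occur, so the density is the pair density with `p`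
removed. -/
theorem abs_bilinear_sub_quadForm_le {S : Finset ℤ} (hS : Admissible S) (hS2 : S.card = 2)
    {c : ℕ} (hc12 : c < 12) (hc : Nat.Coprime c 12) {F H : ℝ → ℝ} {R T CF : ℝ}
    (hF : ∀ t, |F t| ≤ CF) (hH : ∀ t, |H t| ≤ CF) (hR : 0 ≤ R)
    (hHT : ∀ d : ℕ, 0 < d → T < d → H (Real.log d / Real.log R) = 0) {p : ℕ} (hp : p.Prime)
    (h3 : 3 < p) {x : ℝ} (hx : 1 ≤ x) :
    |∑ n ∈ (Finset.Ioc ⌊x⌋₊ ⌊2 * x⌋₊).filter (fun n => (p * n) % 12 = c),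
        varpi n * (sieveSum 6 F R S (p * n) * sieveSum 6 H R S (p * n))
      - x / 4 * quadForm (removePrime pairDensity p) F H R|
      ≤ CF * CF * ∑ q ∈ moduli (R * T) 6, 6 ^ q.primeFactors.card * errStar x (12 * q) := by
  have hCF : 0 ≤ CF := (abs_nonneg _).trans (hF 0)
  have h := abs_sum_mul_sieveSum_sub_le (M := 6 * p) hF hH hR hHT S
    ((Finset.Ioc ⌊x⌋₊ ⌊2 * x⌋₊).filter (fun n => (p * n) % 12 = c)) varpi (fun n => p * n)
    (V := fun q => x / 4 * siftWeight (removePrime pairDensity p) q)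
    (B := fun q => 2 ^ q.primeFactors.card * errStar x (12 * q))
    (fun q hq hcq => by
      rw [siftWeight_eq_zero (M := 6 * p) (fun l hl hd => ?_) hq.ne' hcq, mul_zero]
      by_cases hlp : l = p
      · rw [hlp, removePrime, Function.update_self]
      · rw [removePrime, Function.update_of_ne hlp]
        refine pairDensity_eq_zero hl ((hl.dvd_mul.1 hd).resolve_right fun h => hlp ?_)
        exact (Nat.prime_dvd_prime_iff_eq hl hp).1 h)
    (fun q hq => by
      rw [moduli, Finset.mem_filter, Nat.coprime_mul_iff_right] at hq
      obtain ⟨-, hsq, h6, hqp⟩ := hq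
      have hpq : ¬ p ∣ q := (hp.coprime_iff_not_dvd).1 hqp.symm
      rw [Finset.filter_filter, siftWeight_removePrime, if_neg fun h =>
        hpq (Nat.dvd_of_mem_primeFactors h)]
      refine abs_sum_varpi_sub_le hS hS2 hc12 hc hsq h6 ?_ hx
      refine Nat.Coprime.mul_right ?_ hqp.symm
      rw [hp.coprime_iff_not_dvd]
      exact fun hd => not_dvd_of_dvd_twelve hp h3 (dvd_refl (12 : ℤ)) (by exact_mod_cast hd))
  rw [lcmForm_const_mul, ← quadForm_eq_lcmForm] at h
  simp only [three_pow_mul_two_pow] at h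
  have e : ∀ n, sieveSum 6 F R S (p * n) * sieveSum 6 H R S (p * n)
      = sieveSum (6 * p) F R S (p * n) * sieveSum (6 * p) H R S (p * n) := fun n => by
    rw [sieveSum_mul_prime hS hp h3 6 F R (Dvd.intro _ rfl),
      sieveSum_mul_prime hS hp h3 6 H R (Dvd.intro _ rfl)]
  simp only [e]
  refine h.trans (mul_le_mul_of_nonneg_left ?_ (by positivity))
  exact Finset.sum_le_sum_of_subset_of_nonneg (moduli_anti _ (Dvd.intro _ rfl))
    fun q _ _ => mul_nonneg (by positivity) (errStar_nonneg _ _)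

/-- Both products in the cross term contain the shifted weight, which vanishes for `d > R / p`;
hence the moduli reach only `R² / p`. The factor `3` is `|-2| + 1`. -/
theorem abs_crossSum_sub_quadForm_le {S : Finset ℤ} (hS : Admissible S) (hS2 : S.card = 2)
    {c : ℕ} (hc12 : c < 12) (hc : Nat.Coprime c 12) {F : ℝ → ℝ} {R N CF : ℝ}
    (hF : ∀ t, |F t| ≤ CF) (hF1 : ∀ t, 1 ≤ t → F t = 0) (hR : 1 < R) {p : ℕ} (hp : p.Prime)
    (h3 : 3 < p) (hx : 1 ≤ N / p) :
    |crossSum F S c R N p - N / p / 4 * (-2 * quadForm (removePrime pairDensity p) F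
        (primeShift F R p) R + quadForm (removePrime pairDensity p) (primeShift F R p)
        (primeShift F R p) R)|
      ≤ 3 * (CF * CF * ∑ q ∈ moduli (R * (R / p)) 6,
        6 ^ q.primeFactors.card * errStar (N / p) (12 * q)) := by
  have hp0 : (0 : ℝ) < p := by exact_mod_cast hp.pos
  have hHT : ∀ d : ℕ, 0 < d → R / p < d → primeShift F R p (Real.log d / Real.log R) = 0 := by
    intro d hd hlt
    rw [primeShift, ← add_div, ← Real.log_mul (by exact_mod_cast hd.ne') hp0.ne']
    have := support_of_vanish hF1 hR (d := d * p) (by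
      rw [div_lt_iff₀ hp0] at hlt; push_cast; exact hlt)
    rwa [Nat.cast_mul] at this
  have hFp : ∀ t, |primeShift F R p t| ≤ CF := fun t => hF _
  have h1 := abs_bilinear_sub_quadForm_le hS hS2 hc12 hc hF hFp (by linarith) hHT hp h3 hx
  have h2 := abs_bilinear_sub_quadForm_le hS hS2 hc12 hc hFp hFp (by linarith) hHT hp h3 hx
  have e : crossSum F S c R N p = -2 * (∑ n ∈ (Finset.Ioc ⌊N / p⌋₊ ⌊2 * (N / p)⌋₊).filter
      (fun n => (p * n) % 12 = c),
        varpi n * (sieveSum 6 F R S (p * n) * sieveSum 6 (primeShift F R p) R S (p * n)))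
      + ∑ n ∈ (Finset.Ioc ⌊N / p⌋₊ ⌊2 * (N / p)⌋₊).filter (fun n => (p * n) % 12 = c),
        varpi n * (sieveSum 6 (primeShift F R p) R S (p * n)
          * sieveSum 6 (primeShift F R p) R S (p * n)) := by
    rw [crossSum, Finset.mul_sum, ← Finset.sum_add_distrib]
    refine Finset.sum_congr rfl fun n _ => ?_
    rw [crossTerm]
    ring
  rw [e]
  rw [abs_le] at h1 h2 ⊢
  constructor <;> linarith

/-- Putting `p` back into the sieve costs at most `2 D / (p - 1)` per form, and the uniform
asymptotics cost `δ`; the coefficients `-2` and `1` triple both. -/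
theorem abs_mul_crossForm_sub_le {F : ℝ → ℝ} {R δ D : ℝ} {p : ℕ} (hp : p.Prime)
    (hD : 0 ≤ D) (hR : 1 < R)
    (hδ : ∀ u v : ℝ, 0 ≤ u → 0 ≤ v →
      |Real.log R ^ 2 * quadForm pairDensity (fun t => F (t + u)) (fun t => F (t + v)) R
        - (singularSeries 2 pairDensity).re * sieveForm 2 F u v| ≤ δ)
    (hrem : ∀ (p : Nat.Primes) (u v : ℝ), 0 ≤ u → 0 ≤ v →
      |Real.log R ^ 2 * (quadForm pairDensity (fun t => F (t + u)) (fun t => F (t + v)) R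
        - quadForm (removePrime pairDensity p) (fun t => F (t + u)) (fun t => F (t + v)) R)|
        ≤ D * |pairDensity p|) :
    |Real.log R ^ 2 * (-2 * quadForm (removePrime pairDensity p) F (primeShift F R p) R
        + quadForm (removePrime pairDensity p) (primeShift F R p) (primeShift F R p) R)
      - (singularSeries 2 pairDensity).re * crossDensity F (Real.log p / Real.log R)|
      ≤ 3 * δ + 6 * D / ((p : ℝ) - 1) := by
  have hu : 0 ≤ Real.log p / Real.log R :=
    div_nonneg (Real.log_natCast_nonneg p) (Real.log_pos hR).le
  have h1 := hδ 0 _ le_rfl hu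
  have h2 := hδ _ _ hu hu
  have h3 := hrem ⟨p, hp⟩ 0 _ le_rfl hu
  have h4 := hrem ⟨p, hp⟩ _ _ hu hu
  have h5 := mul_le_mul_of_nonneg_left (abs_pairDensity_le hp.two_le) hD
  have h6 : 6 * D / ((p : ℝ) - 1) = 3 * (D * (2 / ((p : ℝ) - 1))) := by ring
  simp only [add_zero] at h1 h3
  rw [crossDensity, h6]
  replace h3 := h3.trans h5
  replace h4 := h4.trans h5
  change |Real.log R ^ 2 * quadForm pairDensity F (primeShift F R p) R - _| ≤ _ at h1
  change |Real.log R ^ 2 * quadForm pairDensity (primeShift F R p) (primeShift F R p) R - _| ≤ _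
    at h2
  change |Real.log R ^ 2 * (quadForm pairDensity F (primeShift F R p) R
    - quadForm (removePrime pairDensity p) F (primeShift F R p) R)| ≤ _ at h3
  change |Real.log R ^ 2 * (quadForm pairDensity (primeShift F R p) (primeShift F R p) R
    - quadForm (removePrime pairDensity p) (primeShift F R p) (primeShift F R p) R)| ≤ _ at h4
  rw [abs_le] at h1 h2 h3 h4 ⊢
  constructor <;> linarith

end GapsE2
end

/-! ### Summation of the cross terms over the primes up to `R`. -/

noncomputable section

open Filter Asymptotics Topology

namespace GapsE2

theorem one_le_two_div_sub_one {p : ℕ} (hp : p.Prime) (h3 : p ≤ 3) : 1 ≤ 2 / ((p : ℝ) - 1) := by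
  have h2 : (2 : ℝ) ≤ p := by exact_mod_cast hp.two_le
  have h3' : (p : ℝ) ≤ 3 := by exact_mod_cast h3
  rw [le_div_iff₀ (by linarith)]
  linarith

/-- The error at `p` has three parts: the uniform sieve error `δ`, a term `K / (p - 1)` that is
summable against `log p / p`, and a term `L / log R` from the distribution of primes. All three must
be uniform in `p ≤ R`. -/
theorem exists_abs_crossSum_sub_le {θ : ℝ} (hθ : θ ≤ 1) (hBV : HypBV θ) {F : ℝ → ℝ}
    (hFs : ContDiff ℝ (⊤ : ℕ∞) F) (hFc : HasCompactSupport F) (hF : ∀ t, 1 ≤ t → F t = 0)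
    {η : ℝ} (h0 : 0 < η) (h1 : η < θ) {S : Finset ℤ} (hS : Admissible S) (hS2 : S.card = 2)
    {c : ℕ} (hc12 : c < 12) (hc : Nat.Coprime c 12) :
    ∃ δ : ℝ → ℝ, ∃ K L : ℝ, 0 ≤ K ∧ 0 ≤ L ∧ Tendsto δ atTop (𝓝 0) ∧ ∀ᶠ N : ℝ in atTop,
      0 ≤ δ (N ^ (η / 2)) ∧ ∀ p ∈ primesTo (N ^ (η / 2)),
      |Real.log (N ^ (η / 2)) / N * (2 * Real.log p * crossSum F S c (N ^ (η / 2)) N p)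
        - 1 / 2 * (singularSeries 2 pairDensity).re * ((Real.log (N ^ (η / 2)))⁻¹
          * (Real.log p / p * crossDensity F (Real.log p / Real.log (N ^ (η / 2)))))|
      ≤ (Real.log (N ^ (η / 2)))⁻¹ * (Real.log p / p
        * (3 * δ (N ^ (η / 2)) + K / ((p : ℝ) - 1) + L * (Real.log (N ^ (η / 2)))⁻¹)) := by
  obtain ⟨CF, hCF, hb⟩ := exists_bound hFs hFc
  have hR : Tendsto (fun N : ℝ => N ^ (η / 2)) atTop atTop := tendsto_rpow_atTop (by linarith)
  obtain ⟨D, hD, hrem⟩ := exists_quadForm_removePrime_le 2 summable_pairDensity hFs hFc hF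
  obtain ⟨δ, hδ, hquad⟩ := exists_quadForm_error two_pos summable_pairDensity hFs hFc hF
  set τ := (η + θ) / 2 with hτ
  obtain ⟨C, hC, hbv⟩ := exists_weighted_bound errStar_nonneg (K := 13)
    (by norm_num) (fun N hN r hr hrN => errStar_le hN hr hrN)
    (show τ ≤ 1 by linarith) (fun A hA => hBV.level (show τ < θ by linarith) hA)
    -- The main term has size `(log R)⁻²` relative to `N / p`; the third logarithm is the saving.
    (A := ((3 : ℕ) : ℝ)) (by norm_num)
  obtain ⟨N₁, hN₁⟩ := eventually_atTop.1 hbv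
  obtain ⟨Mφ, hMφ⟩ := isCompact_Icc.exists_bound_of_continuousOn (continuousOn_crossDensity hFs hF)
  have hMφ0 : 0 ≤ Mφ := (norm_nonneg _).trans (hMφ 0 (by simp))
  set s := (singularSeries 2 pairDensity).re with hs
  refine ⟨δ, 6 * D + 2 * |s| * Mφ, 48 * CF * CF * C, by positivity, by positivity, hδ, ?_⟩
  have hroot : Tendsto (fun N : ℝ => N ^ (1 / 2 : ℝ)) atTop atTop :=
    tendsto_rpow_atTop (by norm_num)
  filter_upwards [eventually_ge_atTop (3 : ℝ), hR.eventually_gt_atTop 1, hR.eventually hrem,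
    hR.eventually hquad, eventually_twelve_mul_rpow_le (show η < τ by linarith),
    hroot.eventually_ge_atTop N₁, hroot.eventually_ge_atTop 3] with N hN hR1 hr hq h12 hroot1 hroot3
  have hN0 : 0 < N := by linarith
  set R := N ^ (η / 2) with hRdef
  have hδ0 : 0 ≤ δ R := (abs_nonneg _).trans (hq 0 0 le_rfl le_rfl)
  refine ⟨hδ0, fun p hp => ?_⟩
  have hlogR : Real.log R = η / 2 * Real.log N := log_rpow_half hN0 η
  have hL := one_le_log_of_three_le hN
  set ℓ := Real.log R with hℓ
  have hℓ0 : 0 < ℓ := Real.log_pos hR1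
  rw [mem_primesTo (by linarith)] at hp
  obtain ⟨hp, hpR⟩ := hp
  have hp2 : (2 : ℝ) ≤ p := by exact_mod_cast hp.two_le
  have hp0 : (0 : ℝ) < p := by linarith
  have hp1 : (0 : ℝ) < p - 1 := by linarith
  have hlp : 0 ≤ Real.log p := Real.log_natCast_nonneg p
  have hu1 : Real.log p / ℓ ≤ 1 := by
    rw [div_le_one hℓ0]
    exact Real.log_le_log hp0 hpR
  have hu0 : 0 ≤ Real.log p / ℓ := div_nonneg hlp hℓ0.le
  set φ := crossDensity F (Real.log p / ℓ) with hφ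
  have hφM : |φ| ≤ Mφ := hMφ _ ⟨hu0, hu1⟩
  have hsuff : |crossSum F S c R N p - N / p / 4 * ((ℓ ^ 2)⁻¹ * (s * φ))|
      ≤ N / p / 4 * ((ℓ ^ 2)⁻¹ * (2 * (3 * δ R + (6 * D + 2 * |s| * Mφ) / ((p : ℝ) - 1)
        + 48 * CF * CF * C * ℓ⁻¹))) := by
    -- At `2` and `3` the cross sum is zero but the model term is not; the part `2 |s| Mφ` of the
    -- constant absorbs it.
    by_cases h3 : p ≤ 3
    · rw [crossSum_eq_zero_of_le_three hc R N hp h3, zero_sub, abs_neg, abs_mul, abs_mul, abs_mul,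
        abs_of_nonneg (by positivity : 0 ≤ N / p / 4), abs_of_nonneg (by positivity : 0 ≤ (ℓ ^ 2)⁻¹)]
      refine mul_le_mul_of_nonneg_left (mul_le_mul_of_nonneg_left ?_ (by positivity))
        (by positivity)
      have k1 := one_le_two_div_sub_one hp h3
      have k2 : |s| * |φ| ≤ |s| * Mφ := mul_le_mul_of_nonneg_left hφM (abs_nonneg _)
      have k3 : |s| * Mφ ≤ |s| * Mφ * (2 / ((p : ℝ) - 1)) :=
        le_mul_of_one_le_right (by positivity) k1
      have k4 : (6 * D + 2 * |s| * Mφ) / ((p : ℝ) - 1)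
          = 6 * D / (p - 1) + |s| * Mφ * (2 / ((p : ℝ) - 1)) := by ring
      have k5 : 0 ≤ 6 * D / ((p : ℝ) - 1) := by positivity
      have k6 : 0 ≤ |s| * Mφ * (2 / ((p : ℝ) - 1)) := by positivity
      have k7 : 0 ≤ 48 * CF * CF * C * ℓ⁻¹ := by positivity
      rw [k4]
      linarith
    · push Not at h3
      -- Since `p ≤ R ≤ √N`, the scale `N / p` is at least `√N`, so the asymptotic bound applies at
      -- `N / p` for all `p` at once.
      have hRh : R ≤ N ^ (1 / 2 : ℝ) := Real.rpow_le_rpow_of_exponent_le (by linarith) (by linarith)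
      have hhalf : N ^ (1 / 2 : ℝ) * N ^ (1 / 2 : ℝ) = N := by
        rw [← Real.rpow_add hN0]; norm_num
      have hx : N ^ (1 / 2 : ℝ) ≤ N / p := by
        rw [le_div_iff₀ hp0]
        calc N ^ (1 / 2 : ℝ) * p ≤ N ^ (1 / 2 : ℝ) * N ^ (1 / 2 : ℝ) := by
              gcongr; exact hpR.trans hRh
          _ = N := hhalf
      have hx3 : 3 ≤ N / p := hroot3.trans hx
      have hRR : R * R = N ^ η := rpow_half_mul_self hN0 η
      have hτp : (p : ℝ) ^ τ ≤ p := by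
        calc (p : ℝ) ^ τ ≤ (p : ℝ) ^ (1 : ℝ) :=
              Real.rpow_le_rpow_of_exponent_le (by linarith) (by linarith)
          _ = p := Real.rpow_one _
      -- The moduli up to `N^η / p` are within the level at `N / p` because `p^τ ≤ p`.
      have hy : 12 * (R * (R / p)) ≤ (N / p) ^ τ := by
        rw [Real.div_rpow hN0.le hp0.le]
        calc 12 * (R * (R / p)) = 12 * N ^ η / p := by rw [← hRR]; ring
          _ ≤ N ^ τ / p := by gcongr
          _ ≤ N ^ τ / (p : ℝ) ^ τ := by
            have := Real.rpow_pos_of_pos hp0 τ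
            gcongr
      have hE := hN₁ (N / p) (hroot1.trans hx) _ hy
      have hlogx : ℓ ≤ Real.log (N / p) := by
        have : Real.log (N ^ (1 / 2 : ℝ)) ≤ Real.log (N / p) := Real.log_le_log (by linarith) hx
        rw [Real.log_rpow hN0] at this
        nlinarith
      have hlogpow : Real.log (N / p) ^ (-((3 : ℕ) : ℝ)) ≤ (ℓ ^ 3)⁻¹ := by
        rw [Real.rpow_neg (by linarith), Real.rpow_natCast]
        gcongr
      have hc1 := abs_crossSum_sub_quadForm_le hS hS2 hc12 hc hb hF hR1 hp h3 (N := N)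
        (by linarith)
      have hc2 : 3 * (CF * CF * ∑ q ∈ moduli (R * (R / p)) 6,
          6 ^ q.primeFactors.card * errStar (N / p) (12 * q))
          ≤ 3 * (CF * CF * (C * (N / p * (ℓ ^ 3)⁻¹))) := by
        have : 0 ≤ N / p := by positivity
        refine mul_le_mul_of_nonneg_left (mul_le_mul_of_nonneg_left (hE.trans ?_)
          (by positivity)) (by norm_num)
        gcongr
      have hc3 := abs_mul_crossForm_sub_le hp hD hR1 hq hr
      set Q := -2 * quadForm (removePrime pairDensity p) F (primeShift F R p) R
        + quadForm (removePrime pairDensity p) (primeShift F R p) (primeShift F R p) R with hQ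
      have e1 : crossSum F S c R N p - N / p / 4 * ((ℓ ^ 2)⁻¹ * (s * φ))
          = (crossSum F S c R N p - N / p / 4 * Q)
            + N / p / 4 * ((ℓ ^ 2)⁻¹ * (ℓ ^ 2 * Q - s * φ)) := by
        field_simp
        ring
      have e2 : |N / p / 4 * ((ℓ ^ 2)⁻¹ * (ℓ ^ 2 * Q - s * φ))|
          ≤ N / p / 4 * ((ℓ ^ 2)⁻¹ * (3 * δ R + 6 * D / ((p : ℝ) - 1))) := by
        rw [abs_mul, abs_mul, abs_of_nonneg (by positivity : 0 ≤ N / p / 4),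
          abs_of_nonneg (by positivity : 0 ≤ (ℓ ^ 2)⁻¹)]
        exact mul_le_mul_of_nonneg_left (mul_le_mul_of_nonneg_left hc3 (by positivity))
          (by positivity)
      rw [e1]
      refine (abs_add_le _ _).trans ((add_le_add (hc1.trans hc2) e2).trans ?_)
      have e3 : 3 * (CF * CF * (C * (N / p * (ℓ ^ 3)⁻¹)))
          = N / p / 4 * ((ℓ ^ 2)⁻¹ * (12 * CF * CF * C * ℓ⁻¹)) := by
        field_simp
        ring
      rw [e3, ← mul_add, ← mul_add]
      refine mul_le_mul_of_nonneg_left (mul_le_mul_of_nonneg_left ?_ (by positivity))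
        (by positivity)
      have k5 : 6 * D / ((p : ℝ) - 1) ≤ (6 * D + 2 * |s| * Mφ) / ((p : ℝ) - 1) := by
        gcongr
        have : 0 ≤ 2 * |s| * Mφ := by positivity
        linarith
      have k6 : 0 ≤ 6 * D / ((p : ℝ) - 1) := by positivity
      have k7 : 0 ≤ CF * CF * C * ℓ⁻¹ := by positivity
      linarith
  have e : ℓ / N * (2 * Real.log p * crossSum F S c R N p)
      - 1 / 2 * s * (ℓ⁻¹ * (Real.log p / p * φ))
      = ℓ / N * (2 * Real.log p) * (crossSum F S c R N p - N / p / 4 * ((ℓ ^ 2)⁻¹ * (s * φ))) := by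
    field_simp
    ring
  rw [e, abs_mul, abs_of_nonneg (by positivity : 0 ≤ ℓ / N * (2 * Real.log p))]
  refine (mul_le_mul_of_nonneg_left hsuff (by positivity)).trans (le_of_eq ?_)
  field_simp
  ring

/-- The model terms form a prime mean of the cross density, which tends to its integral. The uniform
errors are summed with Mertens, the `1/(p-1)` part with a convergent series. -/
theorem tendsto_sum_crossSum {θ : ℝ} (hθ : θ ≤ 1) (hBV : HypBV θ) {F : ℝ → ℝ}
    (hFs : ContDiff ℝ (⊤ : ℕ∞) F) (hFc : HasCompactSupport F) (hF : ∀ t, 1 ≤ t → F t = 0)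
    {η : ℝ} (h0 : 0 < η) (h1 : η < θ) {S : Finset ℤ} (hS : Admissible S) (hS2 : S.card = 2)
    {c : ℕ} (hc12 : c < 12) (hc : Nat.Coprime c 12) :
    Tendsto (fun N => Real.log (N ^ (η / 2)) / N * ∑ p ∈ primesTo (N ^ (η / 2)),
      2 * Real.log p * crossSum F S c (N ^ (η / 2)) N p) atTop
      (𝓝 (1 / 2 * (singularSeries 2 pairDensity).re
        * ∫ u in Set.Ioc (0 : ℝ) 1, crossDensity F u)) := by
  obtain ⟨δ, K, L, hK, hL, hδ, h⟩ :=
    exists_abs_crossSum_sub_le hθ hBV hFs hFc hF h0 h1 hS hS2 hc12 hc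
  obtain ⟨C, hC, hmer⟩ := exists_mertens
  have hR : Tendsto (fun N : ℝ => N ^ (η / 2)) atTop atTop := tendsto_rpow_atTop (by linarith)
  have hmean := ((tendsto_primeMean (continuousOn_crossDensity hFs hF)).comp hR).const_mul
    (1 / 2 * (singularSeries 2 pairDensity).re)
  have herr : Tendsto (fun N => Real.log (N ^ (η / 2)) / N * ∑ p ∈ primesTo (N ^ (η / 2)),
      2 * Real.log p * crossSum F S c (N ^ (η / 2)) N p
      - 1 / 2 * (singularSeries 2 pairDensity).re * primeMean (crossDensity F) (N ^ (η / 2)))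
      atTop (𝓝 0) := by
    have hinv := tendsto_inv_log
    have hlim : Tendsto (fun R : ℝ => (3 * δ R + L * (Real.log R)⁻¹) * (1 + C * (Real.log R)⁻¹)
        + K * primeLogConst * (Real.log R)⁻¹) atTop (𝓝 0) := by
      have := (((hδ.const_mul 3).add (hinv.const_mul L)).mul ((hinv.const_mul C).const_add 1)).add
        (hinv.const_mul (K * primeLogConst))
      simpa using this
    refine squeeze_zero_norm' ?_ (hlim.comp hR)
    filter_upwards [h, hR.eventually_gt_atTop 1] with N hN hR1
    set R := N ^ (η / 2) with hRdef
    have hℓ0 : 0 < Real.log R := Real.log_pos hR1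
    obtain ⟨hδ0, hN⟩ := hN
    simp only [Function.comp_apply]
    rw [primeMean, Finset.mul_sum, Finset.mul_sum, Finset.mul_sum, ← Finset.sum_sub_distrib,
      Real.norm_eq_abs]
    refine (Finset.abs_sum_le_sum_abs _ _).trans ((Finset.sum_le_sum hN).trans ?_)
    have e : ∀ p ∈ primesTo R, (Real.log R)⁻¹ * (Real.log p / p
        * (3 * δ R + K / ((p : ℝ) - 1) + L * (Real.log R)⁻¹))
        = (Real.log R)⁻¹ * ((3 * δ R + L * (Real.log R)⁻¹) * (Real.log p / p))
          + (Real.log R)⁻¹ * (K * (Real.log p / ((p : ℝ) * (p - 1)))) := by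
      intro p hp
      have hp' := ((mem_primesTo (by linarith)).1 hp).1
      have hp2 : (2 : ℝ) ≤ p := by exact_mod_cast hp'.two_le
      have : (p : ℝ) - 1 ≠ 0 := by linarith
      have : (p : ℝ) ≠ 0 := by linarith
      field_simp
      ring
    rw [Finset.sum_congr rfl e, Finset.sum_add_distrib, ← Finset.mul_sum, ← Finset.mul_sum,
      ← Finset.mul_sum, ← Finset.mul_sum]
    have k1 : ∑ p ∈ primesTo R, Real.log p / p ≤ Real.log R + C := by
      have := (abs_le.1 (hmer R hR1.le)).2
      linarith
    have k2 := sum_log_div_mul_sub_one_le R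
    have k3 : 0 ≤ 3 * δ R + L * (Real.log R)⁻¹ := by positivity
    calc _ ≤ (Real.log R)⁻¹ * ((3 * δ R + L * (Real.log R)⁻¹) * (Real.log R + C))
          + (Real.log R)⁻¹ * (K * primeLogConst) := by gcongr
      _ = _ := by
        rw [← hRdef]
        field_simp
  have := herr.add hmean
  rw [zero_add] at this
  refine this.congr fun N => ?_
  simp only [Function.comp_apply]
  ring

end GapsE2
end

/-! ### The complete asymptotics for one weighted shift. -/

noncomputable section

open Filter Asymptotics Topology

namespace GapsE2

theorem tendsto_pairSum_insert_zero {θ : ℝ} (hθ : θ ≤ 1) (hBV : HypBV θ) (hBV2 : HypBV2 θ)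
    {F : ℝ → ℝ} (hFs : ContDiff ℝ (⊤ : ℕ∞) F) (hFc : HasCompactSupport F)
    (hF : ∀ t, 1 ≤ t → F t = 0) {η : ℝ} (h0 : 0 < η) (h1 : η < θ) {S : Finset ℤ}
    (hS : Admissible S) (hS2 : S.card = 2) (hS0 : (0 : ℤ) ∉ S) {c : ℕ} (hc12 : c < 12)
    (hc : Nat.Coprime c 12) (hsq : ∀ k, (k * k) % 12 ≠ c) :
    Tendsto (fun N => Real.log (N ^ (η / 2)) / N * pairSum F (insert 0 S) c (N ^ (η / 2)) N) atTop
      (𝓝 (1 / 2 * (singularSeries 2 pairDensity).re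
        * (sieveForm 2 F 0 0 / η + ∫ u in Set.Ioc (0 : ℝ) 1, crossDensity F u))) := by
  have hA := tendsto_pairSum hθ hBV2 hFs hFc hF h0 h1 hS hS2 hc12 hc
  have hB := tendsto_sum_crossSum hθ hBV hFs hFc hF h0 h1 hS hS2 hc12 hc
  have hR : Tendsto (fun N : ℝ => N ^ (η / 2)) atTop atTop := tendsto_rpow_atTop (by linarith)
  refine ((hA.add hB).congr' ?_).trans (le_of_eq ?_)
  · filter_upwards [hR.eventually_gt_atTop 1, eventually_ge_atTop (1 : ℝ)] with N hR1 hN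
    rw [pairSum_insert_zero hS hS0 hF hR1 ?_ hc hsq, mul_add]
    rw [rpow_half_mul_self (by linarith)]
    calc N ^ η ≤ N ^ (1 : ℝ) := Real.rpow_le_rpow_of_exponent_le hN (by linarith)
      _ = N := Real.rpow_one N
  · congr 1
    field_simp

/-! ### Two almost primes in a translate of `{0, 2, 6}` -/

theorem sieveSum_add {S S' : Finset ℤ} {n h : ℕ}
    (hS : ∏ a ∈ S, ((n : ℤ) + a) = ∏ a ∈ S', (((n + h : ℕ) : ℤ) + a)) (M : ℕ) (F : ℝ → ℝ) (R : ℝ) :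
    sieveSum M F R S n = sieveSum M F R S' (n + h) := by
  have h : ∀ d, ShiftDvd S d n ↔ ShiftDvd S' d (n + h) := fun d => by rw [ShiftDvd, hS]; rfl
  unfold sieveSum
  simp only [h]

/-- The weight detecting the almost primes `n + h` with `N < n + h ≤ 2 N`. -/
def shiftWeight (N : ℝ) (h n : ℕ) : ℝ :=
  if n + h ∈ Finset.Ioc ⌊N⌋₊ ⌊2 * N⌋₊ then varpi2 (n + h) else 0

/-- Substitute `m = n + h`. Starting at `⌊N⌋₊ - 6` ensures that no `m` in the dyadic interval is
lost when `h ≤ 6`. -/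
theorem sum_shiftWeight_eq_pairSum (F : ℝ → ℝ) (R N : ℝ) {h : ℕ} (hh : h ≤ 6) {S' : Finset ℤ}
    (hS : ∀ n : ℕ, ∏ a ∈ ({0, 2, 6} : Finset ℤ), ((n : ℤ) + a)
      = ∏ a ∈ S', (((n + h : ℕ) : ℤ) + a)) (hN : 6 ≤ ⌊N⌋₊) :
    ∑ n ∈ (Finset.Ioc (⌊N⌋₊ - 6) ⌊2 * N⌋₊).filter (fun n => n % 12 = 5),
      shiftWeight N h n * sieveSum 6 F R {0, 2, 6} n ^ 2
      = pairSum F S' ((5 + h) % 12) R N := by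
  unfold pairSum shiftWeight
  simp only [ite_mul, zero_mul]
  rw [← Finset.sum_filter]
  have e : (Finset.Ioc ⌊N⌋₊ ⌊2 * N⌋₊).filter (fun m => m % 12 = (5 + h) % 12)
      = (((Finset.Ioc (⌊N⌋₊ - 6) ⌊2 * N⌋₊).filter (fun n => n % 12 = 5)).filter
        (fun n => n + h ∈ Finset.Ioc ⌊N⌋₊ ⌊2 * N⌋₊)).image (fun n => n + h) := by
    ext m
    simp only [Finset.mem_filter, Finset.mem_Ioc, Finset.mem_image]
    constructor
    · rintro ⟨h1, h2⟩
      exact ⟨m - h, by omega, by omega⟩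
    · rintro ⟨n, h1, rfl⟩
      omega
  rw [e, Finset.sum_image fun a _ b _ hab => Nat.add_right_cancel hab]
  refine Finset.sum_congr rfl fun n _ => ?_
  rw [sieveSum_add (hS n)]

theorem isE2_of_varpi2_ne_zero {m : ℕ} (h : varpi2 m ≠ 0) (hsq : ∀ k, m ≠ k * k) : IsE2 m := by
  obtain ⟨p, l, hp, hl, rfl⟩ := exists_of_varpi2_ne_zero h
  exact ⟨p, l, hp, hl, fun hpl => hsq p (by rw [← hpl]), rfl⟩

/-- The arithmetic–geometric mean inequality for `log p` and `log l`. -/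
theorem varpi2_le_of_nonsquare {m : ℕ} (hsq : ∀ k, m ≠ k * k) :
    varpi2 m ≤ 1 / 2 * Real.log m ^ 2 := by
  by_cases h : varpi2 m = 0
  · rw [h]; positivity
  · obtain ⟨p, l, hp, hl, hpl, rfl⟩ := isE2_of_varpi2_ne_zero h hsq
    rw [varpi2_prime_mul hp hl hpl]
    push_cast
    rw [Real.log_mul (by exact_mod_cast hp.ne_zero) (by exact_mod_cast hl.ne_zero)]
    nlinarith [sq_nonneg (Real.log p - Real.log l)]

theorem mod_twelve_ne_square {m c : ℕ} (hm : m % 12 = c) (hsq : ∀ k, (k * k) % 12 ≠ c) (k : ℕ) :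
    m ≠ k * k := fun h => hsq k (h ▸ hm)

theorem mul_self_mod_twelve (k : ℕ) :
    (k * k) % 12 ≠ 5 ∧ (k * k) % 12 ≠ 7 ∧ (k * k) % 12 ≠ 11 := by
  rw [Nat.mul_mod]
  have : k % 12 < 12 := Nat.mod_lt _ (by norm_num)
  interval_cases k % 12 <;> decide

theorem shiftWeight_le {N : ℝ} (hN : 1 ≤ N) {h n : ℕ} (hsq : ∀ k, n + h ≠ k * k) :
    shiftWeight N h n ≤ 1 / 2 * Real.log (2 * N) ^ 2 := by
  unfold shiftWeight
  split_ifs with hm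
  · rw [Finset.mem_Ioc] at hm
    refine (varpi2_le_of_nonsquare hsq).trans ?_
    have h1 := (Nat.le_floor_iff (by linarith)).1 hm.2
    have h2 : Real.log ((n + h : ℕ) : ℝ) ≤ Real.log (2 * N) :=
      Real.log_le_log (by exact_mod_cast (by omega : 0 < n + h)) h1
    have h3 := Real.log_natCast_nonneg (n + h)
    gcongr
  · positivity

theorem isE2_of_shiftWeight_ne_zero {N : ℝ} {h n : ℕ} (hsq : ∀ k, n + h ≠ k * k)
    (hw : shiftWeight N h n ≠ 0) : IsE2 (n + h) := by
  unfold shiftWeight at hw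
  split_ifs at hw
  · exact isE2_of_varpi2_ne_zero hw hsq
  · exact absurd rfl hw

/-- Some `n` has three weights with sum above `½ log²(2N)`. Each weight alone is at most this, so at
least two are nonzero. -/
theorem exists_isE2_pair_of_lt {F : ℝ → ℝ} {η N : ℝ} (hN : 6 ≤ ⌊N⌋₊)
    (h : 1 / 2 * Real.log (2 * N) ^ 2 * weightSum F η N
      < pairSum F (insert 0 {2, 6}) 5 (N ^ (η / 2)) N
        + pairSum F (insert 0 {-2, 4}) 7 (N ^ (η / 2)) N
        + pairSum F (insert 0 {-6, -4}) 11 (N ^ (η / 2)) N) :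
    ∃ a b : ℕ, ⌊N⌋₊ - 6 < a ∧ a < b ∧ b ≤ a + 6 ∧ IsE2 a ∧ IsE2 b := by
  have hN1 : 1 ≤ N := by
    have := Nat.floor_pos.1 (show 0 < ⌊N⌋₊ by omega)
    exact this
  rw [← sum_shiftWeight_eq_pairSum F (N ^ (η / 2)) N (h := 0) (S' := insert 0 {2, 6}) (by norm_num)
      (fun n => by simp) hN,
    ← sum_shiftWeight_eq_pairSum F (N ^ (η / 2)) N (h := 2) (S' := insert 0 {-2, 4}) (by norm_num)
      (fun n => by
        rw [Finset.prod_insert (by decide), Finset.prod_insert (by decide), Finset.prod_singleton,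
          Finset.prod_insert (by decide), Finset.prod_insert (by decide), Finset.prod_singleton]
        push_cast; ring) hN,
    ← sum_shiftWeight_eq_pairSum F (N ^ (η / 2)) N (h := 6) (S' := insert 0 {-6, -4})
      (by norm_num) (fun n => by
        rw [Finset.prod_insert (by decide), Finset.prod_insert (by decide), Finset.prod_singleton,
          Finset.prod_insert (by decide), Finset.prod_insert (by decide), Finset.prod_singleton]
        push_cast; ring) hN,
    ← Finset.sum_add_distrib, ← Finset.sum_add_distrib, weightSum, Finset.mul_sum] at h
  obtain ⟨n, hn, hlt⟩ := Finset.exists_lt_of_sum_lt h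
  rw [Finset.mem_filter, Finset.mem_Ioc] at hn
  have hpos : 1 / 2 * Real.log (2 * N) ^ 2
      < shiftWeight N 0 n + shiftWeight N 2 n + shiftWeight N 6 n := by
    by_contra! hle
    have := mul_le_mul_of_nonneg_right hle (sq_nonneg (sieveSum 6 F (N ^ (η / 2)) {0, 2, 6} n))
    linarith
  have s0 : ∀ k, n + 0 ≠ k * k :=
    mod_twelve_ne_square (by omega : (n + 0) % 12 = 5) fun k => (mul_self_mod_twelve k).1
  have s2 : ∀ k, n + 2 ≠ k * k :=
    mod_twelve_ne_square (by omega : (n + 2) % 12 = 7) fun k => (mul_self_mod_twelve k).2.1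
  have s6 : ∀ k, n + 6 ≠ k * k :=
    mod_twelve_ne_square (by omega : (n + 6) % 12 = 11) fun k => (mul_self_mod_twelve k).2.2
  have b0 := shiftWeight_le hN1 s0
  have b2 := shiftWeight_le hN1 s2
  have b6 := shiftWeight_le hN1 s6
  by_cases w0 : shiftWeight N 0 n = 0
  · have w2 : shiftWeight N 2 n ≠ 0 := fun h => by linarith
    have w6 : shiftWeight N 6 n ≠ 0 := fun h => by linarith
    exact ⟨n + 2, n + 6, by omega, by omega, by omega, isE2_of_shiftWeight_ne_zero s2 w2,
      isE2_of_shiftWeight_ne_zero s6 w6⟩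
  · by_cases w2 : shiftWeight N 2 n = 0
    · have w6 : shiftWeight N 6 n ≠ 0 := fun h => by linarith
      exact ⟨n + 0, n + 6, by omega, by omega, by omega, isE2_of_shiftWeight_ne_zero s0 w0,
        isE2_of_shiftWeight_ne_zero s6 w6⟩
    · exact ⟨n + 0, n + 2, by omega, by omega, by omega, isE2_of_shiftWeight_ne_zero s0 w0,
        isE2_of_shiftWeight_ne_zero s2 w2⟩

/-- The successor of `a` in the enumeration is at most `b`. Such indices occur arbitrarily far out,
and frequent occurrence is enough to bound a lower limit. -/
theorem liminf_le_six_of_pairs (h : ∀ k : ℕ, ∃ a b : ℕ, k ≤ a ∧ a < b ∧ b ≤ a + 6 ∧ IsE2 a ∧ IsE2 b) :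
    liminf (fun n : ℕ => ((qSeq (n + 1) - qSeq n : ℕ) : ℕ∞)) atTop ≤ 6 := by
  classical
  refine liminf_le_of_frequently_le' ?_
  rw [frequently_atTop]
  intro K
  obtain ⟨a, b, hk, hab, hb6, ha, hb⟩ := h (qSeq K)
  refine ⟨Nat.count IsE2 a, ?_, ?_⟩
  · rw [← strictMono_qSeq.le_iff_le, qSeq, qSeq, Nat.nth_count ha]
    exact hk
  · have h1 : qSeq (Nat.count IsE2 a) = a := Nat.nth_count ha
    have h2 : qSeq (Nat.count IsE2 b) = b := Nat.nth_count hb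
    have h3 : qSeq (Nat.count IsE2 a + 1) ≤ b := by
      rw [← h2]
      exact strictMono_qSeq.monotone (Nat.count_strict_mono ha hab)
    rw [h1]
    exact_mod_cast (by omega : qSeq (Nat.count IsE2 a + 1) - a ≤ 6)

/-- The three shifts have the same limit. Since `log (2N) ~ (2/η) log R` and the triple series is
three times the pair series `s`, the limiting difference is `s/(2η²)` times the gap in the
hypothesis. -/
theorem liminf_le_six_of_sieve_inequality {θ : ℝ} (hθ : θ ≤ 1) (hBV : HypBV θ) (hBV2 : HypBV2 θ)
    {F : ℝ → ℝ} (hFs : ContDiff ℝ (⊤ : ℕ∞) F) (hFc : HasCompactSupport F)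
    (hF : ∀ t, 1 ≤ t → F t = 0) {η : ℝ} (h0 : 0 < η) (h1 : η < θ)
    (hlt : sieveForm 3 F 0 0
      < 3 * (η * sieveForm 2 F 0 0 + η ^ 2 * ∫ u in Set.Ioc (0 : ℝ) 1, crossDensity F u)) :
    liminf (fun n : ℕ => ((qSeq (n + 1) - qSeq n : ℕ) : ℕ∞)) atTop ≤ 6 := by
  have hR : Tendsto (fun N : ℝ => N ^ (η / 2)) atTop atTop := tendsto_rpow_atTop (by linarith)
  have t0 := tendsto_pairSum_insert_zero hθ hBV hBV2 hFs hFc hF h0 h1 (S := {2, 6})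
    (admissible_pair (by decide) (by decide) (by decide)) (by decide) (by decide) (c := 5)
    (by norm_num) (by decide) fun k => (mul_self_mod_twelve k).1
  have t2 := tendsto_pairSum_insert_zero hθ hBV hBV2 hFs hFc hF h0 h1 (S := {-2, 4})
    (admissible_pair (by decide) (by decide) (by decide)) (by decide) (by decide) (c := 7)
    (by norm_num) (by decide) fun k => (mul_self_mod_twelve k).2.1
  have t6 := tendsto_pairSum_insert_zero hθ hBV hBV2 hFs hFc hF h0 h1 (S := {-6, -4})
    (admissible_pair (by decide) (by decide) (by decide)) (by decide) (by decide) (c := 11)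
    (by norm_num) (by decide) fun k => (mul_self_mod_twelve k).2.2
  have tw := tendsto_weightSum hFs hFc hF h0 (by linarith)
  have hs := singularSeries_pair_pos
  have hs3 : (singularSeries 3 tripleDensity).re = 3 * (singularSeries 2 pairDensity).re := by
    rw [singularSeries_triple]; simp
  set s := (singularSeries 2 pairDensity).re
  set J := sieveForm 2 F 0 0
  set D := ∫ u in Set.Ioc (0 : ℝ) 1, crossDensity F u
  have tlog : Tendsto (fun N : ℝ => 1 / 2 * (2 / η * (1 + Real.log 2 * (Real.log N)⁻¹)) ^ 2) atTop
      (𝓝 (1 / 2 * (2 / η * (1 + Real.log 2 * 0)) ^ 2)) :=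
    (((((tendsto_inv_log.const_mul _).const_add 1).const_mul _).pow 2).const_mul _)
  have tdiff := ((t0.add t2).add t6).sub (tlog.mul tw)
  have hpos : 0 < 1 / 2 * s * (J / η + D) + 1 / 2 * s * (J / η + D) + 1 / 2 * s * (J / η + D)
      - 1 / 2 * (2 / η * (1 + Real.log 2 * 0)) ^ 2
        * ((singularSeries 3 tripleDensity).re / 12 * sieveForm 3 F 0 0) := by
    rw [hs3]
    have e : 1 / 2 * s * (J / η + D) + 1 / 2 * s * (J / η + D) + 1 / 2 * s * (J / η + D)
      - 1 / 2 * (2 / η * (1 + Real.log 2 * 0)) ^ 2 * (3 * s / 12 * sieveForm 3 F 0 0)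
      = s / (2 * η ^ 2) * (3 * (η * J + η ^ 2 * D) - sieveForm 3 F 0 0) := by
      field_simp
      ring
    rw [e]
    exact mul_pos (by positivity) (by linarith)
  have hev := tdiff.eventually (lt_mem_nhds hpos)
  refine liminf_le_six_of_pairs fun k => ?_
  obtain ⟨N, hN, hR1, hNk⟩ := (hev.and ((hR.eventually_gt_atTop 1).and
    (eventually_ge_atTop ((k : ℝ) + 6)))).exists
  have hkN : k + 6 ≤ ⌊N⌋₊ := Nat.le_floor (by push_cast; exact hNk)
  have hN6 : 6 ≤ N := by
    have : (0 : ℝ) ≤ k := Nat.cast_nonneg k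
    linarith
  have hL := Real.log_pos (show 1 < N by linarith)
  have hℓ := Real.log_pos hR1
  have key : 1 / 2 * Real.log (2 * N) ^ 2 * weightSum F η N
      < pairSum F (insert 0 {2, 6}) 5 (N ^ (η / 2)) N
        + pairSum F (insert 0 {-2, 4}) 7 (N ^ (η / 2)) N
        + pairSum F (insert 0 {-6, -4}) 11 (N ^ (η / 2)) N := by
    have hlogR : Real.log (N ^ (η / 2)) = η / 2 * Real.log N := log_rpow_half (by linarith) η
    have hlog2 : Real.log (2 * N) = 2 / η * (1 + Real.log 2 * (Real.log N)⁻¹)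
        * Real.log (N ^ (η / 2)) := by
      rw [Real.log_mul (by norm_num) (by linarith), hlogR]
      field_simp
      ring
    rw [hlog2]
    have hc : 0 < Real.log (N ^ (η / 2)) / N := div_pos hℓ (by linarith)
    refine lt_of_mul_lt_mul_left ?_ hc.le
    have e : Real.log (N ^ (η / 2)) / N * (1 / 2 * (2 / η * (1 + Real.log 2 * (Real.log N)⁻¹)
        * Real.log (N ^ (η / 2))) ^ 2 * weightSum F η N)
        = 1 / 2 * (2 / η * (1 + Real.log 2 * (Real.log N)⁻¹)) ^ 2
          * (Real.log (N ^ (η / 2)) ^ 3 / N * weightSum F η N) := by ring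
    rw [e, mul_add, mul_add]
    linarith
  obtain ⟨a, b, ha, hab⟩ := exists_isE2_pair_of_lt (by omega) key
  exact ⟨a, b, by omega, hab⟩

end GapsE2
end

noncomputable section

open Filter Asymptotics Topology

namespace GapsE2

/-! ### The test function -/

/-- The primitive vanishing at `1`. -/
def primitive (f : ℝ → ℝ) (t : ℝ) : ℝ := ∫ x in (1 : ℝ)..t, f x

theorem deriv_primitive {f : ℝ → ℝ} (hf : Continuous f) : deriv (primitive f) = f :=
  funext fun t => hf.deriv_integral f 1 t

theorem contDiff_primitive {f : ℝ → ℝ} (hf : ContDiff ℝ (⊤ : ℕ∞) f) :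
    ContDiff ℝ (⊤ : ℕ∞) (primitive f) := by
  rw [contDiff_infty_iff_deriv, deriv_primitive hf.continuous]
  exact ⟨fun t => (hf.continuous.integral_hasStrictDerivAt 1 t).hasDerivAt.differentiableAt, hf⟩

theorem primitive_eq_zero {f : ℝ → ℝ} (hf : ∀ t, 1 ≤ t → f t = 0) {t : ℝ} (ht : 1 ≤ t) :
    primitive f t = 0 := by
  rw [primitive, intervalIntegral.integral_congr (g := fun _ => 0), intervalIntegral.integral_zero]
  intro x hx
  rw [Set.uIcc_of_le ht] at hx
  exact hf x hx.1

/-- A smooth truncation of `4 t - 5` at `1`. -/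
def truncatedLinear (ε t : ℝ) : ℝ := (4 * t - 5) * Real.smoothTransition ((1 - t) / ε)

theorem contDiff_truncatedLinear (ε : ℝ) : ContDiff ℝ (⊤ : ℕ∞) (truncatedLinear ε) := by
  unfold truncatedLinear
  have h : ContDiff ℝ (⊤ : ℕ∞) fun t : ℝ => (1 - t) / ε := by fun_prop
  exact (by fun_prop : ContDiff ℝ (⊤ : ℕ∞) fun t : ℝ => 4 * t - 5).mul
    (Real.smoothTransition.contDiff.comp h)

theorem truncatedLinear_eq_zero {ε : ℝ} (hε : 0 < ε) {t : ℝ} (ht : 1 ≤ t) :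
    truncatedLinear ε t = 0 := by
  rw [truncatedLinear, Real.smoothTransition.zero_of_nonpos, mul_zero]
  exact div_nonpos_of_nonpos_of_nonneg (by linarith) hε.le

/-- The limit `(1 - t) + 2 (1 - t)²` (for `t ≤ 1`) of the second derivatives. -/
def limitFun (t : ℝ) : ℝ := max (1 - t) 0 + 2 * max (1 - t) 0 ^ 2

theorem continuous_limitFun : Continuous limitFun := by unfold limitFun; fun_prop

theorem limitFun_of_le {t : ℝ} (ht : t ≤ 1) : limitFun t = (1 - t) + 2 * (1 - t) ^ 2 := by
  rw [limitFun, max_eq_left (by linarith)]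

theorem limitFun_of_ge {t : ℝ} (ht : 1 ≤ t) : limitFun t = 0 := by
  rw [limitFun, max_eq_right (by linarith)]; norm_num

theorem abs_limitFun_le {t : ℝ} (ht : 0 ≤ t) : |limitFun t| ≤ 3 := by
  rcases le_total t 1 with h | h
  · rw [limitFun_of_le h, abs_le]
    constructor <;> nlinarith
  · rw [limitFun_of_ge h, abs_zero]; norm_num

theorem integral_linear (t : ℝ) :
    ∫ x in t..1, (5 - 4 * x) = (1 - t) + 2 * (1 - t) ^ 2 := by
  rw [intervalIntegral.integral_sub (by simp)
    ((by fun_prop : Continuous fun x : ℝ => 4 * x).intervalIntegrable _ _),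
    intervalIntegral.integral_const_mul, integral_id, intervalIntegral.integral_const, smul_eq_mul]
  ring

/-- On `[0, 1]` the negated integrand lies between `0` and `5 - 4x`, with equality to the latter for
`x ≤ 1 - ε`. The difference of the integrals is thus at most `5` on an interval of length at most
`ε`. -/
theorem primitive_truncatedLinear {ε : ℝ} (hε : 0 < ε) {t : ℝ} (ht : 0 ≤ t) :
    |primitive (truncatedLinear ε) t| ≤ 3 ∧ |primitive (truncatedLinear ε) t - limitFun t|
      ≤ 5 * ε := by
  rcases le_total 1 t with h | h
  · rw [primitive_eq_zero (fun t ht => truncatedLinear_eq_zero hε ht) h, limitFun_of_ge h]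
    norm_num
    exact hε.le
  have hc := (contDiff_truncatedLinear ε).continuous
  have hcn : Continuous fun x => -truncatedLinear ε x := hc.neg
  have hl : Continuous fun x : ℝ => 5 - 4 * x := by fun_prop
  have e : primitive (truncatedLinear ε) t = ∫ x in t..1, -truncatedLinear ε x := by
    rw [primitive, intervalIntegral.integral_symm, intervalIntegral.integral_neg]
  have hb : ∀ x ∈ Set.Icc (0 : ℝ) 1, 0 ≤ -truncatedLinear ε x
      ∧ -truncatedLinear ε x ≤ 5 - 4 * x := by
    intro x hx
    have h1 := Real.smoothTransition.nonneg ((1 - x) / ε)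
    have h2 := Real.smoothTransition.le_one ((1 - x) / ε)
    have h3 := hx.2
    rw [truncatedLinear]
    constructor <;> nlinarith
  have hsub : ∀ x ∈ Set.Icc t 1, x ∈ Set.Icc (0 : ℝ) 1 := fun x hx => ⟨ht.trans hx.1, hx.2⟩
  have h0 : 0 ≤ primitive (truncatedLinear ε) t := by
    rw [e]
    exact intervalIntegral.integral_nonneg h fun x hx => (hb x (hsub x hx)).1
  have h1 : primitive (truncatedLinear ε) t ≤ limitFun t := by
    rw [e, limitFun_of_le h, ← integral_linear]
    exact intervalIntegral.integral_mono_on h (hcn.intervalIntegrable _ _)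
      (hl.intervalIntegrable _ _) fun x hx => (hb x (hsub x hx)).2
  have h2 := (abs_le.1 (abs_limitFun_le ht)).2
  refine ⟨by rw [abs_of_nonneg h0]; linarith, ?_⟩
  rw [abs_sub_comm, abs_of_nonneg (by linarith), e, limitFun_of_le h, ← integral_linear,
    ← intervalIntegral.integral_sub (hl.intervalIntegrable _ _) (hcn.intervalIntegrable _ _)]
  set k : ℝ → ℝ := fun x => 5 - 4 * x - -truncatedLinear ε x with hk
  have hkc : Continuous k := hl.sub hcn
  have hk0 : ∀ x, x ≤ 1 - ε → k x = 0 := by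
    intro x hx
    rw [hk]
    dsimp only
    rw [truncatedLinear, Real.smoothTransition.one_of_one_le (by
      rw [le_div_iff₀ hε]; linarith)]
    ring
  have hk5 : ∀ x, 0 ≤ x → x ≤ 1 → ‖k x‖ ≤ 5 := by
    intro x hx0 hx1
    have := hb x ⟨hx0, hx1⟩
    rw [hk, Real.norm_eq_abs, abs_le]
    dsimp only
    constructor <;> linarith
  rcases le_total t (1 - ε) with hte | hte
  · rw [← intervalIntegral.integral_add_adjacent_intervals (b := 1 - ε)
      (hkc.intervalIntegrable _ _) (hkc.intervalIntegrable _ _),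
      intervalIntegral.integral_congr (g := fun _ => (0 : ℝ)) (b := 1 - ε),
      intervalIntegral.integral_zero, zero_add]
    · refine (Real.le_norm_self _).trans ((intervalIntegral.norm_integral_le_of_norm_le_const (C := 5)
        fun x hx => ?_).trans_eq ?_)
      · rw [Set.uIoc_of_le (by linarith)] at hx
        exact hk5 x (by linarith [hx.1]) hx.2
      · rw [sub_sub_cancel, abs_of_pos hε]
    · intro x hx
      rw [Set.uIcc_of_le hte] at hx
      exact hk0 x hx.2
  · refine (Real.le_norm_self _).trans ((intervalIntegral.norm_integral_le_of_norm_le_const (C := 5)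
        fun x hx => ?_).trans ?_)
    · rw [Set.uIoc_of_le h] at hx
      exact hk5 x (by linarith [hx.1]) hx.2
    · rw [abs_of_nonneg (by linarith)]
      linarith

/-- Integrating the truncated linear function three times from `1` keeps every derivative zero on
`[1, ∞)`. The factor `smoothTransition (t + 2)` gives compact support and is `1` for `t ≥ -1`, so
functionals on `[0, ∞)` do not see it. -/
theorem exists_testFunction {ε : ℝ} (hε : 0 < ε) : ∃ F : ℝ → ℝ, ContDiff ℝ (⊤ : ℕ∞) F ∧
    HasCompactSupport F ∧ (∀ t, 1 ≤ t → F t = 0) ∧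
    (∀ t, 0 ≤ t → |iteratedDeriv 2 F t| ≤ 3 ∧ |iteratedDeriv 2 F t - limitFun t| ≤ 5 * ε) ∧
    ∀ t, 0 ≤ t → t ≤ 1 → |iteratedDeriv 3 F t| ≤ 5 - 4 * t := by
  have c3 := contDiff_truncatedLinear ε
  have c2 := contDiff_primitive c3
  have c1 := contDiff_primitive c2
  have c0 := contDiff_primitive c1
  have z3 : ∀ t, 1 ≤ t → truncatedLinear ε t = 0 := fun t ht => truncatedLinear_eq_zero hε ht
  have z2 := fun t (ht : 1 ≤ t) => primitive_eq_zero z3 ht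
  have z1 := fun t (ht : 1 ≤ t) => primitive_eq_zero z2 ht
  have z0 := fun t (ht : 1 ≤ t) => primitive_eq_zero z1 ht
  set F0 := primitive (primitive (primitive (truncatedLinear ε))) with hF0
  have i2 : iteratedDeriv 2 F0 = primitive (truncatedLinear ε) := by
    rw [iteratedDeriv_succ, iteratedDeriv_one, hF0, deriv_primitive c1.continuous,
      deriv_primitive c2.continuous]
  have i3 : iteratedDeriv 3 F0 = truncatedLinear ε := by
    rw [iteratedDeriv_succ, i2, deriv_primitive c3.continuous]
  have hloc : ∀ t : ℝ, 0 ≤ t → (fun t => Real.smoothTransition (t + 2) * F0 t) =ᶠ[𝓝 t] F0 := by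
    intro t ht
    filter_upwards [lt_mem_nhds (show (-1 : ℝ) < t by linarith)] with x hx
    rw [Real.smoothTransition.one_of_one_le (by linarith), one_mul]
  refine ⟨fun t => Real.smoothTransition (t + 2) * F0 t, ?_, ?_, ?_, ?_, ?_⟩
  · exact (Real.smoothTransition.contDiff.comp
      (by fun_prop : ContDiff ℝ (⊤ : ℕ∞) fun t : ℝ => t + 2)).mul c0
  · refine HasCompactSupport.intro (isCompact_Icc (a := (-2 : ℝ)) (b := 1)) fun t ht => ?_
    rw [Set.mem_Icc, not_and_or, not_le, not_le] at ht
    rcases ht with h | h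
    · rw [Real.smoothTransition.zero_of_nonpos (by linarith), zero_mul]
    · rw [z0 t h.le, mul_zero]
  · intro t ht
    dsimp only
    rw [z0 t ht, mul_zero]
  · intro t ht
    rw [(hloc t ht).iteratedDeriv_eq, i2]
    exact primitive_truncatedLinear hε ht
  · intro t ht ht1
    rw [(hloc t ht).iteratedDeriv_eq, i3, truncatedLinear, abs_mul,
      abs_of_nonneg (Real.smoothTransition.nonneg _), abs_of_neg (by linarith)]
    have := Real.smoothTransition.le_one ((1 - t) / ε)
    nlinarith

/-! ### Evaluation of the limiting functionals -/

theorem integral_quintic (c₀ c₁ c₂ c₃ c₄ c₅ s : ℝ) :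
    ∫ t in (0 : ℝ)..s, (c₀ + c₁ * t + c₂ * t ^ 2 + c₃ * t ^ 3 + c₄ * t ^ 4 + c₅ * t ^ 5)
      = c₀ * s + c₁ * s ^ 2 / 2 + c₂ * s ^ 3 / 3 + c₃ * s ^ 4 / 4 + c₄ * s ^ 5 / 5
        + c₅ * s ^ 6 / 6 := by
  have hi : ∀ (c : ℝ) (n : ℕ),
      IntervalIntegrable (fun t : ℝ => c * t ^ n) MeasureTheory.volume 0 s := fun c n =>
    (by fun_prop : Continuous fun t : ℝ => c * t ^ n).intervalIntegrable _ _
  have e : ∀ t : ℝ, c₀ + c₁ * t + c₂ * t ^ 2 + c₃ * t ^ 3 + c₄ * t ^ 4 + c₅ * t ^ 5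
      = ∑ i : Fin 6, (![c₀, c₁, c₂, c₃, c₄, c₅] i) * t ^ (i : ℕ) := fun t => by
    simp [Fin.sum_univ_succ]
    ring
  simp only [e]
  rw [intervalIntegral.integral_finsetSum fun i _ => hi _ _]
  simp only [intervalIntegral.integral_const_mul, integral_pow]
  simp [Fin.sum_univ_succ]
  ring

/-- The bilinear form `∫ G(t + u) G(t + v) t` for the limit function `G`. -/
def limitForm (u v : ℝ) : ℝ :=
  ∫ t in Set.Icc (0 : ℝ) 1, limitFun (t + u) * limitFun (t + v) * t

theorem limitForm_eq {u v : ℝ} (hu : 0 ≤ u) (huv : u ≤ v) (hv : v ≤ 1) :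
    limitForm u v = ∫ t in (0 : ℝ)..(1 - v), ((1 - (t + u)) + 2 * (1 - (t + u)) ^ 2)
      * ((1 - (t + v)) + 2 * (1 - (t + v)) ^ 2) * t := by
  have hc : Continuous fun t => limitFun (t + u) * limitFun (t + v) * t := by
    have := continuous_limitFun
    fun_prop
  rw [limitForm, MeasureTheory.integral_Icc_eq_integral_Ioc,
    ← intervalIntegral.integral_of_le zero_le_one,
    ← intervalIntegral.integral_add_adjacent_intervals (b := 1 - v)
      (hc.intervalIntegrable _ _) (hc.intervalIntegrable _ _),
    intervalIntegral.integral_congr (g := fun _ => (0 : ℝ)) (a := 1 - v),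
    intervalIntegral.integral_zero, add_zero]
  · refine intervalIntegral.integral_congr fun t ht => ?_
    rw [Set.uIcc_of_le (by linarith)] at ht
    rw [limitFun_of_le (by linarith [ht.2]), limitFun_of_le (by linarith [ht.2])]
  · intro t ht
    rw [Set.uIcc_of_le (by linarith)] at ht
    dsimp only
    rw [limitFun_of_ge (t := t + v) (by linarith [ht.1])]
    ring

theorem limitForm_zero {u : ℝ} (hu : 0 ≤ u) (hu1 : u ≤ 1) :
    limitForm 0 u = (1 - u) ^ 3 / 2 + (1 - u) ^ 4 / 12 - 7 * (1 - u) ^ 5 / 30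
      + (1 - u) ^ 6 / 15 := by
  rw [limitForm_eq le_rfl hu hu1]
  set s := 1 - u with hs
  -- The factors are `3 - 5t + 2t²` and, with `s = 1 - u`, `(s + 2s²) - (1 + 4s) t + 2t²`.
  have e : ∀ t : ℝ, ((1 - (t + 0)) + 2 * (1 - (t + 0)) ^ 2)
      * ((1 - (t + u)) + 2 * (1 - (t + u)) ^ 2) * t
      = 0 + 3 * (s + 2 * s ^ 2) * t + -(3 * (1 + 4 * s) + 5 * (s + 2 * s ^ 2)) * t ^ 2
        + (6 + 5 * (1 + 4 * s) + 2 * (s + 2 * s ^ 2)) * t ^ 3 + -(10 + 2 * (1 + 4 * s)) * t ^ 4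
        + 4 * t ^ 5 := fun t => by
    rw [hs]; ring
  simp only [e]
  rw [integral_quintic]
  ring

theorem limitForm_self {u : ℝ} (hu : 0 ≤ u) (hu1 : u ≤ 1) :
    limitForm u u = (1 - u) ^ 4 / 12 + (1 - u) ^ 5 / 5 + 2 * (1 - u) ^ 6 / 15 := by
  rw [limitForm_eq hu le_rfl hu1]
  set s := 1 - u with hs
  have e : ∀ t : ℝ, ((1 - (t + u)) + 2 * (1 - (t + u)) ^ 2)
      * ((1 - (t + u)) + 2 * (1 - (t + u)) ^ 2) * t
      = 0 + (s + 2 * s ^ 2) ^ 2 * t + -(2 * (s + 2 * s ^ 2) * (1 + 4 * s)) * t ^ 2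
        + ((1 + 4 * s) ^ 2 + 4 * (s + 2 * s ^ 2)) * t ^ 3 + -(4 * (1 + 4 * s)) * t ^ 4
        + 4 * t ^ 5 := fun t => by
    rw [hs]; ring
  simp only [e]
  rw [integral_quintic]
  ring

/-- In `s = 1 - u` the sixth powers cancel and the integrand is `-s³ - s⁴/12 + (2/3) s⁵`, with
integral `-1/4 - 1/60 + 1/9`. -/
theorem integral_limitForm :
    ∫ u in Set.Ioc (0 : ℝ) 1, (-2 * limitForm 0 u + limitForm u u) = -(7 / 45) := by
  rw [← intervalIntegral.integral_of_le zero_le_one,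
    intervalIntegral.integral_congr (g := fun u => (fun s : ℝ => 0 + 0 * s + 0 * s ^ 2 + (-1) * s ^ 3
      + (-1 / 12) * s ^ 4 + (2 / 3) * s ^ 5) (1 - u)),
    intervalIntegral.integral_comp_sub_left (fun s : ℝ => 0 + 0 * s + 0 * s ^ 2 + (-1) * s ^ 3
      + (-1 / 12) * s ^ 4 + (2 / 3) * s ^ 5), sub_self, sub_zero, integral_quintic]
  · norm_num
  · intro u hu
    rw [Set.uIcc_of_le zero_le_one] at hu
    dsimp only
    rw [limitForm_zero hu.1 hu.2, limitForm_self hu.1 hu.2]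
    ring

/-! ### Comparison with the limit -/

theorem abs_mul_sub_mul_le {a b a' b' ε : ℝ} (ha' : |a'| ≤ 3) (hb : |b| ≤ 3)
    (h1 : |a - a'| ≤ 5 * ε) (h2 : |b - b'| ≤ 5 * ε) : |a * b - a' * b'| ≤ 30 * ε := by
  have e : a * b - a' * b' = (a - a') * b + a' * (b - b') := by ring
  rw [e]
  refine (abs_add_le _ _).trans ?_
  rw [abs_mul, abs_mul]
  have h3 := mul_le_mul h1 hb (abs_nonneg _) ((abs_nonneg _).trans h1)
  have h4 := mul_le_mul ha' h2 (abs_nonneg _) (by norm_num)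
  linarith

theorem abs_sieveForm_sub_limitForm_le {F : ℝ → ℝ} {ε : ℝ} (hFs : ContDiff ℝ (⊤ : ℕ∞) F)
    (hF : ∀ t, 1 ≤ t → F t = 0)
    (hF2 : ∀ t, 0 ≤ t → |iteratedDeriv 2 F t| ≤ 3 ∧ |iteratedDeriv 2 F t - limitFun t| ≤ 5 * ε)
    {u v : ℝ} (hu : 0 ≤ u) (hv : 0 ≤ v) : |sieveForm 2 F u v - limitForm u v| ≤ 30 * ε := by
  have hc : Continuous (iteratedDeriv 2 F) := hFs.continuous_iteratedDeriv 2 (by norm_cast)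
  have hg := continuous_limitFun
  have hε : 0 ≤ 5 * ε := (abs_nonneg _).trans (hF2 0 le_rfl).2
  rw [sieveForm_eq_setIntegral hF 2 hu, limitForm, ← MeasureTheory.integral_sub, ← Real.norm_eq_abs]
  · refine (MeasureTheory.norm_setIntegral_le_of_norm_le_const (s := Set.Icc (0 : ℝ) 1)
      (C := 30 * ε) measure_Icc_lt_top fun t ht => ?_).trans_eq ?_
    · have h := abs_mul_sub_mul_le (abs_limitFun_le (add_nonneg ht.1 hu))
        (hF2 _ (add_nonneg ht.1 hv)).1 (hF2 _ (add_nonneg ht.1 hu)).2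
        (hF2 _ (add_nonneg ht.1 hv)).2
      have e : iteratedDeriv 2 F (t + u) * iteratedDeriv 2 F (t + v)
          * (t ^ (2 - 1) / ((2 - 1).factorial : ℝ)) - limitFun (t + u) * limitFun (t + v) * t
          = (iteratedDeriv 2 F (t + u) * iteratedDeriv 2 F (t + v)
            - limitFun (t + u) * limitFun (t + v)) * t := by
        norm_num
        ring
      rw [e, Real.norm_eq_abs, abs_mul, abs_of_nonneg ht.1]
      exact (mul_le_of_le_one_right (abs_nonneg _) ht.2).trans h
    · simp
  · exact (by fun_prop : Continuous fun t => iteratedDeriv 2 F (t + u) * iteratedDeriv 2 F (t + v)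
      * (t ^ (2 - 1) / ((2 - 1).factorial : ℝ))).continuousOn.integrableOn_compact isCompact_Icc
  · exact (by fun_prop : Continuous fun t => limitFun (t + u) * limitFun (t + v)
      * t).continuousOn.integrableOn_compact isCompact_Icc

theorem abs_integral_crossDensity_sub_le {F : ℝ → ℝ} {ε : ℝ} (hFs : ContDiff ℝ (⊤ : ℕ∞) F)
    (hF : ∀ t, 1 ≤ t → F t = 0)
    (hF2 : ∀ t, 0 ≤ t → |iteratedDeriv 2 F t| ≤ 3 ∧ |iteratedDeriv 2 F t - limitFun t| ≤ 5 * ε) :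
    |(∫ u in Set.Ioc (0 : ℝ) 1, crossDensity F u) - -(7 / 45)| ≤ 90 * ε := by
  have hg := continuous_limitFun
  have hlim : Continuous fun u => -2 * limitForm 0 u + limitForm u u := by
    unfold limitForm
    have h1 : Continuous fun u : ℝ => ∫ t in Set.Icc (0 : ℝ) 1,
        limitFun (t + 0) * limitFun (t + u) * t :=
      continuous_parametric_integral_of_continuous (by fun_prop) isCompact_Icc
    have h2 : Continuous fun u : ℝ => ∫ t in Set.Icc (0 : ℝ) 1,
        limitFun (t + u) * limitFun (t + u) * t :=
      continuous_parametric_integral_of_continuous (by fun_prop) isCompact_Icc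
    exact (h1.const_mul (-2)).add h2
  have hint : ∫ u in Set.Icc (0 : ℝ) 1, (-2 * limitForm 0 u + limitForm u u) = -(7 / 45) := by
    rw [MeasureTheory.integral_Icc_eq_integral_Ioc, integral_limitForm]
  rw [← MeasureTheory.integral_Icc_eq_integral_Ioc, ← hint, ← MeasureTheory.integral_sub
    ((continuousOn_crossDensity hFs hF).integrableOn_compact isCompact_Icc)
    (hlim.continuousOn.integrableOn_compact isCompact_Icc), ← Real.norm_eq_abs]
  refine (MeasureTheory.norm_setIntegral_le_of_norm_le_const (s := Set.Icc (0 : ℝ) 1)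
      (C := 90 * ε) measure_Icc_lt_top fun u hu => ?_).trans_eq ?_
  swap
  · simp
  have h1 := abs_sieveForm_sub_limitForm_le hFs hF hF2 le_rfl hu.1
  have h2 := abs_sieveForm_sub_limitForm_le hFs hF hF2 hu.1 hu.1
  rw [crossDensity, Real.norm_eq_abs]
  rw [abs_le] at h1 h2 ⊢
  constructor <;> linarith

/-- An upper bound is enough for `k = 3`, so the third derivative, which cannot converge uniformly
near `1`, is only dominated by `5 - 4t`. -/
theorem sieveForm_three_le {F : ℝ → ℝ} (hFs : ContDiff ℝ (⊤ : ℕ∞) F) (hF : ∀ t, 1 ≤ t → F t = 0)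
    (hF3 : ∀ t, 0 ≤ t → t ≤ 1 → |iteratedDeriv 3 F t| ≤ 5 - 4 * t) :
    sieveForm 3 F 0 0 ≤ 23 / 30 := by
  have hc : Continuous (iteratedDeriv 3 F) := hFs.continuous_iteratedDeriv 3 (by norm_cast)
  have h := integral_quintic 0 0 (25 / 2) (-20) 8 0 1
  rw [sieveForm_eq_setIntegral hF 3 le_rfl]
  calc _ ≤ ∫ t in Set.Icc (0 : ℝ) 1,
        (0 + 0 * t + 25 / 2 * t ^ 2 + (-20) * t ^ 3 + 8 * t ^ 4 + 0 * t ^ 5) := by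
        refine MeasureTheory.setIntegral_mono_on ?_ ?_ measurableSet_Icc fun t ht => ?_
        · exact (by fun_prop : Continuous fun t => iteratedDeriv 3 F (t + 0)
            * iteratedDeriv 3 F (t + 0) * (t ^ (3 - 1)
            / ((3 - 1).factorial : ℝ))).continuousOn.integrableOn_compact isCompact_Icc
        · exact (by fun_prop : Continuous fun t : ℝ => 0 + 0 * t + 25 / 2 * t ^ 2 + (-20) * t ^ 3
            + 8 * t ^ 4 + 0 * t ^ 5).continuousOn.integrableOn_compact isCompact_Icc
        · have h1 := hF3 t ht.1 ht.2
          have h2 : iteratedDeriv 3 F t * iteratedDeriv 3 F t ≤ (5 - 4 * t) ^ 2 := by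
            rw [← sq, ← sq_abs]
            gcongr
          have h3 : (t ^ (3 - 1) / ((3 - 1).factorial : ℝ)) = t ^ 2 / 2 := by norm_num
          rw [add_zero, h3]
          have h4 := mul_le_mul_of_nonneg_right h2 (by positivity : 0 ≤ t ^ 2 / 2)
          refine h4.trans_eq ?_
          ring
    _ = 23 / 30 := by
        rw [MeasureTheory.integral_Icc_eq_integral_Ioc,
          ← intervalIntegral.integral_of_le zero_le_one, h]
        norm_num

/-- In the limit the claim is `23/30 < 3 (5η/12 - 7η²/45)`, which is the hypothesis divided by `60`.
The available slack is `1000 ε`, while approximation loses at most `3 (30 + 90) ε = 360 ε`. -/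
theorem exists_sieve_inequality {η : ℝ} (h0 : 0 ≤ η) (h1 : η ≤ 1)
    (h : 28 * η ^ 2 - 75 * η + 46 < 0) : ∃ F : ℝ → ℝ, ContDiff ℝ (⊤ : ℕ∞) F ∧
      HasCompactSupport F ∧ (∀ t, 1 ≤ t → F t = 0) ∧ sieveForm 3 F 0 0
        < 3 * (η * sieveForm 2 F 0 0
          + η ^ 2 * ∫ u in Set.Ioc (0 : ℝ) 1, crossDensity F u) := by
  set ε := -(28 * η ^ 2 - 75 * η + 46) / 60 / 1000 with hε
  have hε0 : 0 < ε := by rw [hε]; linarith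
  obtain ⟨F, hFs, hFc, hF, hF2, hF3⟩ := exists_testFunction hε0
  refine ⟨F, hFs, hFc, hF, ?_⟩
  have k3 := sieveForm_three_le hFs hF hF3
  have k2 := (abs_le.1 (abs_sieveForm_sub_limitForm_le hFs hF hF2 (le_refl 0) (le_refl 0))).1
  have k1 := (abs_le.1 (abs_integral_crossDensity_sub_le hFs hF hF2)).1
  rw [limitForm_zero le_rfl zero_le_one] at k2
  norm_num at k2 k1
  have l2 : η * (5 / 12 - 30 * ε) ≤ η * sieveForm 2 F 0 0 :=
    mul_le_mul_of_nonneg_left (by linarith) h0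
  have l1 : η ^ 2 * (-(7 / 45) - 90 * ε)
      ≤ η ^ 2 * ∫ u in Set.Ioc (0 : ℝ) 1, crossDensity F u :=
    mul_le_mul_of_nonneg_left (by linarith) (sq_nonneg η)
  have l3 : η * ε ≤ ε := mul_le_of_le_one_left hε0.le h1
  have l4 : η ^ 2 * ε ≤ ε := mul_le_of_le_one_left hε0.le (by nlinarith)
  nlinarith

end GapsE2

end

/-! ### Conclusion. -/

theorem theorem4 (θ : ℝ) (hθ : (75 - Real.sqrt 473) / 56 < θ) (hθ1 : θ ≤ 1)
    (hBV : GapsE2.HypBV θ) (hBV2 : GapsE2.HypBV2 θ) :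
    Filter.liminf (fun n : ℕ => ((GapsE2.qSeq (n + 1) - GapsE2.qSeq n : ℕ) : ℕ∞))
      Filter.atTop ≤ 6 := by
  -- The midpoint leaves room on both sides: `η < θ` for the level of distribution, and `η` above
  -- the smaller root for the sieve inequality.
  set η := ((75 - Real.sqrt 473) / 56 + θ) / 2 with hη
  have hs := Real.sq_sqrt (show (0 : ℝ) ≤ 473 by norm_num)
  have hs0 := Real.sqrt_nonneg 473
  have hs1 : Real.sqrt 473 < 22 := by nlinarith
  have h1 : η < θ := by rw [hη]; linarith
  have h2 : (75 - Real.sqrt 473) / 56 < η := by rw [hη]; linarith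
  have h0 : 0 < η := by linarith
  -- The discriminant is `75² - 4 · 28 · 46 = 473`, and the larger root exceeds `1 ≥ θ > η`.
  have hq : 28 * η ^ 2 - 75 * η + 46 < 0 := by
    have e : 28 * η ^ 2 - 75 * η + 46
        = 28 * ((η - (75 - Real.sqrt 473) / 56) * (η - (75 + Real.sqrt 473) / 56)) := by
      linear_combination (1 / 112) * hs
    rw [e]
    have : (η - (75 - Real.sqrt 473) / 56) * (η - (75 + Real.sqrt 473) / 56) < 0 :=
      mul_neg_of_pos_of_neg (by linarith) (by linarith)
    linarith
  obtain ⟨F, hFs, hFc, hF, hlt⟩ := GapsE2.exists_sieve_inequality h0.le (by linarith) hq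
  exact GapsE2.liminf_le_six_of_sieve_inequality hθ1 hBV hBV2 hFs hFc hF h0 h1 hlt
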